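/- Let $L>0$, let $N$ be a positive integer, and for $\varepsilon>0$ and $u=(u_1,u_2)\in H^1((0,1);\mathbb R^2)$, identified with $u_1+iu_2\in H^1((0,1);\mathbb C)$, put $$E_\varepsilon(u)=\int_0^1 \frac{\varepsilon}{2}|u'|^2+\frac1{4\varepsilon}\bigl(|u|^2-1\bigr)^2+\frac L2\bigl(u_1u_2'-u_2u_1'-2\pi N\bigr)^2\,dx .$$ For $\alpha\in[0,2\pi)$ let $\mathcal A_\alpha=\{u\in H^1((0,1);\mathbb C): u(0)=1,\ u(1)=e^{i\alpha}\}$. A function $v\in\mathcal A_\alpha$ is called a critical point of $E_\varepsilon$ in $\mathcal A_\alpha$ if $\frac{d}{dt}\big|_{t=0}E_\varepsilon(v+t\varphi)=0$ for every $\varphi\in H^1_0((0,1);\mathbb C)$. For a positive integer $M$ let $U_M(x)=e^{i(2\pi M+\alpha)x}$, and let $$c_\varepsilon=\inf_{\gamma}\ \max_{t\in[0,1]}E_\varepsilon(\gamma(t)),$$ where $\gamma$ runs over all $H^1$-continuous paths $\gamma:[0,1]\to\mathcal A_\alpha$ with $\gamma(0)=U_M$ and $\gamma(1)=U_{M+1}$.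 Then for every positive integer $M$ and every $\alpha\in[0,2\pi)$ the following hold. (i) If $(M,\alpha)\neq(N,0)$, then for each $\varepsilon>0$ there is a critical point $v_\varepsilon$ of $E_\varepsilon$ in $\mathcal A_\alpha$ such that $$E_\varepsilon(v_\varepsilon)\to 2\pi^2L\Bigl(N-M-\frac{\alpha}{2\pi}\Bigr)^2+\frac{2\sqrt2}{3}\qquad\text{as }\varepsilon\to0^+ .$$ (ii) There is $\varepsilon_0>0$ such that for every $\varepsilon\in(0,\varepsilon_0)$ the mountain pass level $c_\varepsilon$ is a critical value: there is a critical point $w_\varepsilon$ of $E_\varepsilon$ in $\mathcal A_\alpha$ with $E_\varepsilon(w_\varepsilon)=c_\varepsilon$. Moreover $$c_\varepsilon\to 2\pi^2L\,\max\Bigl\{\Bigl(N-M-\frac{\alpha}{2\pi}\Bigr)^2,\ \Bigl(N-M-1-\frac{\alpha}{2\pi}\Bigr)^2\Bigr\}+\frac{2\sqrt2}{3}\qquad\text{as }\varepsilon\to0^+ .$$ -/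

import Mathlib

open Set Filter Topology MeasureTheory

noncomputable section

namespace Cholesteric

/-- The Sobolev space `H¹((0,1); ℂ)`, with `ℂ` in the role of `ℝ²`, through continuous
representatives: a function on the real line (only its values on `[0,1]` matter) that is absolutely
continuous on `[0,1]` and whose derivative, which exists almost everywhere and is the weak
derivative, is square integrable on `(0,1)`. -/
structure MemH1 (u : ℝ → ℂ) : Prop where
  absolutelyContinuous : AbsolutelyContinuousOnInterval u 0 1
  memLp_deriv : MemLp (deriv u) 2 (volume.restrict (Ioo (0 : ℝ) 1))

/-- The space `H¹₀((0,1); ℂ)`. -/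
def MemH10 (φ : ℝ → ℂ) : Prop :=
  MemH1 φ ∧ φ 0 = 0 ∧ φ 1 = 0

/-- The square of the `H¹(0,1)` norm. -/
def h1NormSq (u : ℝ → ℂ) : ℝ :=
  ∫ x in (0 : ℝ)..1, (‖u x‖ ^ 2 + ‖deriv u x‖ ^ 2)

/-- The admissible class: `u ∈ H¹((0,1); ℂ)` with `u(0) = 1` and `u(1) = e^{iα}`. -/
def admissible (α : ℝ) : Set (ℝ → ℂ) :=
  {u | MemH1 u ∧ u 0 = 1 ∧ u 1 = Complex.exp (α * Complex.I)}

/-- The twist `u₁ u₂' - u₂ u₁'`. -/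
def twist (u : ℝ → ℂ) (x : ℝ) : ℝ :=
  (u x).re * (deriv u x).im - (u x).im * (deriv u x).re

/-- The energy `E_ε`. -/
def energy (L : ℝ) (N : ℕ) (ε : ℝ) (u : ℝ → ℂ) : ℝ :=
  ∫ x in (0 : ℝ)..1,
    (ε / 2 * ‖deriv u x‖ ^ 2 + 1 / (4 * ε) * (‖u x‖ ^ 2 - 1) ^ 2
      + L / 2 * (twist u x - 2 * Real.pi * N) ^ 2)

/-- `v` is a critical point of `E_ε` in the admissible class: `v` is admissible and the first
variation of `E_ε` at `v` vanishes in every direction `φ ∈ H¹₀`. -/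
def IsCriticalPoint (L : ℝ) (N : ℕ) (α ε : ℝ) (v : ℝ → ℂ) : Prop :=
  v ∈ admissible α ∧
    ∀ φ : ℝ → ℂ, MemH10 φ →
      HasDerivAt (fun t : ℝ => energy L N ε (fun x => v x + (t : ℂ) * φ x)) 0 0

/-- The twist state of class `M`: `x ↦ e^{i(2πM+α)x}`. -/
def twistState (α : ℝ) (M : ℕ) (x : ℝ) : ℂ :=
  Complex.exp (((2 * Real.pi * M + α) * x : ℝ) * Complex.I)

/-- `γ`, restricted to parameters `t ∈ [0,1]`, is a path in the admissible class, continuous for the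
`H¹` norm, from the twist state of class `M` to the twist state of class `M'`. -/
structure IsTwistPath (α : ℝ) (M M' : ℕ) (γ : ℝ → ℝ → ℂ) : Prop where
  mem : ∀ t ∈ Icc (0 : ℝ) 1, γ t ∈ admissible α
  continuous : ∀ s ∈ Icc (0 : ℝ) 1,
    Tendsto (fun t => h1NormSq (fun x => γ t x - γ s x)) (𝓝[Icc 0 1] s) (𝓝 0)
  source : EqOn (γ 0) (twistState α M) (Icc 0 1)
  target : EqOn (γ 1) (twistState α M') (Icc 0 1)

/-- The mountain pass level between the twist states of classes `M` and `M'`: the infimum, over all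
continuous paths `γ` joining them in the admissible class, of `max_{t ∈ [0,1]} E_ε(γ(t))`. -/
def mountainPassLevel (L : ℝ) (N : ℕ) (α ε : ℝ) (M M' : ℕ) : ℝ :=
  sInf {m : ℝ | ∃ γ : ℝ → ℝ → ℂ, IsTwistPath α M M' γ ∧
    IsGreatest ((fun t => energy L N ε (γ t)) '' Icc (0 : ℝ) 1) m}

end Cholesteric

end

/-! An admissible curve is determined by its derivative, which is the constant `refDeriv α` plus a
mean-zero `L²` function `f`. In the variable `f` the energy is a weighted sum of three squared norms
of maps of degree at most two, hence smooth enough for a gradient flow step. Taking primitives is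
compact from `L²` to `C⁰`, and the part of the gradient that is not controlled by this compactness
is monotone; so the Palais–Smale condition holds at every level (`TwistModel.palaisSmaleAt`). The
mountain pass theorem (`exists_critical_minimaxLevel`) then makes a minimax level critical as soon
as it exceeds the energy of both ends, and everything reduces to computing limits of minimax levels.

Lower bound. On curves without zeros `∫ u'/u` depends continuously on the curve, and its exponential
is fixed by the boundary values; hence it is constant along a path as long as the modulus stays
above some `δ > 0`. A path from the twist state of class `M` to a state with a zero, or to another
twist state, must therefore contain a curve whose minimal modulus is `δ` while its phase increment
is still `2πM + α` (`exists_crossing_of_separated`). For this curve the Modica–Mortola inequality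
bounds the Ginzburg–Landau part below by `√2 (2/3 - δ)`. The total twist differs from the phase
increment by `O(√ε)`, so Jensen's inequality gives the twist energy of class `M` up to a small error
(`le_energy_of_layer`).

Upper bound. Insert at `1/2` a `tanh` wall of width comparable to `ε`, and deepen it until the curve
vanishes there. The zero decouples the phases of the two halves, so the twist rate `k` can be
changed continuously; the wall is then closed again. Up to a small error the energy stays below `L/2
(k - 2πN)² + 2√2/3`, which is convex in `k`, so only the two end rates matter
(`eventually_joinedIn`).

For (ii) the lower bound is applied from both ends. For (i) the path runs from the twist state of
class `M` to the wall with `k = 2πN`, whose energy is at most about `2√2/3`; the level tends to the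
twist energy of class `M` plus `2√2/3`. It lies above both ends exactly because this twist energy is
positive when `(M, α) ≠ (N, 0)`. -/

noncomputable section

/-! ### Minimax levels over paths in a topological space. -/

section Minimax

open scoped unitInterval

variable {Y : Type*} [TopologicalSpace Y]

/-- The minimax level over the paths from `a` to `b`. -/
def minimaxLevel (E : Y → ℝ) (a b : Y) : ℝ :=
  sInf {m : ℝ | ∃ γ : Path a b, IsGreatest (range fun t => E (γ t)) m}

theorem exists_isGreatest_path {E : Y → ℝ} {a b : Y} (hE : Continuous E) (γ : Path a b) :
    ∃ m, IsGreatest (range fun t => E (γ t)) m :=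
  (isCompact_range (hE.comp γ.continuous)).exists_isGreatest (range_nonempty _)

theorem bddBelow_minimax (E : Y → ℝ) (a b : Y) :
    BddBelow {m : ℝ | ∃ γ : Path a b, IsGreatest (range fun t => E (γ t)) m} :=
  ⟨E a, fun _ ⟨γ, hm⟩ => hm.2 ⟨0, by simp⟩⟩

theorem minimaxLevel_le {E : Y → ℝ} (hE : Continuous E) {a b : Y} {m : ℝ} (h : JoinedIn {x | E x ≤ m} a b) :
    minimaxLevel E a b ≤ m := by
  obtain ⟨γ, hγ⟩ := h
  obtain ⟨m', hm'⟩ := exists_isGreatest_path hE γ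
  obtain ⟨t, ht⟩ := hm'.1
  exact (csInf_le (bddBelow_minimax E a b) ⟨γ, hm'⟩).trans (ht ▸ hγ t)

theorem le_minimaxLevel [PathConnectedSpace Y] {E : Y → ℝ} (hE : Continuous E) {a b : Y} {m : ℝ}
    (h : ∀ γ : Path a b, ∃ t, m ≤ E (γ t)) : m ≤ minimaxLevel E a b := by
  refine le_csInf ?_ ?_
  · obtain ⟨γ⟩ : Nonempty (Path a b) := PathConnectedSpace.joined a b
    obtain ⟨m', hm'⟩ := exists_isGreatest_path hE γ
    exact ⟨m', γ, hm'⟩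
  · rintro m' ⟨γ, hm'⟩
    obtain ⟨t, ht⟩ := h γ
    exact ht.trans (hm'.2 ⟨t, rfl⟩)

end Minimax

/-! ### The mountain pass theorem in a Hilbert space. -/

section MountainPass

open scoped RealInnerProductSpace unitInterval

variable {X : Type*} [NormedAddCommGroup X] [InnerProductSpace ℝ X]

/-- `G` is a gradient of `E`, with a quadratic remainder that is uniform on bounded sets. -/
structure HasQuadRemainder (E : X → ℝ) (G : X → X) : Prop where
  continuous_grad : Continuous G
  bounded_grad : ∀ R : ℝ, ∃ B : ℝ, ∀ x, ‖x‖ ≤ R → ‖G x‖ ≤ B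
  remainder : ∀ R : ℝ, ∃ C : ℝ, ∀ x h, ‖x‖ ≤ R → ‖h‖ ≤ R →
    |E (x + h) - E x - ⟪G x, h⟫| ≤ C * ‖h‖ ^ 2

namespace HasQuadRemainder

variable {E F : X → ℝ} {G G' : X → X}

theorem add (h : HasQuadRemainder E G) (h' : HasQuadRemainder F G') :
    HasQuadRemainder (fun x => E x + F x) (fun x => G x + G' x) where
  continuous_grad := h.continuous_grad.add h'.continuous_grad
  bounded_grad R := by
    obtain ⟨B, hB⟩ := h.bounded_grad R
    obtain ⟨B', hB'⟩ := h'.bounded_grad R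
    exact ⟨B + B', fun x hx => (norm_add_le _ _).trans (add_le_add (hB x hx) (hB' x hx))⟩
  remainder R := by
    obtain ⟨C, hC⟩ := h.remainder R
    obtain ⟨C', hC'⟩ := h'.remainder R
    refine ⟨C + C', fun x k hx hk => ?_⟩
    have h1 := abs_le.1 (hC x k hx hk)
    have h2 := abs_le.1 (hC' x k hx hk)
    rw [inner_add_left, abs_le]
    constructor <;> nlinarith

theorem const_mul (h : HasQuadRemainder E G) (c : ℝ) :
    HasQuadRemainder (fun x => c * E x) (fun x => c • G x) where
  continuous_grad := h.continuous_grad.const_smul c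
  bounded_grad R := by
    obtain ⟨B, hB⟩ := h.bounded_grad R
    refine ⟨|c| * B, fun x hx => ?_⟩
    rw [norm_smul, Real.norm_eq_abs]
    exact mul_le_mul_of_nonneg_left (hB x hx) (abs_nonneg c)
  remainder R := by
    obtain ⟨C, hC⟩ := h.remainder R
    refine ⟨|c| * C, fun x k hx hk => ?_⟩
    have : c * E (x + k) - c * E x - ⟪c • G x, k⟫ = c * (E (x + k) - E x - ⟪G x, k⟫) := by
      rw [real_inner_smul_left]; ring
    rw [this, abs_mul, mul_assoc]
    exact mul_le_mul_of_nonneg_left (hC x k hx hk) (abs_nonneg c)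

theorem continuous (h : HasQuadRemainder E G) : Continuous E := by
  rw [continuous_iff_continuousAt]
  intro x
  obtain ⟨C, hC⟩ := h.remainder (‖x‖ + 1)
  have hlim : Tendsto (fun y => ⟪G x, y - x⟫ + C * ‖y - x‖ ^ 2) (𝓝 x) (𝓝 0) := by
    have : Continuous fun y => ⟪G x, y - x⟫ + C * ‖y - x‖ ^ 2 := by fun_prop
    simpa using this.tendsto x
  have hlim' : Tendsto (fun y => ⟪G x, y - x⟫ - C * ‖y - x‖ ^ 2) (𝓝 x) (𝓝 0) := by
    have : Continuous fun y => ⟪G x, y - x⟫ - C * ‖y - x‖ ^ 2 := by fun_prop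
    simpa using this.tendsto x
  rw [ContinuousAt, ← tendsto_sub_nhds_zero_iff]
  have hball : ∀ᶠ y in 𝓝 x, ‖y - x‖ ≤ ‖x‖ + 1 := by
    filter_upwards [Metric.closedBall_mem_nhds x one_pos] with y hy
    rw [Metric.mem_closedBall, dist_eq_norm] at hy
    linarith [norm_nonneg x]
  refine tendsto_of_tendsto_of_tendsto_of_le_of_le' hlim' hlim ?_ ?_
  all_goals
    filter_upwards [hball] with y hy
    have := abs_le.1 (hC x (y - x) (by linarith) hy)
    rw [add_sub_cancel] at this
    linarith [this.1, this.2]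

theorem hasDerivAt_line (h : HasQuadRemainder E G) (x k : X) :
    HasDerivAt (fun t : ℝ => E (x + t • k)) ⟪G x, k⟫ 0 := by
  obtain ⟨C, hC⟩ := h.remainder (‖x‖ + ‖k‖)
  rw [hasDerivAt_iff_isLittleO]
  refine Asymptotics.IsBigO.trans_isLittleO (g := fun t : ℝ => t ^ 2) ?_ ?_
  · refine Asymptotics.IsBigO.of_bound (C * ‖k‖ ^ 2) ?_
    filter_upwards [Metric.closedBall_mem_nhds (0 : ℝ) one_pos] with t ht
    rw [Metric.mem_closedBall, dist_zero_right, Real.norm_eq_abs] at ht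
    have hk : ‖t • k‖ ≤ ‖x‖ + ‖k‖ := by
      rw [norm_smul, Real.norm_eq_abs]
      nlinarith [norm_nonneg x, norm_nonneg k]
    have := hC x (t • k) (by linarith [norm_nonneg k]) hk
    rw [real_inner_smul_right, norm_smul, mul_pow] at this
    simp only [zero_smul, add_zero, sub_zero, smul_eq_mul, Real.norm_eq_abs, abs_pow] at *
    linarith
  · simpa using Asymptotics.isLittleO_pow_id (𝕜 := ℝ) (n := 2) (by norm_num)

end HasQuadRemainder

/-- The Palais–Smale condition at level `c`. -/
def PalaisSmaleAt (E : X → ℝ) (G : X → X) (c : ℝ) : Prop :=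
  ∀ x : ℕ → X, Tendsto (fun n => E (x n)) atTop (𝓝 c) → Tendsto (fun n => ‖G (x n)‖) atTop (𝓝 0) →
    ∃ y, ∃ φ : ℕ → ℕ, StrictMono φ ∧ Tendsto (x ∘ φ) atTop (𝓝 y)

variable {E : X → ℝ} {G : X → X} {c : ℝ}

/-- Otherwise there would be a Palais–Smale sequence at level `c`, and its limit point would be
critical at that level. -/
theorem PalaisSmaleAt.exists_norm_ge (hE : HasQuadRemainder E G) (hPS : PalaisSmaleAt E G c)
    (hc : ∀ x, E x = c → G x ≠ 0) :
    ∃ d > 0, ∃ ρ > 0, ∀ x, |E x - c| ≤ d → ρ ≤ ‖G x‖ := by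
  by_contra! H
  have hpos : ∀ n : ℕ, (0 : ℝ) < 1 / (n + 1) := fun n => Nat.one_div_pos_of_nat
  choose x hx hG using fun n : ℕ => H _ (hpos n) _ (hpos n)
  have h0 := tendsto_one_div_add_atTop_nhds_zero_nat (𝕜 := ℝ)
  have hEx : Tendsto (fun n => E (x n)) atTop (𝓝 c) := by
    rw [← tendsto_sub_nhds_zero_iff]
    exact squeeze_zero_norm hx h0
  have hGx : Tendsto (fun n => ‖G (x n)‖) atTop (𝓝 0) :=
    squeeze_zero (fun n => norm_nonneg _) (fun n => (hG n).le) h0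
  obtain ⟨y, φ, hφ, hy⟩ := hPS x hEx hGx
  refine hc y (tendsto_nhds_unique ((hE.continuous.tendsto y).comp hy)
    (hEx.comp hφ.tendsto_atTop)) ?_
  rw [← norm_eq_zero]
  exact tendsto_nhds_unique ((hE.continuous_grad.norm.tendsto y).comp hy)
    (hGx.comp hφ.tendsto_atTop)

/-- Deformation through a regular level, by one truncated gradient step. -/
theorem exists_deformation (hE : HasQuadRemainder E G)
    (hbdd : ∀ m, ∃ R, ∀ x, E x ≤ m → ‖x‖ ≤ R) (hPS : PalaisSmaleAt E G c)
    (hc : ∀ x, E x = c → G x ≠ 0) {κ : ℝ} (hκ : 0 < κ) :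
    ∃ δ > 0, ∃ T : X → X, Continuous T ∧ (∀ x, E x ≤ c - κ → T x = x) ∧
      ∀ x, E x ≤ c + δ → E (T x) ≤ c - δ := by
  obtain ⟨d₀, hd₀, ρ, hρ, hGρ⟩ := hPS.exists_norm_ge hE hc
  set d := min d₀ κ with hd
  have hdpos : 0 < d := lt_min hd₀ hκ
  obtain ⟨R, hR⟩ := hbdd (c + d)
  obtain ⟨B, hB⟩ := hE.bounded_grad R
  obtain ⟨C, hC⟩ := hE.remainder (max R B)
  -- The bound `η ≤ 1` keeps the step `η • G x` within the radius where `C` is valid; `C * η ≤ 1 /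
  -- 2` lets the quadratic remainder consume at most half of the first-order decrease.
  set η : ℝ := min 1 (1 / (2 * (|C| + 1))) with hη
  have hCpos : 0 < 2 * (|C| + 1) := by positivity
  have hηpos : 0 < η := lt_min one_pos (by positivity)
  have hη1 : η ≤ 1 := min_le_left _ _
  have hηC : C * η ≤ 1 / 2 := by
    have h1 : η * (2 * (|C| + 1)) ≤ 1 := by
      have : η ≤ 1 / (2 * (|C| + 1)) := min_le_right _ _
      rwa [le_div_iff₀ hCpos] at this
    nlinarith [le_abs_self C]
  -- The cut-off vanishes below `c - d`, which contains the sublevel `c - κ` because `d ≤ κ`, and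
  -- equals `1` above `c - d / 2`.
  set χ : ℝ → ℝ := fun s => max 0 (min 1 ((s - (c - d)) / (d / 2))) with hχ
  have hχ0 : ∀ s, 0 ≤ χ s := fun s => le_max_left _ _
  have hχ1 : ∀ s, χ s ≤ 1 := fun s => max_le zero_le_one (min_le_left _ _)
  have hχlow : ∀ s, s ≤ c - d → χ s = 0 := fun s hs =>
    max_eq_left ((min_le_right _ _).trans (div_nonpos_of_nonpos_of_nonneg (by linarith)
      (by linarith)))
  have hχhigh : ∀ s, c - d / 2 ≤ s → χ s = 1 := fun s hs => by
    have : 1 ≤ (s - (c - d)) / (d / 2) := by rw [le_div_iff₀ (by linarith)]; linarith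
    simp [hχ, min_eq_left this]
  have hχcont : Continuous χ := by fun_prop
  set T : X → X := fun x => x + (-(η * χ (E x))) • G x with hT
  have hTcont : Continuous T :=
    continuous_id.add (((hχcont.comp hE.continuous).const_mul η).neg.smul hE.continuous_grad)
  have hdesc : ∀ x, E x ≤ c + d → E (T x) ≤ E x - η * χ (E x) / 2 * ‖G x‖ ^ 2 := by
    intro x hx
    set r := η * χ (E x) with hr
    have hr0 : 0 ≤ r := mul_nonneg hηpos.le (hχ0 _)
    have hrη : r ≤ η := mul_le_of_le_one_right hηpos.le (hχ1 _)
    have hGB := hB x (hR x hx)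
    have hstep : ‖(-r) • G x‖ ≤ max R B := by
      rw [norm_smul, Real.norm_eq_abs, abs_neg, abs_of_nonneg hr0]
      refine le_trans ?_ (le_max_right R B)
      nlinarith [norm_nonneg (G x)]
    have := (abs_le.1 (hC x ((-r) • G x) ((hR x hx).trans (le_max_left _ _)) hstep)).2
    rw [real_inner_smul_right, real_inner_self_eq_norm_sq, norm_smul, Real.norm_eq_abs, abs_neg,
      abs_of_nonneg hr0, mul_pow] at this
    have hCr : C * r ≤ 1 / 2 := by
      rcases le_total 0 C with h | h
      · exact (mul_le_mul_of_nonneg_left hrη h).trans hηC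
      · nlinarith
    have : C * (r ^ 2 * ‖G x‖ ^ 2) ≤ 1 / 2 * (r * ‖G x‖ ^ 2) := by
      have : C * (r ^ 2 * ‖G x‖ ^ 2) = C * r * (r * ‖G x‖ ^ 2) := by ring
      rw [this]
      exact mul_le_mul_of_nonneg_right hCr (by positivity)
    change E (x + (-r) • G x) ≤ _
    linarith
  -- Either the energy is already below `c - d / 2` and does not increase, or the full step lowers
  -- it by at least `η ρ² / 2 ≥ 2δ`.
  refine ⟨min (d / 2) (η * ρ ^ 2 / 4), by positivity, T, hTcont, fun x hx => ?_, fun x hx => ?_⟩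
  · have : χ (E x) = 0 := hχlow _ (by linarith [min_le_right d₀ κ])
    simp [hT, this]
  · have hδ1 := min_le_left (d / 2) (η * ρ ^ 2 / 4)
    have hδ2 := min_le_right (d / 2) (η * ρ ^ 2 / 4)
    have hD := hdesc x (by linarith)
    by_cases hlow : E x ≤ c - d / 2
    · have : 0 ≤ η * χ (E x) / 2 * ‖G x‖ ^ 2 := by
        have := hχ0 (E x)
        positivity
      linarith
    · push Not at hlow
      rw [hχhigh _ hlow.le] at hD
      have hge : ρ ≤ ‖G x‖ := hGρ x (by
        rw [abs_le]; constructor <;> linarith [min_le_left d₀ κ])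
      have : ρ ^ 2 ≤ ‖G x‖ ^ 2 := by gcongr
      nlinarith

/-- If there were no critical point at all, the deformation at the level of the infimum would push
some point below the infimum. -/
theorem exists_critical_minimizer (hE : HasQuadRemainder E G)
    (hbdd : ∀ m, ∃ R, ∀ x, E x ≤ m → ‖x‖ ≤ R) (hPS : ∀ c, PalaisSmaleAt E G c)
    (hbelow : BddBelow (range E)) : ∃ x, G x = 0 := by
  by_contra! H
  obtain ⟨δ, hδ, T, -, -, hT⟩ :=
    exists_deformation hE hbdd (hPS (⨅ x, E x)) (fun x _ => H x) one_pos
  obtain ⟨x, hx⟩ := exists_lt_of_ciInf_lt (show ⨅ x, E x < (⨅ x, E x) + δ by linarith)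
  linarith [hT x hx.le, ciInf_le hbelow (T x)]

/-- The mountain pass theorem. -/
theorem exists_critical_minimaxLevel (hE : HasQuadRemainder E G)
    (hbdd : ∀ m, ∃ R, ∀ x, E x ≤ m → ‖x‖ ≤ R) (hPS : ∀ c, PalaisSmaleAt E G c) {a b : X}
    (ha : E a < minimaxLevel E a b) (hb : E b < minimaxLevel E a b) :
    ∃ x, E x = minimaxLevel E a b ∧ G x = 0 := by
  set c := minimaxLevel E a b with hc
  by_contra! H
  have hκ : 0 < c - max (E a) (E b) := sub_pos.2 (max_lt ha hb)
  obtain ⟨δ, hδ, T, hTc, hTfix, hT⟩ := exists_deformation hE hbdd (hPS c) H hκ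
  have hfa : T a = a := hTfix a (by linarith [le_max_left (E a) (E b)])
  have hfb : T b = b := hTfix b (by linarith [le_max_right (E a) (E b)])
  have hne : {m : ℝ | ∃ γ : Path a b, IsGreatest (range fun t => E (γ t)) m}.Nonempty := by
    obtain ⟨γ⟩ : Nonempty (Path a b) := PathConnectedSpace.joined a b
    obtain ⟨m', hm'⟩ := exists_isGreatest_path hE.continuous γ
    exact ⟨m', γ, hm'⟩
  obtain ⟨m, ⟨γ, hm⟩, hlt⟩ := exists_lt_of_csInf_lt hne (show c < c + δ by linarith)
  have hle : c ≤ c - δ := by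
    -- The deformation fixes both ends, so the image of a nearly optimal path competes for the
    -- level, with maximum at most `c - δ`.
    refine minimaxLevel_le hE.continuous ⟨(γ.map hTc).cast hfa.symm hfb.symm, fun t => ?_⟩
    exact hT _ ((hm.2 ⟨t, rfl⟩).trans hlt.le)
  linarith

end MountainPass

end

noncomputable section

/-! ### Squared norms of quadratic maps. -/

section QuadraticEnergy

open scoped RealInnerProductSpace

variable {X Z : Type*} [NormedAddCommGroup X] [InnerProductSpace ℝ X]
  [NormedAddCommGroup Z] [InnerProductSpace ℝ Z]

/-- The map `x ↦ a + l x + b x x`. -/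
def quadMap (a : Z) (l : X →L[ℝ] Z) (b : X →L[ℝ] X →L[ℝ] Z) (x : X) : Z := a + l x + b x x

/-- The derivative of `quadMap`. -/
def quadMapDeriv (l : X →L[ℝ] Z) (b : X →L[ℝ] X →L[ℝ] Z) (x : X) : X →L[ℝ] Z :=
  l + b x + b.flip x

variable (a : Z) (l : X →L[ℝ] Z) (b : X →L[ℝ] X →L[ℝ] Z)

theorem norm_quadMap_le {R : ℝ} {x : X} (hx : ‖x‖ ≤ R) :
    ‖quadMap a l b x‖ ≤ ‖a‖ + ‖l‖ * R + ‖b‖ * R * R := by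
  have hR : 0 ≤ R := (norm_nonneg x).trans hx
  refine (norm_add₃_le).trans ?_
  gcongr
  · exact (l.le_opNorm x).trans (by gcongr)
  · exact (b.le_opNorm₂ x x).trans (by gcongr)

theorem norm_quadMapDeriv_le {R : ℝ} {x : X} (hx : ‖x‖ ≤ R) :
    ‖quadMapDeriv l b x‖ ≤ ‖l‖ + ‖b‖ * R + ‖b‖ * R := by
  refine (norm_add₃_le).trans ?_
  gcongr
  · exact (b.le_opNorm x).trans (by gcongr)
  · refine (b.flip.le_opNorm x).trans ?_
    rw [ContinuousLinearMap.opNorm_flip]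
    gcongr

variable [CompleteSpace X] [CompleteSpace Z]

/-- The gradient of the square of the norm of `quadMap`. -/
def quadGrad (x : X) : X :=
  (2 : ℝ) • ContinuousLinearMap.adjoint (quadMapDeriv l b x) (quadMap a l b x)

theorem inner_quadGrad (x h : X) :
    ⟪quadGrad a l b x, h⟫ = 2 * ⟪quadMap a l b x, l h + b x h + b h x⟫ := by
  rw [quadGrad, real_inner_smul_left, ContinuousLinearMap.adjoint_inner_left]
  simp [quadMapDeriv]

theorem hasQuadRemainder_normSq_quadMap :
    HasQuadRemainder (fun x => ‖quadMap a l b x‖ ^ 2) (quadGrad a l b) where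
  continuous_grad := by
    have h1 : Continuous fun x => quadMapDeriv l b x := by unfold quadMapDeriv; fun_prop
    have h2 : Continuous fun x => quadMap a l b x := by unfold quadMap; fun_prop
    have h3 : Continuous fun x => ContinuousLinearMap.adjoint (quadMapDeriv l b x) :=
      (ContinuousLinearMap.adjoint : (X →L[ℝ] Z) ≃ₗᵢ⋆[ℝ] _).continuous.comp h1
    exact (h3.clm_apply h2).const_smul 2
  bounded_grad R := by
    refine ⟨2 * ((‖l‖ + ‖b‖ * R + ‖b‖ * R) * (‖a‖ + ‖l‖ * R + ‖b‖ * R * R)), fun x hx => ?_⟩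
    have hR : 0 ≤ R := (norm_nonneg x).trans hx
    rw [quadGrad, norm_smul, Real.norm_ofNat]
    gcongr
    refine (ContinuousLinearMap.le_opNorm _ _).trans ?_
    rw [LinearIsometryEquiv.norm_map]
    gcongr
    · exact norm_quadMapDeriv_le l b hx
    · exact norm_quadMap_le a l b hx
  remainder R := by
    refine ⟨(‖l‖ + ‖b‖ * R + ‖b‖ * R + ‖b‖ * R) ^ 2
      + 2 * ((‖a‖ + ‖l‖ * R + ‖b‖ * R * R) * ‖b‖), fun x h hx hh => ?_⟩
    have hR : 0 ≤ R := (norm_nonneg x).trans hx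
    set A := quadMap a l b x
    set p := quadMapDeriv l b x h + b h h with hp
    have hexp : quadMap a l b (x + h) = A + p := by
      simp only [A, hp, quadMap, quadMapDeriv, map_add, add_apply, ContinuousLinearMap.flip_apply]
      abel
    have hinner : ⟪quadGrad a l b x, h⟫ = 2 * ⟪A, p⟫ - 2 * ⟪A, b h h⟫ := by
      rw [inner_quadGrad, hp]
      simp only [quadMapDeriv, add_apply, ContinuousLinearMap.flip_apply,
        inner_add_right]
      ring
    -- The increment `p` is its linear part plus `b h h`. Removing the linear part from the cross
    -- term `2⟪A, p⟫` leaves only terms of order `‖h‖²`.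
    have heq : ‖quadMap a l b (x + h)‖ ^ 2 - ‖A‖ ^ 2 - ⟪quadGrad a l b x, h⟫
        = ‖p‖ ^ 2 + 2 * ⟪A, b h h⟫ := by
      rw [hexp, norm_add_sq_real, hinner]; ring
    have hpn : ‖p‖ ≤ (‖l‖ + ‖b‖ * R + ‖b‖ * R + ‖b‖ * R) * ‖h‖ := by
      refine (norm_add_le _ _).trans ?_
      rw [add_mul]
      gcongr
      · exact (ContinuousLinearMap.le_opNorm _ _).trans
          (by gcongr; exact norm_quadMapDeriv_le l b hx)
      · exact (b.le_opNorm₂ h h).trans (by gcongr)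
    have hAn : |⟪A, b h h⟫| ≤ (‖a‖ + ‖l‖ * R + ‖b‖ * R * R) * ‖b‖ * ‖h‖ ^ 2 := by
      refine (abs_real_inner_le_norm _ _).trans ?_
      rw [mul_assoc]
      gcongr
      · exact norm_quadMap_le a l b hx
      · exact (b.le_opNorm₂ h h).trans_eq (by ring)
    rw [heq]
    refine (abs_add_le _ _).trans ?_
    rw [abs_mul, abs_two, abs_of_nonneg (by positivity : (0 : ℝ) ≤ ‖p‖ ^ 2)]
    have : ‖p‖ ^ 2 ≤ ((‖l‖ + ‖b‖ * R + ‖b‖ * R + ‖b‖ * R) * ‖h‖) ^ 2 := by gcongr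
    nlinarith

end QuadraticEnergy

/-! ### An abstract twist energy: gradient, coercivity and the Palais–Smale condition. -/

section TwistModel

open scoped RealInnerProductSpace

/-- The data of an energy of Ginzburg–Landau type with a twist term on a Hilbert space `X`: the
derivative is `d₀ + ι f`, the field itself is `u₀ + K f` with `K` a compact operator. -/
structure TwistModel (X H V Z : Type*) [NormedAddCommGroup X] [InnerProductSpace ℝ X]
    [NormedAddCommGroup H] [InnerProductSpace ℝ H] [NormedAddCommGroup V] [NormedSpace ℝ V]
    [NormedAddCommGroup Z] [InnerProductSpace ℝ Z] where
  ι : X →ₗᵢ[ℝ] H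
  K : X →L[ℝ] V
  d₀ : H
  u₀ : V
  S : V →L[ℝ] V →L[ℝ] Z
  B : V →L[ℝ] H →L[ℝ] Z
  e : Z
  κ : Z
  compact : ∀ (R : ℝ) (f : ℕ → X), (∀ n, ‖f n‖ ≤ R) →
    ∃ φ : ℕ → ℕ, StrictMono φ ∧ CauchySeq (fun n => K (f (φ n)))

namespace TwistModel

variable {X H V Z : Type*} [NormedAddCommGroup X] [InnerProductSpace ℝ X]
    [NormedAddCommGroup H] [InnerProductSpace ℝ H] [NormedAddCommGroup V] [NormedSpace ℝ V]
    [NormedAddCommGroup Z] [InnerProductSpace ℝ Z]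
    (m : TwistModel X H V Z)

/-- The derivative of the field. -/
def D (f : X) : H := m.d₀ + m.ι f

/-- The field. -/
def U (f : X) : V := m.u₀ + m.K f

/-- The energy. -/
def energy (p q r : ℝ) (f : X) : ℝ :=
  p * ‖m.D f‖ ^ 2 + q * ‖m.S (m.U f) (m.U f) - m.e‖ ^ 2 + r * ‖m.B (m.U f) (m.D f) - m.κ‖ ^ 2

/-- The first variation of the energy. -/
def variation (p q r : ℝ) (f h : X) : ℝ :=
  p * (2 * ⟪m.D f, m.ι h⟫)
    + q * (2 * ⟪m.S (m.U f) (m.U f) - m.e, m.S (m.U f) (m.K h) + m.S (m.K h) (m.U f)⟫)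
    + r * (2 * ⟪m.B (m.U f) (m.D f) - m.κ, m.B (m.K h) (m.D f) + m.B (m.U f) (m.ι h)⟫)

/-- Expanding `U` and `D` around the reference data `u₀`, `d₀` exhibits each of the three terms as
the squared norm of a `quadMap`. -/
theorem exists_hasQuadRemainder [CompleteSpace X] [CompleteSpace H] [CompleteSpace Z] (p q r : ℝ) :
    ∃ G : X → X, HasQuadRemainder (m.energy p q r) G ∧
      ∀ f h, ⟪G f, h⟫ = m.variation p q r f h := by
  set ι := m.ι.toContinuousLinearMap with hι
  have hι' : ∀ f, ι f = m.ι f := fun f => rfl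
  set a₂ := m.S m.u₀ m.u₀ - m.e
  set l₂ := (m.S m.u₀).comp m.K + (m.S.flip m.u₀).comp m.K with hl₂
  set b₂ := m.S.bilinearComp m.K m.K with hb₂
  set a₃ := m.B m.u₀ m.d₀ - m.κ
  set l₃ := (m.B m.u₀).comp ι + (m.B.flip m.d₀).comp m.K with hl₃
  set b₃ := m.B.bilinearComp m.K ι with hb₃
  have e₁ : ∀ f, quadMap m.d₀ ι 0 f = m.D f := fun f => by simp [quadMap, D, hι']
  have e₂ : ∀ f, quadMap a₂ l₂ b₂ f = m.S (m.U f) (m.U f) - m.e := fun f => by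
    simp only [quadMap, a₂, hl₂, hb₂, U, map_add, add_apply,
      ContinuousLinearMap.comp_apply, ContinuousLinearMap.flip_apply,
      ContinuousLinearMap.bilinearComp_apply]
    abel
  have e₃ : ∀ f, quadMap a₃ l₃ b₃ f = m.B (m.U f) (m.D f) - m.κ := fun f => by
    simp only [quadMap, a₃, hl₃, hb₃, U, D, map_add, add_apply,
      ContinuousLinearMap.comp_apply, ContinuousLinearMap.flip_apply,
      ContinuousLinearMap.bilinearComp_apply, hι']
    abel
  have key := (((hasQuadRemainder_normSq_quadMap m.d₀ ι 0).const_mul p).add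
      ((hasQuadRemainder_normSq_quadMap a₂ l₂ b₂).const_mul q)).add
      ((hasQuadRemainder_normSq_quadMap a₃ l₃ b₃).const_mul r)
  simp only [e₁, e₂, e₃] at key
  refine ⟨_, key, ?_⟩
  · intro f h
    simp only [inner_add_left, real_inner_smul_left, inner_quadGrad, e₁, e₂, e₃, variation]
    have h₂ : l₂ h + b₂ f h + b₂ h f = m.S (m.U f) (m.K h) + m.S (m.K h) (m.U f) := by
      simp only [hl₂, hb₂, U, map_add, add_apply,
        ContinuousLinearMap.comp_apply, ContinuousLinearMap.flip_apply,
        ContinuousLinearMap.bilinearComp_apply]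
      abel
    have h₃ : l₃ h + b₃ f h + b₃ h f = m.B (m.K h) (m.D f) + m.B (m.U f) (m.ι h) := by
      simp only [hl₃, hb₃, U, D, map_add, add_apply,
        ContinuousLinearMap.comp_apply, ContinuousLinearMap.flip_apply,
        ContinuousLinearMap.bilinearComp_apply, hι']
      abel
    rw [h₂, h₃]
    simp [hι']

variable {p q r : ℝ}

/-- Coercivity comes from the derivative term alone, since `ι` is an isometry and the other two
terms are nonnegative. -/
theorem bounded_sublevel (hp : 0 < p) (hq : 0 ≤ q) (hr : 0 ≤ r) (M : ℝ) :
    ∃ R, ∀ f, m.energy p q r f ≤ M → ‖f‖ ≤ R := by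
  refine ⟨√(M / p) + ‖m.d₀‖, fun f hf => ?_⟩
  have h1 : p * ‖m.D f‖ ^ 2 ≤ M := by
    refine le_trans ?_ hf
    unfold energy
    have : 0 ≤ q * ‖m.S (m.U f) (m.U f) - m.e‖ ^ 2 := by positivity
    have : 0 ≤ r * ‖m.B (m.U f) (m.D f) - m.κ‖ ^ 2 := by positivity
    linarith
  have h2 : ‖m.D f‖ ≤ √(M / p) := by
    apply Real.le_sqrt_of_sq_le
    rw [le_div_iff₀ hp]
    linarith
  have h3 : m.ι f = m.D f - m.d₀ := by simp [D]
  rw [← m.ι.norm_map, h3]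
  exact (norm_sub_le _ _).trans (by gcongr)

/-- The monotonicity of the leading part of the first variation, up to a compact perturbation. -/
theorem exists_monotone_bound (hr : 0 ≤ r) (hq : 0 ≤ q) (R : ℝ) :
    ∃ C, ∀ f g : X, ‖f‖ ≤ R → ‖g‖ ≤ R →
      2 * p * ‖f - g‖ ^ 2 ≤ C * ‖m.K (f - g)‖
        + (m.variation p q r f (f - g) - m.variation p q r g (f - g)) := by
  by_cases hR : 0 ≤ R
  swap
  · exact ⟨0, fun f _ hf => absurd ((norm_nonneg f).trans hf) hR⟩
  set u := ‖m.u₀‖ + ‖m.K‖ * R with hu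
  set d := ‖m.d₀‖ + R with hd
  set s := ‖m.S‖
  set b := ‖m.B‖
  have hU : ∀ f : X, ‖f‖ ≤ R → ‖m.U f‖ ≤ u := fun f hf => by
    refine (norm_add_le _ _).trans ?_
    rw [hu]
    gcongr
    exact (m.K.le_opNorm f).trans (by gcongr)
  have hD : ∀ f : X, ‖f‖ ≤ R → ‖m.D f‖ ≤ d := fun f hf => by
    refine (norm_add_le _ _).trans ?_
    rw [m.ι.norm_map, hd]
    gcongr
  have hu0 : 0 ≤ u := by positivity
  have hd0 : 0 ≤ d := by positivity
  have hS : ∀ v w : V, ‖m.S v w‖ ≤ s * ‖v‖ * ‖w‖ := fun v w => m.S.le_opNorm₂ v w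
  have hB : ∀ v w, ‖m.B v w‖ ≤ b * ‖v‖ * ‖w‖ := fun v w => m.B.le_opNorm₂ v w
  set CS := (s * u * u + ‖m.e‖) * (s * u + s * u) with hCS
  set CB := (b * u * d + ‖m.κ‖) with hCB
  have hCB0 : 0 ≤ CB := by positivity
  refine ⟨2 * q * (CS + CS) + 2 * r * (CB * (b * d) + CB * (b * d)
    + (b * d * (b * u * (2 * R)) + CB * (b * (2 * R)))), fun f g hf hg => ?_⟩
  set h := f - g with hh
  set w := m.K h with hw
  have hhR : ‖h‖ ≤ 2 * R := (norm_sub_le _ _).trans (by linarith)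
  have hDsub : m.D f - m.D g = m.ι h := by simp [D, hh]
  have hUsub : m.U f = m.U g + w := by simp [U, hw, hh]
  have hqS : ∀ f' : X, ‖f'‖ ≤ R →
      |⟪m.S (m.U f') (m.U f') - m.e, m.S (m.U f') w + m.S w (m.U f')⟫| ≤ CS * ‖w‖ := by
    intro f' hf'
    have := hU f' hf'
    refine (abs_real_inner_le_norm _ _).trans ?_
    rw [hCS, mul_assoc]
    gcongr
    · refine (norm_sub_le _ _).trans ?_
      gcongr
      exact (hS _ _).trans (by gcongr)
    · refine (norm_add_le _ _).trans ?_
      rw [add_mul]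
      gcongr
      · exact (hS _ _).trans (by gcongr)
      · refine (hS _ _).trans ?_
        rw [mul_right_comm]
        gcongr
  have hqB : ∀ f' : X, ‖f'‖ ≤ R → ‖m.B (m.U f') (m.D f') - m.κ‖ ≤ CB := by
    intro f' hf'
    have := hU f' hf'
    have := hD f' hf'
    refine (norm_sub_le _ _).trans ?_
    rw [hCB]
    gcongr
    exact (hB _ _).trans (by gcongr)
  have hqB1 : ∀ f' : X, ‖f'‖ ≤ R →
      |⟪m.B (m.U f') (m.D f') - m.κ, m.B w (m.D f')⟫| ≤ CB * (b * d) * ‖w‖ := by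
    intro f' hf'
    have := hD f' hf'
    refine (abs_real_inner_le_norm _ _).trans ?_
    rw [mul_assoc]
    gcongr
    · exact hqB f' hf'
    · refine (hB _ _).trans ?_
      rw [mul_right_comm]
      gcongr
  have hdiff : m.B (m.U f) (m.D f) - m.κ
      = (m.B (m.U g) (m.D g) - m.κ) + (m.B (m.U f) (m.ι h) + m.B w (m.D g)) := by
    have : m.D f = m.D g + m.ι h := by rw [← hDsub]; abel
    rw [this, map_add]
    nth_rewrite 1 [hUsub]
    simp only [map_add, add_apply]
    abel
  -- This is the only term where the derivative enters quadratically without a factor `w = K h`. Its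
  -- leading part is a square, hence of the good sign; the remaining two products contain `w`.
  have hcross : ⟪m.B (m.U f) (m.D f) - m.κ, m.B (m.U f) (m.ι h)⟫
      - ⟪m.B (m.U g) (m.D g) - m.κ, m.B (m.U g) (m.ι h)⟫
      = ‖m.B (m.U f) (m.ι h)‖ ^ 2 + ⟪m.B w (m.D g), m.B (m.U f) (m.ι h)⟫
        + ⟪m.B (m.U g) (m.D g) - m.κ, m.B w (m.ι h)⟫ := by
    have h1 : m.B (m.U g) (m.ι h) = m.B (m.U f) (m.ι h) - m.B w (m.ι h) := by
      simp [hUsub]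
    rw [hdiff, h1]
    simp only [inner_add_left, inner_sub_right, real_inner_self_eq_norm_sq]
    ring
  have hc1 : |⟪m.B w (m.D g), m.B (m.U f) (m.ι h)⟫| ≤ b * d * (b * u * (2 * R)) * ‖w‖ := by
    have := hD g hg
    have := hU f hf
    refine (abs_real_inner_le_norm _ _).trans ?_
    rw [mul_right_comm]
    gcongr
    · refine (hB _ _).trans ?_
      rw [mul_right_comm]
      gcongr
    · refine (hB _ _).trans ?_
      rw [m.ι.norm_map]
      gcongr
  have hc2 : |⟪m.B (m.U g) (m.D g) - m.κ, m.B w (m.ι h)⟫| ≤ CB * (b * (2 * R)) * ‖w‖ := by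
    refine (abs_real_inner_le_norm _ _).trans ?_
    rw [mul_assoc]
    gcongr
    · exact hqB g hg
    · refine (hB _ _).trans ?_
      rw [m.ι.norm_map, mul_right_comm]
      gcongr
  have hmain : ⟪m.D f, m.ι h⟫ - ⟪m.D g, m.ι h⟫ = ‖h‖ ^ 2 := by
    rw [← inner_sub_left, hDsub, real_inner_self_eq_norm_sq, m.ι.norm_map]
  have s1 := abs_le.1 (hqS f hf)
  have s2 := abs_le.1 (hqS g hg)
  have b1 := abs_le.1 (hqB1 f hf)
  have b2 := abs_le.1 (hqB1 g hg)
  have c1 := abs_le.1 hc1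
  have c2 := abs_le.1 hc2
  have hsq : 0 ≤ ‖m.B (m.U f) (m.ι h)‖ ^ 2 := by positivity
  simp only [variation, ← hw, inner_add_right] at *
  have t1 := mul_le_mul_of_nonneg_left (add_le_add s1.1 (neg_le_neg s2.2)) hq
  have t2 := mul_le_mul_of_nonneg_left
    (add_le_add (add_le_add b1.1 (neg_le_neg b2.2)) (add_le_add hsq (add_le_add c1.1 c2.1))) hr
  linear_combination 2 * t1 + 2 * t2 - 2 * p * hmain - 2 * r * hcross

/-- A Palais–Smale sequence is bounded, so along a subsequence its image under `K` is Cauchy. The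
monotonicity bound then controls `‖f - g‖²` by `‖K (f - g)‖` and by gradients that tend to zero, so
the subsequence is itself Cauchy. -/
theorem palaisSmaleAt [CompleteSpace X] {G : X → X}
    (hG : ∀ f h, ⟪G f, h⟫ = m.variation p q r f h)
    (hp : 0 < p) (hq : 0 ≤ q) (hr : 0 ≤ r) (c : ℝ) : PalaisSmaleAt (m.energy p q r) G c := by
  intro x hEx hGx
  obtain ⟨M, hM⟩ := hEx.bddAbove_range
  obtain ⟨R, hR⟩ := m.bounded_sublevel hp hq hr M
  have hxR : ∀ n, ‖x n‖ ≤ R := fun n => hR _ (hM ⟨n, rfl⟩)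
  have hR0 : 0 ≤ R := (norm_nonneg _).trans (hxR 0)
  obtain ⟨φ, hφ, hK⟩ := m.compact R x hxR
  obtain ⟨C, hC⟩ := m.exists_monotone_bound (p := p) hr hq R
  have hcauchy : CauchySeq (x ∘ φ) := by
    rw [Metric.cauchySeq_iff]
    intro ε hε
    -- The compact term contributes at most `η / 2` and each gradient at most `η / 4`; the factor
    -- `2` in the monotonicity bound makes the final inequality strict.
    set η := p * ε ^ 2 with hη
    have hηpos : 0 < η := by positivity
    obtain ⟨N₁, hN₁⟩ := Metric.cauchySeq_iff.1 hK (η / (2 * (|C| + 1))) (by positivity)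
    have hG0 := (hGx.comp hφ.tendsto_atTop).eventually
      (gt_mem_nhds (show (0 : ℝ) < η / (4 * (2 * R + 1)) by positivity))
    obtain ⟨N₂, hN₂⟩ := eventually_atTop.1 hG0
    refine ⟨max N₁ N₂, fun i hi j hj => ?_⟩
    have hb := hC (x (φ i)) (x (φ j)) (hxR _) (hxR _)
    rw [← hG, ← hG] at hb
    have hk := hN₁ i (le_of_max_le_left hi) j (le_of_max_le_left hj)
    rw [dist_eq_norm, ← map_sub] at hk
    have hgi := hN₂ i (le_of_max_le_right hi)
    have hgj := hN₂ j (le_of_max_le_right hj)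
    simp only [Function.comp_apply] at hgi hgj
    have hd : ‖x (φ i) - x (φ j)‖ ≤ 2 * R :=
      (norm_sub_le _ _).trans (by linarith [hxR (φ i), hxR (φ j)])
    have i1 := (abs_le.1 (abs_real_inner_le_norm (G (x (φ i))) (x (φ i) - x (φ j)))).2
    have i2 := (abs_le.1 (abs_real_inner_le_norm (G (x (φ j))) (x (φ i) - x (φ j)))).1
    have e1 : C * ‖m.K (x (φ i) - x (φ j))‖ ≤ η / 2 := by
      rw [lt_div_iff₀ (by positivity)] at hk
      nlinarith [le_abs_self C, norm_nonneg (m.K (x (φ i) - x (φ j)))]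
    have e2 : ∀ y : X, ‖y‖ < η / (4 * (2 * R + 1)) →
        ‖y‖ * ‖x (φ i) - x (φ j)‖ ≤ η / 4 := by
      intro y hy
      rw [lt_div_iff₀ (by positivity)] at hy
      nlinarith [norm_nonneg y, mul_le_mul_of_nonneg_left hd (norm_nonneg y)]
    have e3 := e2 _ hgi
    have e4 := e2 _ hgj
    have : 2 * (p * ‖x (φ i) - x (φ j)‖ ^ 2) ≤ η := by linarith
    have hlt : ‖x (φ i) - x (φ j)‖ ^ 2 < ε ^ 2 := by
      have : p * ‖x (φ i) - x (φ j)‖ ^ 2 < p * ε ^ 2 := by linarith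
      exact lt_of_mul_lt_mul_left this hp.le
    rw [dist_eq_norm]
    exact lt_of_pow_lt_pow_left₀ 2 hε.le hlt
  obtain ⟨y, hy⟩ := cauchySeq_tendsto_of_complete hcauchy
  exact ⟨y, φ, hφ, hy⟩

end TwistModel

end TwistModel

end

noncomputable section

/-! ### Absolutely continuous complex-valued functions. -/

section AbsolutelyContinuous

open scoped NNReal

theorem AbsolutelyContinuousOnInterval.lipschitzOnWith_comp {Y W : Type*} [PseudoMetricSpace Y]
    [PseudoMetricSpace W] {f : ℝ → Y} {g : Y → W} {a b : ℝ} {K : ℝ≥0}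
    (hf : AbsolutelyContinuousOnInterval f a b) (hg : LipschitzOnWith K g (f '' uIcc a b)) :
    AbsolutelyContinuousOnInterval (fun x => g (f x)) a b := by
  unfold AbsolutelyContinuousOnInterval at hf ⊢
  refine squeeze_zero' ?_ ?_ (by simpa using Tendsto.const_mul (K : ℝ) hf)
  · exact Eventually.of_forall fun _ => Finset.sum_nonneg fun i _ => dist_nonneg
  rw [eventually_inf_principal]
  filter_upwards with ⟨n, I⟩ hnI
  rw [Finset.mul_sum]
  gcongr with i hi
  simp only [AbsolutelyContinuousOnInterval.disjWithin, mem_ofPred_eq] at hnI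
  exact hg.dist_le_mul _ (mem_image_of_mem f (hnI.1 i hi).1) _
    (mem_image_of_mem f (hnI.1 i hi).2)

theorem AbsolutelyContinuousOnInterval.lipschitzWith_comp {Y W : Type*} [PseudoMetricSpace Y]
    [PseudoMetricSpace W] {f : ℝ → Y} {g : Y → W} {a b : ℝ} {K : ℝ≥0}
    (hf : AbsolutelyContinuousOnInterval f a b) (hg : LipschitzWith K g) :
    AbsolutelyContinuousOnInterval (fun x => g (f x)) a b :=
  hf.lipschitzOnWith_comp hg.lipschitzOnWith

theorem AbsolutelyContinuousOnInterval.congr {Y : Type*} [PseudoMetricSpace Y] {f g : ℝ → Y}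
    {a b : ℝ} (hf : AbsolutelyContinuousOnInterval f a b) (h : EqOn f g (uIcc a b)) :
    AbsolutelyContinuousOnInterval g a b := by
  rw [absolutelyContinuousOnInterval_iff] at hf ⊢
  intro ε hε
  obtain ⟨δ, hδ, H⟩ := hf ε hε
  refine ⟨δ, hδ, fun E hE hlt => ?_⟩
  convert H E hE hlt using 3 with i hi
  · exact (h (hE.1 i hi).1).symm
  · exact (h (hE.1 i hi).2).symm

theorem AbsolutelyContinuousOnInterval.re {f : ℝ → ℂ} {a b : ℝ}
    (hf : AbsolutelyContinuousOnInterval f a b) :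
    AbsolutelyContinuousOnInterval (fun x => (f x).re) a b :=
  hf.lipschitzWith_comp Complex.reCLM.lipschitz

theorem AbsolutelyContinuousOnInterval.im {f : ℝ → ℂ} {a b : ℝ}
    (hf : AbsolutelyContinuousOnInterval f a b) :
    AbsolutelyContinuousOnInterval (fun x => (f x).im) a b :=
  hf.lipschitzWith_comp Complex.imCLM.lipschitz

theorem AbsolutelyContinuousOnInterval.of_re_im {f : ℝ → ℂ} {a b : ℝ}
    (hr : AbsolutelyContinuousOnInterval (fun x => (f x).re) a b)
    (hi : AbsolutelyContinuousOnInterval (fun x => (f x).im) a b) :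
    AbsolutelyContinuousOnInterval f a b := by
  have h1 := hr.lipschitzWith_comp Complex.ofRealCLM.lipschitz
  have h2 := (hi.lipschitzWith_comp Complex.ofRealCLM.lipschitz).const_smul Complex.I
  refine (h1.add h2).congr fun x _ => ?_
  simp [Pi.add_apply, mul_comm Complex.I, Complex.re_add_im]

theorem AbsolutelyContinuousOnInterval.ae_differentiableAt_complex {f : ℝ → ℂ} {a b : ℝ}
    (hf : AbsolutelyContinuousOnInterval f a b) :
    ∀ᵐ x : ℝ, x ∈ uIcc a b → DifferentiableAt ℝ f x := by
  filter_upwards [hf.re.ae_differentiableAt, hf.im.ae_differentiableAt] with x hx hx' hmem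
  have h := ((Complex.ofRealCLM.differentiableAt.comp x (hx hmem)).add
    ((Complex.ofRealCLM.differentiableAt.comp x (hx' hmem)).mul_const Complex.I))
  refine h.congr_of_eventuallyEq (Eventually.of_forall fun y => ?_)
  simp [Complex.re_add_im]

theorem IntervalIntegrable.absolutelyContinuousOnInterval_intervalIntegral_complex {f : ℝ → ℂ}
    {a b c : ℝ} (h : IntervalIntegrable f volume a b) (hc : c ∈ uIcc a b) :
    AbsolutelyContinuousOnInterval (fun x => ∫ v in c..x, f v) a b := by
  have hsub : ∀ x ∈ uIcc a b, IntervalIntegrable f volume c x := fun x hx =>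
    h.mono_set (uIcc_subset_uIcc hc hx)
  have hre : IntervalIntegrable (fun x => (f x).re) volume a b := ⟨h.1.re, h.2.re⟩
  have him : IntervalIntegrable (fun x => (f x).im) volume a b := ⟨h.1.im, h.2.im⟩
  refine .of_re_im ?_ ?_
  · refine (hre.absolutelyContinuousOnInterval_intervalIntegral hc).congr fun x hx => ?_
    exact Complex.reCLM.intervalIntegral_comp_comm (hsub x hx)
  · refine (him.absolutelyContinuousOnInterval_intervalIntegral hc).congr fun x hx => ?_
    exact Complex.imCLM.intervalIntegral_comp_comm (hsub x hx)

/-- The difference of `f` and the primitive of its derivative is absolutely continuous with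
derivative zero almost everywhere, hence constant. -/
theorem AbsolutelyContinuousOnInterval.eq_add_integral_deriv {f : ℝ → ℂ} {a b : ℝ}
    (hf : AbsolutelyContinuousOnInterval f a b) (hint : IntervalIntegrable (deriv f) volume a b)
    {x : ℝ} (hx : x ∈ uIcc a b) : f x = f a + ∫ t in a..x, deriv f t := by
  have hac := hint.absolutelyContinuousOnInterval_intervalIntegral_complex left_mem_uIcc
  obtain ⟨C, hC⟩ := (hf.sub hac).const_of_ae_hasDerivAt_zero (by
    filter_upwards [hf.ae_differentiableAt_complex, hint.ae_hasDerivAt_integral] with y h1 h2 hy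
    simpa using (h1 hy).hasDerivAt.sub (h2 hy a left_mem_uIcc))
  have h1 := hC x hx
  have h2 := hC a left_mem_uIcc
  simp only [Pi.sub_apply, intervalIntegral.integral_same, sub_zero] at h1 h2
  rw [h2, ← h1]
  ring

end AbsolutelyContinuous

/-! ### Curves on the unit interval recovered from their derivatives. -/

namespace Cholesteric

/-- Lebesgue measure on the unit interval. -/
abbrev unitMeasure : Measure ℝ := volume.restrict (Ioc 0 1)

theorem restrict_Ioo_eq_unitMeasure : volume.restrict (Ioo (0 : ℝ) 1) = unitMeasure :=
  Measure.restrict_congr_set Ioo_ae_eq_Ioc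

theorem intervalIntegral_eq_unitMeasure {E : Type*} [NormedAddCommGroup E] [NormedSpace ℝ E]
    (f : ℝ → E) : ∫ x in (0 : ℝ)..1, f x = ∫ x, f x ∂unitMeasure :=
  intervalIntegral.integral_of_le zero_le_one

theorem intervalIntegrable_of_memLp {E : Type*} [NormedAddCommGroup E] {F : ℝ → E}
    (hF : MemLp F 2 unitMeasure) : IntervalIntegrable F volume 0 1 :=
  (intervalIntegrable_iff_integrableOn_Ioc_of_le zero_le_one).2 (hF.integrable one_le_two)

/-- The curve with initial point `1` and derivative `F`. -/
def curve (F : ℝ → ℂ) (x : ℝ) : ℂ := 1 + ∫ t in (0 : ℝ)..x, F t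

theorem ae_unit_of_ae {p : ℝ → Prop} (h : ∀ᵐ x : ℝ, x ∈ uIcc (0 : ℝ) 1 → p x) :
    ∀ᵐ x ∂unitMeasure, p x := by
  rw [ae_restrict_iff' measurableSet_Ioc]
  filter_upwards [h] with x hx hmem
  exact hx (by rw [uIcc_of_le zero_le_one]; exact Ioc_subset_Icc_self hmem)

theorem hasDerivAt_curve {F : ℝ → ℂ} (hF : MemLp F 2 unitMeasure) :
    ∀ᵐ x ∂unitMeasure, HasDerivAt (curve F) (F x) x := by
  apply ae_unit_of_ae
  filter_upwards [(intervalIntegrable_of_memLp hF).ae_hasDerivAt_integral] with x hx hmem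
  exact (hx hmem 0 left_mem_uIcc).const_add 1

theorem deriv_curve {F : ℝ → ℂ} (hF : MemLp F 2 unitMeasure) :
    deriv (curve F) =ᵐ[unitMeasure] F := by
  filter_upwards [hasDerivAt_curve hF] with x hx using hx.deriv

theorem memH1_curve {F : ℝ → ℂ} (hF : MemLp F 2 unitMeasure) : MemH1 (curve F) where
  absolutelyContinuous := by
    have h1 := (intervalIntegrable_of_memLp hF).absolutelyContinuousOnInterval_intervalIntegral_complex
      left_mem_uIcc
    have h2 : AbsolutelyContinuousOnInterval (fun _ : ℝ => (1 : ℂ)) 0 1 :=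
      ((LipschitzWith.const (1 : ℂ)).lipschitzOnWith).absolutelyContinuousOnInterval
    exact h2.add h1
  memLp_deriv := by
    rw [restrict_Ioo_eq_unitMeasure]
    exact (memLp_congr_ae (deriv_curve hF)).2 hF

@[simp] theorem curve_zero (F : ℝ → ℂ) : curve F 0 = 1 := by simp [curve]

theorem curve_one (F : ℝ → ℂ) : curve F 1 = 1 + ∫ x, F x ∂unitMeasure := by
  rw [curve, intervalIntegral_eq_unitMeasure]

theorem MemH1.memLp {u : ℝ → ℂ} (hu : MemH1 u) : MemLp (deriv u) 2 unitMeasure := by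
  rw [← restrict_Ioo_eq_unitMeasure]; exact hu.memLp_deriv

theorem MemH1.ae_differentiableAt {u : ℝ → ℂ} (hu : MemH1 u) :
    ∀ᵐ x ∂unitMeasure, DifferentiableAt ℝ u x :=
  ae_unit_of_ae hu.absolutelyContinuous.ae_differentiableAt_complex

theorem MemH1.eq_add_integral {u : ℝ → ℂ} (hu : MemH1 u) {x : ℝ} (hx : x ∈ Icc (0 : ℝ) 1) :
    u x = u 0 + ∫ t in (0 : ℝ)..x, deriv u t :=
  hu.absolutelyContinuous.eq_add_integral_deriv (intervalIntegrable_of_memLp hu.memLp)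
    (by rwa [uIcc_of_le zero_le_one])

theorem MemH1.eqOn_curve {u : ℝ → ℂ} (hu : MemH1 u) (h0 : u 0 = 1) :
    EqOn u (curve (deriv u)) (Icc 0 1) := fun x hx => by
  rw [hu.eq_add_integral hx, h0, curve]

theorem MemH1.integral_deriv {u : ℝ → ℂ} (hu : MemH1 u) :
    ∫ x, deriv u x ∂unitMeasure = u 1 - u 0 := by
  rw [← intervalIntegral_eq_unitMeasure, hu.eq_add_integral (right_mem_Icc.2 zero_le_one)]
  ring

theorem curve_congr {F F' : ℝ → ℂ} (h : F =ᵐ[unitMeasure] F') :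
    EqOn (curve F) (curve F') (Icc 0 1) := fun x hx => by
  unfold curve
  congr 1
  refine intervalIntegral.integral_congr_ae ?_
  rw [EventuallyEq, ae_restrict_iff' measurableSet_Ioc] at h
  filter_upwards [h] with t ht hmem
  rw [uIoc_of_le hx.1] at hmem
  exact ht ⟨hmem.1, hmem.2.trans hx.2⟩

end Cholesteric

end

noncomputable section

/-! ### The Hilbert space model of the admissible class. -/

namespace Cholesteric

open scoped BoundedContinuousFunction ENNReal RealInnerProductSpace

/-- Square integrable complex functions on the unit interval. -/
abbrev L2C : Type := Lp ℂ 2 unitMeasure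

theorem norm_sq_eq_integral {E : Type*} [NormedAddCommGroup E] [InnerProductSpace ℝ E]
    (f : Lp E 2 unitMeasure) : ‖f‖ ^ 2 = ∫ x, ‖f x‖ ^ 2 ∂unitMeasure := by
  rw [← real_inner_self_eq_norm_sq, L2.inner_def]
  simp

theorem integrable_norm_sq {E : Type*} [NormedAddCommGroup E] {f : ℝ → E}
    (hf : MemLp f 2 unitMeasure) : Integrable (fun x => ‖f x‖ ^ 2) unitMeasure :=
  MemLp.integrable_norm_pow (p := 2) (by exact_mod_cast hf) two_ne_zero

theorem intervalIntegrable_L2C (F : L2C) {x y : ℝ} (hx : x ∈ Icc (0 : ℝ) 1)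
    (hy : y ∈ Icc (0 : ℝ) 1) : IntervalIntegrable F volume x y := by
  refine (intervalIntegrable_of_memLp (Lp.memLp F)).mono_set ?_
  rw [uIcc_of_le zero_le_one]
  exact uIcc_subset_Icc hx hy

/-- The Hölder estimate for primitives of square integrable functions. -/
theorem norm_intervalIntegral_le (F : L2C) {x y : ℝ} (hx : x ∈ Icc (0 : ℝ) 1)
    (hy : y ∈ Icc (0 : ℝ) 1) : ‖∫ t in x..y, F t‖ ≤ √|y - x| * ‖F‖ := by
  wlog hxy : x ≤ y generalizing x y
  · rw [intervalIntegral.integral_symm, norm_neg, abs_sub_comm]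
    exact this hy hx (le_of_not_ge hxy)
  have hsub : Ioc x y ⊆ Ioc 0 1 := Ioc_subset_Ioc hx.1 hy.2
  have hμ : unitMeasure (Ioc x y) ≠ ∞ := measure_ne_top _ _
  -- The integral is the inner product with the indicator of `(x, y]`, whose norm is `√(y - x)`; the
  -- estimate is Cauchy–Schwarz.
  have h := L2.inner_indicatorConstLp_one (𝕜 := ℂ) measurableSet_Ioc hμ F
  rw [Measure.restrict_restrict measurableSet_Ioc, inter_eq_left.2 hsub,
    ← intervalIntegral.integral_of_le hxy] at h
  rw [← h]
  refine (norm_inner_le_norm _ _).trans ?_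
  rw [norm_indicatorConstLp two_ne_zero ENNReal.ofNat_ne_top]
  have hm : unitMeasure.real (Ioc x y) = y - x := by
    rw [measureReal_restrict_apply measurableSet_Ioc, inter_eq_left.2 hsub, Real.volume_real_Ioc]
    exact max_eq_left (by linarith)
  rw [hm, abs_of_nonneg (by linarith), norm_one, one_mul, Real.sqrt_eq_rpow]
  norm_num

/-- The primitive of a square integrable function, as a continuous function. -/
def primitiveFun (F : L2C) : Icc (0 : ℝ) 1 →ᵇ ℂ :=
  BoundedContinuousFunction.mkOfCompact ⟨fun x => ∫ t in (0 : ℝ)..x, F t, by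
    have h := (intervalIntegrable_of_memLp
      (Lp.memLp F)).absolutelyContinuousOnInterval_intervalIntegral_complex left_mem_uIcc
    have := h.continuousOn
    rw [uIcc_of_le zero_le_one] at this
    exact continuousOn_iff_continuous_domRestrict.1 this⟩

@[simp] theorem primitiveFun_apply (F : L2C) (x : Icc (0 : ℝ) 1) :
    primitiveFun F x = ∫ t in (0 : ℝ)..x, F t := rfl

theorem zero_mem_unit : (0 : ℝ) ∈ Icc (0 : ℝ) 1 := left_mem_Icc.2 zero_le_one

theorem one_mem_unit : (1 : ℝ) ∈ Icc (0 : ℝ) 1 := right_mem_Icc.2 zero_le_one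

theorem norm_primitive_le (F : L2C) {x : ℝ} (hx : x ∈ Icc (0 : ℝ) 1) :
    ‖∫ t in (0 : ℝ)..x, F t‖ ≤ ‖F‖ := by
  refine (norm_intervalIntegral_le F zero_mem_unit hx).trans ?_
  refine mul_le_of_le_one_left (norm_nonneg _) ?_
  rw [Real.sqrt_le_one, sub_zero, abs_of_nonneg hx.1]
  exact hx.2

/-- The primitive, as a bounded linear operator into the continuous functions. -/
def primitiveL : L2C →L[ℝ] (Icc (0 : ℝ) 1 →ᵇ ℂ) :=
  LinearMap.mkContinuous
    { toFun := primitiveFun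
      map_add' := fun F G => by
        ext x
        have hI : ∀ H : L2C, IntervalIntegrable H volume 0 x := fun H =>
          intervalIntegrable_L2C H zero_mem_unit x.2
        rw [BoundedContinuousFunction.add_apply, primitiveFun_apply, primitiveFun_apply,
          primitiveFun_apply, ← intervalIntegral.integral_add (hI F) (hI G)]
        have h := curve_congr (Lp.coeFn_add F G) x.2
        simpa [curve] using h
      map_smul' := fun c F => by
        ext x
        rw [RingHom.id_apply, BoundedContinuousFunction.smul_apply, primitiveFun_apply,
          primitiveFun_apply, ← intervalIntegral.integral_smul]
        have h := curve_congr (Lp.coeFn_smul c F) x.2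
        simpa [curve] using h }
    1 fun F => by
      rw [one_mul]
      exact (BoundedContinuousFunction.norm_le (norm_nonneg _)).2 fun x => norm_primitive_le F x.2

@[simp] theorem primitiveL_apply (F : L2C) (x : Icc (0 : ℝ) 1) :
    primitiveL F x = ∫ t in (0 : ℝ)..x, F t := rfl

/-- Primitives of an `L²`-bounded family are uniformly bounded and uniformly Hölder of exponent
`1/2`, so the Arzelà–Ascoli theorem applies. -/
theorem primitiveL_compact (R : ℝ) (F : ℕ → L2C) (hF : ∀ n, ‖F n‖ ≤ R) :
    ∃ φ : ℕ → ℕ, StrictMono φ ∧ CauchySeq (fun n => primitiveL (F (φ n))) := by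
  set A : Set (Icc (0 : ℝ) 1 →ᵇ ℂ) := range fun n => primitiveL (F n) with hA
  have hcomp : IsCompact (closure A) := by
    refine BoundedContinuousFunction.arzela_ascoli (Metric.closedBall 0 R)
      (isCompact_closedBall 0 R) A ?_ ?_
    · rintro _ x ⟨n, rfl⟩
      rw [mem_closedBall_zero_iff]
      exact (norm_primitive_le _ x.2).trans (hF n)
    · have hb : Tendsto (fun d : ℝ => √|d| * R) (𝓝 0) (𝓝 0) := by
        have : Continuous fun d : ℝ => √|d| * R := by fun_prop
        simpa using this.tendsto 0
      intro x₀
      rw [Metric.equicontinuousAt_iff]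
      intro ε hε
      obtain ⟨δ, hδ, H⟩ := Metric.eventually_nhds_iff.1 (hb.eventually (gt_mem_nhds hε))
      refine ⟨δ, hδ, ?_⟩
      rintro x hx ⟨_, n, rfl⟩
      rw [dist_eq_norm]
      change ‖(∫ t in (0 : ℝ)..x₀, F n t) - ∫ t in (0 : ℝ)..x, F n t‖ < ε
      rw [intervalIntegral.integral_interval_sub_left
        (intervalIntegrable_L2C _ zero_mem_unit x₀.2) (intervalIntegrable_L2C _ zero_mem_unit x.2)]
      refine (norm_intervalIntegral_le (F n) x.2 x₀.2).trans_lt ?_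
      have h1 : √|(x₀ : ℝ) - x| * ‖F n‖ ≤ √|(x₀ : ℝ) - x| * R := by
        gcongr
        exact hF n
      refine h1.trans_lt (H ?_)
      rw [dist_comm] at hx
      simpa [Subtype.dist_eq, Real.dist_eq] using hx
  obtain ⟨g, -, φ, hφ, hg⟩ := hcomp.tendsto_subseq
    (fun n => subset_closure (mem_range_self n) : ∀ n, primitiveL (F n) ∈ closure A)
  exact ⟨φ, hφ, hg.cauchySeq⟩

theorem aestronglyMeasurable_extend (g : Icc (0 : ℝ) 1 →ᵇ ℂ) :
    AEStronglyMeasurable (fun x => g (projIcc 0 1 zero_le_one x)) unitMeasure :=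
  (g.continuous.comp continuous_projIcc).aestronglyMeasurable

theorem memLp_extend (g : Icc (0 : ℝ) 1 →ᵇ ℂ) :
    MemLp (fun x => g (projIcc 0 1 zero_le_one x)) ∞ unitMeasure :=
  memLp_top_of_bound (aestronglyMeasurable_extend g) ‖g‖
    (Eventually.of_forall fun _ => g.norm_coe_le_norm _)

/-- A continuous function on the unit interval as an element of `L^∞`. -/
def extendL : (Icc (0 : ℝ) 1 →ᵇ ℂ) →L[ℝ] Lp ℂ ∞ unitMeasure :=
  LinearMap.mkContinuous
    { toFun := fun g => (memLp_extend g).toLp _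
      map_add' := fun _ _ => rfl
      map_smul' := fun _ _ => rfl }
    1 fun g => by
      have h := Lp.norm_le_of_ae_bound (f := (memLp_extend g).toLp _) (norm_nonneg g) (by
        filter_upwards [(memLp_extend g).coeFn_toLp] with x hx
        rw [hx]
        exact g.norm_coe_le_norm _)
      exact h.trans_eq (by simp)

theorem coeFn_extendL (g : Icc (0 : ℝ) 1 →ᵇ ℂ) :
    ∀ᵐ x ∂unitMeasure, ∀ hx : x ∈ Icc (0 : ℝ) 1, extendL g x = g ⟨x, hx⟩ := by
  filter_upwards [(memLp_extend g).coeFn_toLp] with x h hx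
  change (memLp_extend g).toLp _ x = _
  rw [h, projIcc_of_mem zero_le_one hx]

theorem ae_mem_unit : ∀ᵐ x ∂unitMeasure, x ∈ Icc (0 : ℝ) 1 :=
  (ae_restrict_mem measurableSet_Ioc).mono fun _ hx => Ioc_subset_Icc_self hx

/-- The real inner product of two complex numbers. -/
def dotL : ℂ →L[ℝ] ℂ →L[ℝ] ℝ :=
  (ContinuousLinearMap.mul ℝ ℝ).bilinearComp Complex.reCLM Complex.reCLM
    + (ContinuousLinearMap.mul ℝ ℝ).bilinearComp Complex.imCLM Complex.imCLM

/-- The cross product of two complex numbers. -/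
def crossL : ℂ →L[ℝ] ℂ →L[ℝ] ℝ :=
  (ContinuousLinearMap.mul ℝ ℝ).bilinearComp Complex.reCLM Complex.imCLM
    - (ContinuousLinearMap.mul ℝ ℝ).bilinearComp Complex.imCLM Complex.reCLM

@[simp] theorem dotL_apply (z w : ℂ) : dotL z w = z.re * w.re + z.im * w.im := rfl

@[simp] theorem crossL_apply (z w : ℂ) : crossL z w = z.re * w.im - z.im * w.re := rfl

/-- The inclusion of `L^∞` into `L²`. -/
def inclL : Lp ℂ ∞ unitMeasure →L[ℝ] L2C :=
  ((ContinuousLinearMap.mul ℝ ℂ).holderL unitMeasure ∞ 2 2).flip (Lp.const 2 unitMeasure 1)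

theorem coeFn_inclL (f : Lp ℂ ∞ unitMeasure) : inclL f =ᵐ[unitMeasure] f := by
  have h := (ContinuousLinearMap.mul ℝ ℂ).coeFn_holder (r := 2) f (Lp.const 2 unitMeasure (1 : ℂ))
  filter_upwards [h, Lp.coeFn_const 2 unitMeasure (1 : ℂ)] with x h1 h2
  refine h1.trans ?_
  rw [h2]
  simp

/-- The mean value. -/
def meanL : L2C →L[ℝ] ℂ :=
  (BoundedContinuousFunction.evalCLM ℝ (⟨1, one_mem_unit⟩ : Icc (0 : ℝ) 1)).comp primitiveL

theorem meanL_apply (F : L2C) : meanL F = ∫ x, F x ∂unitMeasure :=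
  intervalIntegral_eq_unitMeasure _

/-- The tangent space of the admissible class: square integrable derivatives of mean zero. -/
abbrev MeanZero : Type := LinearMap.ker meanL.toLinearMap

instance : CompleteSpace MeanZero :=
  (ContinuousLinearMap.isClosed_ker meanL).completeSpace_coe

/-- The derivative of the affine reference curve. -/
def refDeriv (α : ℝ) : L2C := Lp.const 2 unitMeasure (Complex.exp (α * Complex.I) - 1)

/-- The energy as a twist model. -/
def model (N : ℕ) (α : ℝ) : TwistModel MeanZero L2C (Lp ℂ ∞ unitMeasure) (Lp ℝ 2 unitMeasure) where
  ι := (LinearMap.ker meanL.toLinearMap).subtypeₗᵢ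
  K := (extendL.comp primitiveL).comp (LinearMap.ker meanL.toLinearMap).subtypeL
  d₀ := refDeriv α
  u₀ := Lp.const ∞ unitMeasure 1 + extendL (primitiveL (refDeriv α))
  -- Both products are Hölder pairings `L^∞ × L² → L²`. The field lies in `L^∞`, so its second copy
  -- in the potential term is first sent to `L²`.
  S := (dotL.holderL unitMeasure ∞ 2 2).bilinearComp (.id ℝ _) inclL
  B := crossL.holderL unitMeasure ∞ 2 2
  e := Lp.const 2 unitMeasure 1
  κ := Lp.const 2 unitMeasure (2 * Real.pi * N)
  compact := fun R f hf => by
    obtain ⟨φ, hφ, hc⟩ := primitiveL_compact R (fun n => (f n : L2C)) hf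
    exact ⟨φ, hφ, hc.map extendL.uniformContinuous⟩

variable {L : ℝ} {N : ℕ} {α ε : ℝ}

theorem coeFn_model_U (f : MeanZero) :
    (model N α).U f =ᵐ[unitMeasure] curve (refDeriv α + f : L2C) := by
  have h : (model N α).U f = Lp.const ∞ unitMeasure 1 + extendL (primitiveL (refDeriv α + f)) := by
    simp only [TwistModel.U, model, map_add, add_assoc]
    rfl
  rw [h]
  filter_upwards [Lp.coeFn_add (Lp.const ∞ unitMeasure (1 : ℂ))
    (extendL (primitiveL (refDeriv α + f))), Lp.coeFn_const ∞ unitMeasure (1 : ℂ),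
    coeFn_extendL (primitiveL (refDeriv α + f)), ae_mem_unit] with x h1 h2 h3 h4
  rw [h1, Pi.add_apply, h2, h3 h4]
  rfl

/-- The energy as a function of the derivative. -/
def modelEnergy (L : ℝ) (N : ℕ) (α ε : ℝ) : MeanZero → ℝ :=
  (model N α).energy (ε / 2) (1 / (4 * ε)) (L / 2)

/-- The admissible curve with a given derivative. -/
def toCurve (α : ℝ) (f : MeanZero) : ℝ → ℂ := curve (refDeriv α + f : L2C)

theorem deriv_toCurve (f : MeanZero) :
    deriv (toCurve α f) =ᵐ[unitMeasure] (refDeriv α + f : L2C) :=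
  deriv_curve (Lp.memLp _)

theorem memH1_toCurve (f : MeanZero) : MemH1 (toCurve α f) :=
  memH1_curve (Lp.memLp _)

theorem toCurve_mem (f : MeanZero) : toCurve α f ∈ admissible α := by
  refine ⟨memH1_toCurve f, curve_zero _, ?_⟩
  have h : meanL (f : L2C) = 0 := f.2
  rw [toCurve, curve_one, ← meanL_apply, map_add, h, add_zero, meanL_apply, refDeriv,
    integral_congr_ae (Lp.coeFn_const 2 unitMeasure _)]
  simp

/-- The three squared `L²` norms of the model are the integrals of the three energy densities, by
the pointwise formulas for the Hölder pairings. -/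
theorem energy_toCurve (f : MeanZero) :
    energy L N ε (toCurve α f) = modelEnergy L N α ε f := by
  set m := model N α with hm
  have hU : m.U f =ᵐ[unitMeasure] toCurve α f := coeFn_model_U f
  have hD : m.D f =ᵐ[unitMeasure] deriv (toCurve α f) := (deriv_toCurve f).symm
  set s : Lp ℝ 2 unitMeasure := m.S (m.U f) (m.U f) - m.e with hs
  set b : Lp ℝ 2 unitMeasure := m.B (m.U f) (m.D f) - m.κ with hb
  have hs' : s =ᵐ[unitMeasure] fun x => ‖toCurve α f x‖ ^ 2 - 1 := by
    have h1 : m.S (m.U f) (m.U f) =ᵐ[unitMeasure] _ :=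
      dotL.coeFn_holder (r := 2) (m.U f) (inclL (m.U f))
    filter_upwards [Lp.coeFn_sub (m.S (m.U f) (m.U f)) m.e, h1, coeFn_inclL (m.U f),
      Lp.coeFn_const 2 unitMeasure (1 : ℝ), hU] with x e1 e2 e3 e4 e5
    have e4' : (m.e : ℝ → ℝ) x = 1 := e4
    rw [hs, e1, Pi.sub_apply, e2, e3, e5, e4', dotL_apply, Complex.sq_norm, Complex.normSq_apply]
  have hb' : b =ᵐ[unitMeasure] fun x => twist (toCurve α f) x - 2 * Real.pi * N := by
    have h1 : m.B (m.U f) (m.D f) =ᵐ[unitMeasure] _ :=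
      crossL.coeFn_holder (r := 2) (m.U f) (m.D f)
    filter_upwards [Lp.coeFn_sub (m.B (m.U f) (m.D f)) m.κ, h1,
      Lp.coeFn_const 2 unitMeasure (2 * Real.pi * N : ℝ), hU, hD] with x e1 e2 e4 e5 e6
    have e4' : (m.κ : ℝ → ℝ) x = 2 * Real.pi * N := e4
    rw [hb, e1, Pi.sub_apply, e2, e5, e6, e4', crossL_apply, twist]
  have i1 : Integrable (fun x => ε / 2 * ‖m.D f x‖ ^ 2) unitMeasure :=
    (integrable_norm_sq (Lp.memLp _)).const_mul _
  have i2 : Integrable (fun x => 1 / (4 * ε) * ‖s x‖ ^ 2) unitMeasure :=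
    (integrable_norm_sq (Lp.memLp _)).const_mul _
  have i3 : Integrable (fun x => L / 2 * ‖b x‖ ^ 2) unitMeasure :=
    (integrable_norm_sq (Lp.memLp _)).const_mul _
  have i12 : Integrable (fun x => ε / 2 * ‖m.D f x‖ ^ 2 + 1 / (4 * ε) * ‖s x‖ ^ 2) unitMeasure :=
    i1.add i2
  have hE : modelEnergy L N α ε f = ε / 2 * ‖m.D f‖ ^ 2 + 1 / (4 * ε) * ‖s‖ ^ 2
      + L / 2 * ‖b‖ ^ 2 := rfl
  rw [hE, norm_sq_eq_integral, norm_sq_eq_integral, norm_sq_eq_integral, ← integral_const_mul,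
    ← integral_const_mul, ← integral_const_mul, ← integral_add i1 i2, ← integral_add i12 i3,
    energy, intervalIntegral_eq_unitMeasure]
  refine integral_congr_ae ?_
  filter_upwards [hD, hs', hb'] with x h1 h2 h3
  rw [h1, h2, h3, Real.norm_eq_abs, Real.norm_eq_abs, sq_abs, sq_abs]

theorem deriv_ae_eq_of_eqOn {u v : ℝ → ℂ} (h : EqOn u v (Icc 0 1)) :
    deriv u =ᵐ[unitMeasure] deriv v := by
  rw [← restrict_Ioo_eq_unitMeasure, EventuallyEq, ae_restrict_iff' measurableSet_Ioo]
  filter_upwards with x hx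
  refine EventuallyEq.deriv_eq ?_
  filter_upwards [isOpen_Ioo.mem_nhds hx] with y hy
  exact h (Ioo_subset_Icc_self hy)

theorem energy_congr {u v : ℝ → ℂ} (h : EqOn u v (Icc 0 1)) :
    energy L N ε u = energy L N ε v := by
  unfold energy
  rw [intervalIntegral_eq_unitMeasure, intervalIntegral_eq_unitMeasure]
  refine integral_congr_ae ?_
  filter_upwards [deriv_ae_eq_of_eqOn h, ae_mem_unit] with x h1 h2
  simp only [twist, h1, h h2]

/-- The derivative of an admissible curve, relative to the reference curve. -/
def ofCurve {u : ℝ → ℂ} (hu : u ∈ admissible α) : MeanZero :=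
  ⟨hu.1.memLp.toLp _ - refDeriv α, by
    change meanL _ = 0
    rw [map_sub, meanL_apply, meanL_apply, integral_congr_ae hu.1.memLp.coeFn_toLp,
      hu.1.integral_deriv, hu.2.1, hu.2.2, refDeriv,
      integral_congr_ae (Lp.coeFn_const 2 unitMeasure _)]
    simp⟩

theorem refDeriv_add_ofCurve {u : ℝ → ℂ} (hu : u ∈ admissible α) :
    refDeriv α + ofCurve hu = hu.1.memLp.toLp _ := by
  simp [ofCurve]

theorem toCurve_ofCurve {u : ℝ → ℂ} (hu : u ∈ admissible α) :
    EqOn (toCurve α (ofCurve hu)) u (Icc 0 1) := by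
  rw [toCurve, refDeriv_add_ofCurve]
  exact (curve_congr hu.1.memLp.coeFn_toLp).trans (hu.1.eqOn_curve hu.2.1).symm

theorem ofCurve_congr {u v : ℝ → ℂ} (hu : u ∈ admissible α) (hv : v ∈ admissible α)
    (h : EqOn u v (Icc 0 1)) : ofCurve hu = ofCurve hv := by
  apply Subtype.ext
  change hu.1.memLp.toLp _ - refDeriv α = hv.1.memLp.toLp _ - refDeriv α
  rw [MemLp.toLp_congr _ _ (deriv_ae_eq_of_eqOn h)]

theorem modelEnergy_ofCurve {u : ℝ → ℂ} (hu : u ∈ admissible α) :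
    modelEnergy L N α ε (ofCurve hu) = energy L N ε u := by
  rw [← energy_toCurve, energy_congr (toCurve_ofCurve hu)]

/-- A variation in `H¹₀` has a derivative of mean zero, so it is a direction `h` in the model.
Adding `t φ` to the curve amounts to adding `t • h` to its parameter. -/
theorem isCriticalPoint_toCurve {G : MeanZero → MeanZero}
    (hG : HasQuadRemainder (modelEnergy L N α ε) G) {f : MeanZero} (hf : G f = 0) :
    IsCriticalPoint L N α ε (toCurve α f) := by
  refine ⟨toCurve_mem f, fun φ hφ => ?_⟩
  have hφL := hφ.1.memLp
  set h : MeanZero := ⟨hφL.toLp _, by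
    change meanL _ = 0
    rw [meanL_apply, integral_congr_ae hφL.coeFn_toLp, hφ.1.integral_deriv, hφ.2.1, hφ.2.2,
      sub_zero]⟩ with hh
  have key : ∀ t : ℝ, energy L N ε (fun x => toCurve α f x + (t : ℂ) * φ x)
      = modelEnergy L N α ε (f + t • h) := fun t => by
    rw [← energy_toCurve]
    refine energy_congr fun x hx => ?_
    have e1 : toCurve α (f + t • h) x
        = 1 + primitiveL ((refDeriv α + f) + t • hφL.toLp _ : L2C) ⟨x, hx⟩ := by
      simp only [toCurve, curve, primitiveL_apply, Submodule.coe_add, Submodule.coe_smul, hh,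
        add_assoc]
    have e2 := curve_congr hφL.coeFn_toLp hx
    have e3 := hφ.1.eq_add_integral hx
    rw [hφ.2.1, zero_add] at e3
    simp only [curve, add_right_inj] at e2
    rw [e1, map_add, map_smul, BoundedContinuousFunction.add_apply,
      BoundedContinuousFunction.smul_apply, primitiveL_apply, primitiveL_apply, e2, ← e3,
      Complex.real_smul, ← add_assoc]
    rfl
  have := hG.hasDerivAt_line f h
  rw [hf, inner_zero_left] at this
  simpa only [key] using this

end Cholesteric

end

noncomputable section

/-! ### Passing between paths of curves and paths in the model. -/

namespace Cholesteric

open scoped BoundedContinuousFunction ENNReal RealInnerProductSpace unitInterval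

variable {L : ℝ} {N : ℕ} {α ε : ℝ}

theorem MemH1.deriv_sub {u v : ℝ → ℂ} (hu : MemH1 u) (hv : MemH1 v) :
    deriv (fun x => u x - v x) =ᵐ[unitMeasure] fun x => deriv u x - deriv v x := by
  filter_upwards [hu.ae_differentiableAt, hv.ae_differentiableAt] with x h1 h2
  exact deriv_fun_sub h1 h2

theorem MemH1.sub {u v : ℝ → ℂ} (hu : MemH1 u) (hv : MemH1 v) : MemH1 (fun x => u x - v x) where
  absolutelyContinuous := hu.absolutelyContinuous.fun_sub hv.absolutelyContinuous
  memLp_deriv := by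
    rw [restrict_Ioo_eq_unitMeasure]
    exact (memLp_congr_ae (hu.deriv_sub hv)).2 (hu.memLp.sub hv.memLp)

theorem MemH1.continuousOn {u : ℝ → ℂ} (hu : MemH1 u) : ContinuousOn u (Icc 0 1) := by
  have := hu.absolutelyContinuous.continuousOn
  rwa [uIcc_of_le zero_le_one] at this

theorem integrable_of_continuousOn {E : Type*} [NormedAddCommGroup E] {f : ℝ → E}
    (hf : ContinuousOn f (Icc 0 1)) : Integrable f unitMeasure :=
  hf.integrableOn_Icc.mono_set Ioc_subset_Icc_self

theorem MemH1.integrable_h1 {u : ℝ → ℂ} (hu : MemH1 u) :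
    Integrable (fun x => ‖u x‖ ^ 2 + ‖deriv u x‖ ^ 2) unitMeasure :=
  (integrable_of_continuousOn (hu.continuousOn.norm.pow 2)).add (integrable_norm_sq hu.memLp)

theorem norm_ofCurve_sub_sq_le {u v : ℝ → ℂ} (hu : u ∈ admissible α) (hv : v ∈ admissible α) :
    ‖ofCurve hu - ofCurve hv‖ ^ 2 ≤ h1NormSq (fun x => u x - v x) := by
  have h1 : ‖ofCurve hu - ofCurve hv‖ = ‖hu.1.memLp.toLp _ - hv.1.memLp.toLp _‖ := by
    change ‖(hu.1.memLp.toLp _ - refDeriv α) - (hv.1.memLp.toLp _ - refDeriv α)‖ = _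
    rw [sub_sub_sub_cancel_right]
  rw [h1, norm_sq_eq_integral, h1NormSq, intervalIntegral_eq_unitMeasure]
  refine integral_mono_ae (integrable_norm_sq (Lp.memLp _)) (hu.1.sub hv.1).integrable_h1 ?_
  filter_upwards [Lp.coeFn_sub (hu.1.memLp.toLp _) (hv.1.memLp.toLp _), hu.1.memLp.coeFn_toLp,
    hv.1.memLp.coeFn_toLp, hu.1.deriv_sub hv.1] with x e1 e2 e3 e4
  rw [e1, Pi.sub_apply, e2, e3, e4]
  exact le_add_of_nonneg_left (by positivity)

theorem h1NormSq_nonneg (u : ℝ → ℂ) : 0 ≤ h1NormSq u :=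
  intervalIntegral.integral_nonneg zero_le_one fun _ _ => by positivity

theorem toCurve_sub (f g : MeanZero) {x : ℝ} (hx : x ∈ Icc (0 : ℝ) 1) :
    toCurve α f x - toCurve α g x = ∫ t in (0 : ℝ)..x, ((f - g : MeanZero) : L2C) t := by
  have h : primitiveL ((f - g : MeanZero) : L2C) ⟨x, hx⟩
      = primitiveL (refDeriv α + f) ⟨x, hx⟩ - primitiveL (refDeriv α + g) ⟨x, hx⟩ := by
    rw [← BoundedContinuousFunction.sub_apply, ← map_sub]
    congr 2
    simp
  rw [← primitiveL_apply ((f - g : MeanZero) : L2C) ⟨x, hx⟩, h]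
  exact add_sub_add_left_eq_sub _ _ _

theorem norm_toCurve_sub_le (f g : MeanZero) {x : ℝ} (hx : x ∈ Icc (0 : ℝ) 1) :
    ‖toCurve α f x - toCurve α g x‖ ≤ ‖f - g‖ := by
  rw [toCurve_sub f g hx]
  exact norm_primitive_le _ hx

theorem h1NormSq_toCurve_sub_le (f g : MeanZero) :
    h1NormSq (fun x => toCurve α f x - toCurve α g x) ≤ 2 * ‖f - g‖ ^ 2 := by
  have i1 : Integrable (fun x => ‖((f - g : MeanZero) : L2C) x‖ ^ 2) unitMeasure :=
    integrable_norm_sq (Lp.memLp _)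
  rw [h1NormSq, intervalIntegral_eq_unitMeasure]
  calc ∫ x, (‖toCurve α f x - toCurve α g x‖ ^ 2
        + ‖deriv (fun x => toCurve α f x - toCurve α g x) x‖ ^ 2) ∂unitMeasure
      ≤ ∫ x, (‖f - g‖ ^ 2 + ‖((f - g : MeanZero) : L2C) x‖ ^ 2) ∂unitMeasure := by
        refine integral_mono_ae ((memH1_toCurve f).sub (memH1_toCurve g)).integrable_h1
          ((integrable_const _).add i1) ?_
        filter_upwards [ae_mem_unit, (memH1_toCurve (α := α) f).deriv_sub (memH1_toCurve g),
          deriv_toCurve (α := α) f, deriv_toCurve (α := α) g, Lp.coeFn_add (refDeriv α) (f : L2C),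
          Lp.coeFn_add (refDeriv α) (g : L2C), Lp.coeFn_sub (f : L2C) (g : L2C)]
          with x hx e1 e2 e3 e4 e5 e6
        have h : deriv (fun x => toCurve α f x - toCurve α g x) x
            = ((f - g : MeanZero) : L2C) x := by
          rw [e1, e2, e3, e4, e5, Submodule.coe_sub, e6]
          simp
        simp only [h]
        gcongr
        exact norm_toCurve_sub_le f g hx
    _ = 2 * ‖f - g‖ ^ 2 := by
        rw [integral_add (integrable_const _) i1, ← norm_sq_eq_integral]
        simp
        ring

theorem memH1_of_contDiff {u : ℝ → ℂ} (hu : ContDiff ℝ 1 u) : MemH1 u where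
  absolutelyContinuous := hu.contDiffOn.absolutelyContinuousOnInterval
  memLp_deriv := by
    have hc : Continuous (deriv u) := hu.continuous_deriv le_rfl
    obtain ⟨C, hC⟩ := isCompact_Icc.exists_bound_of_continuousOn (s := Icc (0 : ℝ) 1) hc.continuousOn
    rw [restrict_Ioo_eq_unitMeasure]
    refine MemLp.of_bound hc.aestronglyMeasurable C ?_
    filter_upwards [ae_mem_unit] with x hx using hC x hx

theorem exp_two_pi_nat_add (α : ℝ) (M : ℕ) :
    Complex.exp (((2 * Real.pi * M + α : ℝ) : ℂ) * Complex.I) = Complex.exp (α * Complex.I) := by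
  have : (((2 * Real.pi * M + α : ℝ) : ℂ) * Complex.I)
      = α * Complex.I + M * (2 * Real.pi * Complex.I) := by
    push_cast; ring
  rw [this, Complex.exp_add, Complex.exp_nat_mul_two_pi_mul_I, mul_one]

theorem hasDerivAt_exp_mul_I (k c x : ℝ) :
    HasDerivAt (fun x : ℝ => Complex.exp (((k * x + c : ℝ) : ℂ) * Complex.I))
      (k * Complex.I * Complex.exp (((k * x + c : ℝ) : ℂ) * Complex.I)) x := by
  have h1 : HasDerivAt (fun x : ℝ => k * x + c) k x := by
    simpa using ((hasDerivAt_id x).const_mul k).add_const c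
  have := (h1.ofReal_comp.mul_const Complex.I).cexp
  rwa [mul_comm] at this

theorem twistState_mem (α : ℝ) (M : ℕ) : twistState α M ∈ admissible α := by
  refine ⟨memH1_of_contDiff ?_, by simp [twistState], ?_⟩
  · unfold twistState
    exact ((Complex.ofRealCLM.contDiff.comp (contDiff_const.mul contDiff_id)).mul
      contDiff_const).cexp
  · rw [twistState, mul_one, exp_two_pi_nat_add]

/-- On differences of admissible curves the `H¹` norm and the `L²` norm of the derivative are
equivalent, so continuous paths correspond in both directions. Curves are compared on `[0,1]` only,
which is all that the energy sees. -/
theorem mountainPassLevel_eq (M M' : ℕ) :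
    mountainPassLevel L N α ε M M' = minimaxLevel (modelEnergy L N α ε)
      (ofCurve (twistState_mem α M)) (ofCurve (twistState_mem α M')) := by
  unfold mountainPassLevel minimaxLevel
  congr 1
  ext m
  constructor
  · rintro ⟨γ, hγ, hm⟩
    have hcont : Continuous fun t : I => ofCurve (hγ.mem t t.2) := by
      rw [continuous_iff_continuousAt]
      intro s
      have h1 : Tendsto (fun t : I => h1NormSq (fun x => γ t x - γ s x)) (𝓝 s) (𝓝 0) := by
        have := hγ.continuous s s.2
        rwa [nhdsWithin_eq_map_subtype_coe s.2, tendsto_map'_iff] at this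
      rw [ContinuousAt, tendsto_iff_norm_sub_tendsto_zero]
      have h2 : Tendsto (fun t : I => √(h1NormSq (fun x => γ t x - γ s x))) (𝓝 s) (𝓝 0) := by
        simpa using h1.sqrt
      refine squeeze_zero (fun _ => norm_nonneg _) (fun t => ?_) h2
      exact Real.le_sqrt_of_sq_le (norm_ofCurve_sub_sq_le _ _)
    refine ⟨⟨⟨_, hcont⟩, ofCurve_congr (hγ.mem _ (0 : I).2) _ hγ.source,
      ofCurve_congr (hγ.mem _ (1 : I).2) _ hγ.target⟩, ?_⟩
    convert hm using 1
    ext y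
    simp only [mem_range, mem_image, Path.coe_mk_mk, modelEnergy_ofCurve]
    exact ⟨fun ⟨t, ht⟩ => ⟨t, t.2, ht⟩, fun ⟨t, ht, h⟩ => ⟨⟨t, ht⟩, h⟩⟩
  · rintro ⟨Γ, hm⟩
    refine ⟨fun t => toCurve α (Γ.extend t), ⟨fun t _ => toCurve_mem _, fun s _ => ?_, ?_, ?_⟩, ?_⟩
    · have h1 : Tendsto (fun t => 2 * ‖Γ.extend t - Γ.extend s‖ ^ 2) (𝓝[Icc 0 1] s) (𝓝 0) := by
        have : Continuous fun t => 2 * ‖Γ.extend t - Γ.extend s‖ ^ 2 := by fun_prop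
        simpa using (this.tendsto s).mono_left nhdsWithin_le_nhds
      exact squeeze_zero (fun _ => h1NormSq_nonneg _) (fun t => h1NormSq_toCurve_sub_le _ _) h1
    · simp only [Path.extend_zero]
      exact toCurve_ofCurve _
    · simp only [Path.extend_one]
      exact toCurve_ofCurve _
    · convert hm using 1
      ext y
      simp only [mem_range, mem_image, energy_toCurve]
      exact ⟨fun ⟨t, ht, h⟩ => ⟨⟨t, ht⟩, by rw [← h, Path.extend_apply]⟩,
        fun ⟨t, h⟩ => ⟨t, t.2, by rw [← h, Path.extend_apply]⟩⟩

theorem exists_modelGradient (L : ℝ) (N : ℕ) (α ε : ℝ) :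
    ∃ G : MeanZero → MeanZero, HasQuadRemainder (modelEnergy L N α ε) G ∧
      ∀ f h, ⟪G f, h⟫ = (model N α).variation (ε / 2) (1 / (4 * ε)) (L / 2) f h :=
  (model N α).exists_hasQuadRemainder _ _ _

theorem continuous_modelEnergy (L : ℝ) (N : ℕ) (α ε : ℝ) : Continuous (modelEnergy L N α ε) :=
  let ⟨_, hG, _⟩ := exists_modelGradient L N α ε
  hG.continuous

theorem exists_isCriticalPoint (hL : 0 < L) (hε : 0 < ε) : ∃ v, IsCriticalPoint L N α ε v := by
  obtain ⟨G, hG, hGv⟩ := exists_modelGradient L N α ε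
  obtain ⟨f, hf⟩ := exists_critical_minimizer hG
    ((model N α).bounded_sublevel (by positivity) (by positivity) (by positivity))
    ((model N α).palaisSmaleAt hGv (by positivity) (by positivity) (by positivity))
    ⟨0, by
      rintro _ ⟨f, rfl⟩
      unfold modelEnergy TwistModel.energy
      positivity⟩
  exact ⟨_, isCriticalPoint_toCurve hG hf⟩

theorem exists_isCriticalPoint_minimaxLevel (hL : 0 < L) (hε : 0 < ε) {a b : MeanZero}
    (ha : modelEnergy L N α ε a < minimaxLevel (modelEnergy L N α ε) a b)
    (hb : modelEnergy L N α ε b < minimaxLevel (modelEnergy L N α ε) a b) :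
    ∃ v, IsCriticalPoint L N α ε v ∧
      energy L N ε v = minimaxLevel (modelEnergy L N α ε) a b := by
  obtain ⟨G, hG, hGv⟩ := exists_modelGradient L N α ε
  obtain ⟨f, hf, hf'⟩ := exists_critical_minimaxLevel hG
    ((model N α).bounded_sublevel (by positivity) (by positivity) (by positivity))
    ((model N α).palaisSmaleAt hGv (by positivity) (by positivity) (by positivity)) ha hb
  exact ⟨_, isCriticalPoint_toCurve hG hf', by rw [energy_toCurve, hf]⟩

end Cholesteric

end

noncomputable section

/-! ### The phase increment of a curve without zeros. -/

namespace Cholesteric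

open scoped BoundedContinuousFunction ENNReal RealInnerProductSpace unitInterval

variable {L : ℝ} {N : ℕ} {α ε : ℝ}

theorem sq_integral_le {g : ℝ → ℝ} (hg : MemLp g 2 unitMeasure) :
    (∫ x, g x ∂unitMeasure) ^ 2 ≤ ∫ x, g x ^ 2 ∂unitMeasure := by
  have h1 : Integrable g unitMeasure := hg.integrable one_le_two
  have h2 : Integrable (fun x => g x ^ 2) unitMeasure := hg.integrable_sq
  set m := ∫ x, g x ∂unitMeasure with hm
  have h3 : 0 ≤ ∫ x, (g x - m) ^ 2 ∂unitMeasure := integral_nonneg fun _ => sq_nonneg _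
  have h4 : ∫ x, (g x - m) ^ 2 ∂unitMeasure = ∫ x, (g x ^ 2 - 2 * m * g x + m ^ 2) ∂unitMeasure :=
    integral_congr_ae (Eventually.of_forall fun x => by ring)
  have h5 : ∫ x, (g x ^ 2 - 2 * m * g x + m ^ 2) ∂unitMeasure
      = (∫ x, g x ^ 2 ∂unitMeasure) - 2 * m * m + m ^ 2 := by
    have h6 : Integrable (fun x => g x ^ 2 - 2 * m * g x) unitMeasure := h2.sub (h1.const_mul _)
    rw [integral_add h6 (integrable_const _), integral_sub h2 (h1.const_mul _), integral_const_mul,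
      ← hm]
    simp
  nlinarith

theorem integral_norm_le (F : L2C) : ∫ x, ‖F x‖ ∂unitMeasure ≤ ‖F‖ := by
  refine le_of_sq_le_sq ?_ (norm_nonneg _)
  rw [norm_sq_eq_integral]
  exact sq_integral_le (Lp.memLp F).norm

/-- The integral of the logarithmic derivative. -/
def logIncrement (u : ℝ → ℂ) : ℂ := ∫ x, deriv u x / u x ∂unitMeasure

theorem logIncrement_congr {u v : ℝ → ℂ} (h : EqOn u v (Icc 0 1)) :
    logIncrement u = logIncrement v := by
  refine integral_congr_ae ?_
  filter_upwards [deriv_ae_eq_of_eqOn h, ae_mem_unit] with x h1 h2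
  rw [h1, h h2]

theorem intervalIntegrable_logDeriv {u : ℝ → ℂ} (hu : MemH1 u)
    (h0 : ∀ x ∈ Icc (0 : ℝ) 1, u x ≠ 0) :
    IntervalIntegrable (fun x => deriv u x / u x) volume 0 1 := by
  simp only [div_eq_mul_inv]
  refine (intervalIntegrable_of_memLp hu.memLp).mul_continuousOn ?_
  rw [uIcc_of_le zero_le_one]
  exact hu.continuousOn.inv₀ h0

theorem integrable_logDeriv {u : ℝ → ℂ} (hu : MemH1 u)
    (h0 : ∀ x ∈ Icc (0 : ℝ) 1, u x ≠ 0) :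
    Integrable (fun x => deriv u x / u x) unitMeasure :=
  (intervalIntegrable_iff_integrableOn_Ioc_of_le zero_le_one).1 (intervalIntegrable_logDeriv hu h0)

/-- With `P` the primitive of `u'/u`, the product `u exp(-P)` is absolutely continuous with
derivative zero almost everywhere. Comparing its values at `0` and `1` gives the claim. -/
theorem exp_logIncrement {u : ℝ → ℂ} (hu : u ∈ admissible α)
    (h0 : ∀ x ∈ Icc (0 : ℝ) 1, u x ≠ 0) :
    Complex.exp (logIncrement u) = Complex.exp (α * Complex.I) := by
  have hint := intervalIntegrable_logDeriv hu.1 h0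
  set P : ℝ → ℂ := fun x => ∫ t in (0 : ℝ)..x, deriv u t / u t with hP
  have hPac : AbsolutelyContinuousOnInterval P 0 1 :=
    hint.absolutelyContinuousOnInterval_intervalIntegral_complex left_mem_uIcc
  have hEac : AbsolutelyContinuousOnInterval (fun x => Complex.exp (-P x)) 0 1 := by
    -- The exponential is Lipschitz only on bounded sets, so a ball containing the range of `P` is
    -- needed.
    obtain ⟨C, hC⟩ := hPac.exists_bound
    have hsmooth : ContDiff ℝ 1 fun z : ℂ => Complex.exp (-z) := contDiff_neg.cexp
    obtain ⟨K, hK⟩ := hsmooth.contDiffOn.exists_lipschitzOnWith one_ne_zero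
      (convex_closedBall (0 : ℂ) C) (isCompact_closedBall 0 C)
    refine hPac.lipschitzOnWith_comp (g := fun z : ℂ => Complex.exp (-z)) (hK.mono ?_)
    rintro _ ⟨x, hx, rfl⟩
    exact mem_closedBall_zero_iff.2 (hC x hx)
  obtain ⟨c, hc⟩ := (hu.1.absolutelyContinuous.fun_smul hEac).const_of_ae_hasDerivAt_zero (by
    filter_upwards [hu.1.absolutelyContinuous.ae_differentiableAt_complex,
      hint.ae_hasDerivAt_integral] with x h1 h2 hx
    have hne := h0 x (by rwa [uIcc_of_le zero_le_one] at hx)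
    have := (h1 hx).hasDerivAt.mul ((h2 hx 0 left_mem_uIcc).neg.cexp)
    refine this.congr_deriv ?_
    field_simp
    ring)
  have e1 := hc 1 right_mem_uIcc
  have e0 := hc 0 left_mem_uIcc
  have hP1 : P 1 = logIncrement u := intervalIntegral_eq_unitMeasure _
  have hP0 : P 0 = 0 := intervalIntegral.integral_same
  rw [← e0, hP1, hP0, hu.2.1, hu.2.2, smul_eq_mul, Complex.exp_neg] at e1
  simp only [neg_zero, Complex.exp_zero, smul_eq_mul, mul_one] at e1
  field_simp [Complex.exp_ne_zero] at e1
  exact e1.symm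

theorem logIncrement_sub_le {f g : MeanZero} {δ : ℝ} (hδ : 0 < δ)
    (hf : ∀ x ∈ Icc (0 : ℝ) 1, δ ≤ ‖toCurve α f x‖) (hg : ∀ x ∈ Icc (0 : ℝ) 1, δ ≤ ‖toCurve α g x‖) :
    ‖logIncrement (toCurve α f) - logIncrement (toCurve α g)‖
      ≤ (δ⁻¹ + δ⁻¹ * δ⁻¹ * ‖refDeriv α + g‖) * ‖f - g‖ := by
  have nf : ∀ x ∈ Icc (0 : ℝ) 1, toCurve α f x ≠ 0 := fun x hx =>
    norm_pos_iff.1 (hδ.trans_le (hf x hx))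
  have ng : ∀ x ∈ Icc (0 : ℝ) 1, toCurve α g x ≠ 0 := fun x hx =>
    norm_pos_iff.1 (hδ.trans_le (hg x hx))
  rw [logIncrement, logIncrement, ← integral_sub (integrable_logDeriv (memH1_toCurve f) nf)
    (integrable_logDeriv (memH1_toCurve g) ng)]
  have i1 : Integrable (fun x => δ⁻¹ * ‖((f - g : MeanZero) : L2C) x‖) unitMeasure :=
    (((Lp.memLp _).integrable one_le_two).norm).const_mul _
  have i2 : Integrable (fun x => δ⁻¹ * δ⁻¹ * ‖f - g‖ * ‖(refDeriv α + g : L2C) x‖) unitMeasure :=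
    (((Lp.memLp _).integrable one_le_two).norm).const_mul _
  calc _ ≤ ∫ x, ‖deriv (toCurve α f) x / toCurve α f x
          - deriv (toCurve α g) x / toCurve α g x‖ ∂unitMeasure := norm_integral_le_integral_norm _
    _ ≤ ∫ x, (δ⁻¹ * ‖((f - g : MeanZero) : L2C) x‖
          + δ⁻¹ * δ⁻¹ * ‖f - g‖ * ‖(refDeriv α + g : L2C) x‖) ∂unitMeasure := by
        refine integral_mono_ae ((integrable_logDeriv (memH1_toCurve f) nf).sub
          (integrable_logDeriv (memH1_toCurve g) ng)).norm (i1.add i2) ?_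
        filter_upwards [ae_mem_unit, deriv_toCurve (α := α) f, deriv_toCurve (α := α) g,
          Lp.coeFn_add (refDeriv α) (f : L2C), Lp.coeFn_add (refDeriv α) (g : L2C),
          Lp.coeFn_sub (f : L2C) (g : L2C)] with x hx e2 e3 e4 e5 e6
        have hsub : ((f - g : MeanZero) : L2C) x
            = deriv (toCurve α f) x - deriv (toCurve α g) x := by
          rw [e2, e3, e4, e5, Submodule.coe_sub, e6]
          simp
        have heq : deriv (toCurve α f) x / toCurve α f x - deriv (toCurve α g) x / toCurve α g x
            = (toCurve α f x)⁻¹ * ((f - g : MeanZero) : L2C) x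
              - (toCurve α f x)⁻¹ * (toCurve α g x)⁻¹ * (toCurve α f x - toCurve α g x)
                * (refDeriv α + g : L2C) x := by
          rw [hsub, ← e3]
          have := nf x hx
          have := ng x hx
          field_simp
          ring
        have hif : ‖(toCurve α f x)⁻¹‖ ≤ δ⁻¹ := by
          rw [norm_inv]; exact inv_anti₀ hδ (hf x hx)
        have hig : ‖(toCurve α g x)⁻¹‖ ≤ δ⁻¹ := by
          rw [norm_inv]; exact inv_anti₀ hδ (hg x hx)
        simp only [heq]
        refine (norm_sub_le _ _).trans ?_
        simp only [norm_mul]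
        gcongr
        exact norm_toCurve_sub_le f g hx
    _ ≤ _ := by
        rw [integral_add i1 i2, integral_const_mul, integral_const_mul]
        have h1 := integral_norm_le ((f - g : MeanZero) : L2C)
        have h2 := integral_norm_le (refDeriv α + g : L2C)
        have h3 : ‖((f - g : MeanZero) : L2C)‖ = ‖f - g‖ := rfl
        rw [h3] at h1
        calc _ ≤ δ⁻¹ * ‖f - g‖ + δ⁻¹ * δ⁻¹ * ‖f - g‖ * ‖refDeriv α + g‖ := by gcongr
          _ = _ := by ring

/-- The values of `h` differ by integer multiples of `2πi`. They form a connected countable set,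
which has at most one point. -/
theorem eq_of_continuousOn_of_exp_eq {h : ℝ → ℂ} {a b : ℝ} (hab : a ≤ b) {z : ℂ}
    (hc : ContinuousOn h (Icc a b)) (he : ∀ t ∈ Icc a b, Complex.exp (h t) = z) : h b = h a := by
  have hS : (h '' Icc a b).Countable := by
    refine (countable_range fun n : ℤ => h a + n * (2 * Real.pi * Complex.I)).mono ?_
    rintro _ ⟨t, ht, rfl⟩
    obtain ⟨n, hn⟩ := Complex.exp_eq_exp_iff_exists_int.1
      ((he t ht).trans (he a (left_mem_Icc.2 hab)).symm)
    exact ⟨n, hn.symm⟩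
  exact hS.isTotallyDisconnected _ subset_rfl (isPreconnected_Icc.image h hc)
    (mem_image_of_mem h (right_mem_Icc.2 hab)) (mem_image_of_mem h (left_mem_Icc.2 hab))

end Cholesteric

end

noncomputable section

/-! ### Lower bounds for the wall energy and the twist energy. -/

namespace Cholesteric

open scoped BoundedContinuousFunction ENNReal RealInnerProductSpace unitInterval

variable {L : ℝ} {N : ℕ} {α ε : ℝ}

theorem twist_eq_im (u : ℝ → ℂ) (x : ℝ) :
    twist u x = ((starRingEnd ℂ) (u x) * deriv u x).im := by
  simp [twist, Complex.mul_im]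
  ring

theorem twist_eq_normSq_mul (u : ℝ → ℂ) {x : ℝ} (h : u x ≠ 0) :
    twist u x = ‖u x‖ ^ 2 * (deriv u x / u x).im := by
  have hn : Complex.normSq (u x) ≠ 0 := by simpa using h
  rw [twist, Complex.div_im, Complex.sq_norm]
  field_simp

theorem abs_twist_le (u : ℝ → ℂ) (x : ℝ) : |twist u x| ≤ ‖u x‖ * ‖deriv u x‖ := by
  rw [twist_eq_im]
  refine (Complex.abs_im_le_norm _).trans ?_
  rw [norm_mul, RCLike.norm_conj]

theorem MemH1.memLp_twist {u : ℝ → ℂ} (hu : MemH1 u) : MemLp (twist u) 2 unitMeasure := by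
  obtain ⟨C, hC⟩ := isCompact_Icc.exists_bound_of_continuousOn hu.continuousOn
  have m1 := (integrable_of_continuousOn hu.continuousOn).aestronglyMeasurable
  have m2 := hu.memLp.aestronglyMeasurable
  have hm : AEStronglyMeasurable (twist u) unitMeasure := by
    have := Complex.continuous_im.comp_aestronglyMeasurable
      ((Complex.continuous_conj.comp_aestronglyMeasurable m1).mul m2)
    exact this.congr (Eventually.of_forall fun x => (twist_eq_im u x).symm)
  refine MemLp.of_le_mul (c := C) hu.memLp hm ?_
  filter_upwards [ae_mem_unit] with x hx
  exact (abs_twist_le u x).trans (by gcongr; exact hC x hx)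

theorem abs_deriv_norm_le {u : ℝ → ℂ} {x : ℝ} (h : DifferentiableAt ℝ u x)
    (h' : DifferentiableAt ℝ (fun y => ‖u y‖) x) : |deriv (fun y => ‖u y‖) x| ≤ ‖deriv u x‖ := by
  have t1 := h'.hasDerivAt.tendsto_slope.abs
  have t2 := h.hasDerivAt.tendsto_slope.norm
  refine le_of_tendsto_of_tendsto' t1 t2 fun y => ?_
  rw [slope_def_field, slope_def_module, norm_smul, abs_div, div_eq_inv_mul, norm_inv,
    Real.norm_eq_abs]
  gcongr
  exact abs_norm_sub_norm_le _ _

/-- The primitive of `1 - s²`, which measures the cost of a transition layer. -/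
def layerCost (s : ℝ) : ℝ := s - s ^ 3 / 3

theorem hasDerivAt_layerCost (s : ℝ) : HasDerivAt layerCost (1 - s ^ 2) s := by
  have := (hasDerivAt_id s).sub (((hasDerivAt_id s).pow 3).div_const 3)
  refine this.congr_deriv ?_
  simp

theorem MemH1.norm_absolutelyContinuous {u : ℝ → ℂ} (hu : MemH1 u) :
    AbsolutelyContinuousOnInterval (fun x => ‖u x‖) 0 1 :=
  hu.absolutelyContinuous.lipschitzWith_comp lipschitzWith_one_norm

theorem MemH1.layerCost_absolutelyContinuous {u : ℝ → ℂ} (hu : MemH1 u) :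
    AbsolutelyContinuousOnInterval (fun x => layerCost ‖u x‖) 0 1 := by
  have hn := hu.norm_absolutelyContinuous
  have h3 := (hn.fun_mul (hn.fun_mul hn)).const_mul (1 / 3)
  refine (hn.fun_sub h3).congr fun x _ => ?_
  simp only [layerCost]
  ring

/-- The Modica–Mortola inequality. -/
theorem abs_deriv_layerCost_le {u : ℝ → ℂ} (hu : MemH1 u) (hε : 0 < ε) :
    ∀ᵐ x ∂unitMeasure, |deriv (fun x => layerCost ‖u x‖) x|
      ≤ √2 * (ε / 2 * ‖deriv u x‖ ^ 2 + 1 / (4 * ε) * (‖u x‖ ^ 2 - 1) ^ 2) := by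
  filter_upwards [ae_unit_of_ae hu.norm_absolutelyContinuous.ae_differentiableAt,
    hu.ae_differentiableAt] with x h1 h2
  have hd : deriv (fun x => layerCost ‖u x‖) x = (1 - ‖u x‖ ^ 2) * deriv (fun y => ‖u y‖) x :=
    (HasDerivAt.comp (h₂ := layerCost) x (hasDerivAt_layerCost ‖u x‖) h1.hasDerivAt).deriv
  rw [hd, abs_mul]
  have h3 := abs_deriv_norm_le h2 h1
  set a := |1 - ‖u x‖ ^ 2| with ha
  set b := ‖deriv u x‖ with hb
  have ha2 : (‖u x‖ ^ 2 - 1) ^ 2 = a ^ 2 := by rw [ha, sq_abs]; ring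
  have ha0 : 0 ≤ a := abs_nonneg _
  have hb0 : 0 ≤ b := norm_nonneg _
  rw [ha2]
  refine (mul_le_mul_of_nonneg_left h3 ha0).trans ?_
  have h2 : √2 ^ 2 = 2 := Real.sq_sqrt zero_le_two
  have hs : 0 < √2 := by positivity
  have key : √2 * (ε / 2 * b ^ 2 + 1 / (4 * ε) * a ^ 2) - a * b
      = √2 / (4 * ε) * (a - √2 * ε * b) ^ 2 := by
    field_simp
    ring_nf
    rw [show √2 ^ 3 = √2 ^ 2 * √2 by ring, h2]
    ring
  have : 0 ≤ √2 / (4 * ε) * (a - √2 * ε * b) ^ 2 := by positivity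
  linarith

/-- The Ginzburg–Landau part of the energy density. -/
def wallDensity (ε : ℝ) (u : ℝ → ℂ) (x : ℝ) : ℝ :=
  ε / 2 * ‖deriv u x‖ ^ 2 + 1 / (4 * ε) * (‖u x‖ ^ 2 - 1) ^ 2

theorem MemH1.integrable_potential {u : ℝ → ℂ} (hu : MemH1 u) :
    Integrable (fun x => (‖u x‖ ^ 2 - 1) ^ 2) unitMeasure :=
  integrable_of_continuousOn (((hu.continuousOn.norm.pow 2).sub continuousOn_const).pow 2)

theorem MemH1.integrable_wallDensity {u : ℝ → ℂ} (hu : MemH1 u) (ε : ℝ) :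
    Integrable (wallDensity ε u) unitMeasure :=
  ((integrable_norm_sq hu.memLp).const_mul _).add (hu.integrable_potential.const_mul _)

theorem MemH1.integrable_twist_sub_sq {u : ℝ → ℂ} (hu : MemH1 u) (c : ℝ) :
    Integrable (fun x => (twist u x - c) ^ 2) unitMeasure :=
  (hu.memLp_twist.sub (memLp_const c)).integrable_sq

theorem energy_eq_add {u : ℝ → ℂ} (hu : MemH1 u) :
    energy L N ε u = (∫ x, wallDensity ε u x ∂unitMeasure)
      + L / 2 * ∫ x, (twist u x - 2 * Real.pi * N) ^ 2 ∂unitMeasure := by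
  rw [energy, intervalIntegral_eq_unitMeasure, ← integral_const_mul,
    ← integral_add (hu.integrable_wallDensity ε) ((hu.integrable_twist_sub_sq _).const_mul _)]
  rfl

/-- The modulus is `1` at both ends, where `layerCost` equals `2/3`. Going to the value at `x₀` and
back costs its variation twice, and the Modica–Mortola inequality turns this into energy. -/
theorem le_integral_wallDensity {u : ℝ → ℂ} (hu : u ∈ admissible α) (hε : 0 < ε) {x₀ : ℝ}
    (hx₀ : x₀ ∈ Icc (0 : ℝ) 1) :
    √2 * (2 / 3 - layerCost ‖u x₀‖) ≤ ∫ x, wallDensity ε u x ∂unitMeasure := by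
  set g : ℝ → ℝ := fun x => layerCost ‖u x‖ with hg
  have hac : AbsolutelyContinuousOnInterval g 0 1 := hu.1.layerCost_absolutelyContinuous
  have h01 : uIcc (0 : ℝ) 1 = Icc 0 1 := uIcc_of_le zero_le_one
  have s1 : uIcc 0 x₀ ⊆ uIcc (0 : ℝ) 1 := by rw [h01]; exact uIcc_subset_Icc zero_mem_unit hx₀
  have s2 : uIcc x₀ 1 ⊆ uIcc (0 : ℝ) 1 := by rw [h01]; exact uIcc_subset_Icc hx₀ one_mem_unit
  have e1 := (hac.mono s1).integral_deriv_eq_sub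
  have e2 := (hac.mono s2).integral_deriv_eq_sub
  have i := hac.intervalIntegrable_deriv.abs
  have b1 : |∫ x in (0 : ℝ)..x₀, deriv g x| ≤ ∫ x in (0 : ℝ)..x₀, |deriv g x| :=
    intervalIntegral.abs_integral_le_integral_abs hx₀.1
  have b2 : |∫ x in x₀..1, deriv g x| ≤ ∫ x in x₀..1, |deriv g x| :=
    intervalIntegral.abs_integral_le_integral_abs hx₀.2
  have hadd := intervalIntegral.integral_add_adjacent_intervals (i.mono_set s1) (i.mono_set s2)
  have hg0 : g 0 = 2 / 3 := by simp [hg, hu.2.1, layerCost]; norm_num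
  have hg1 : g 1 = 2 / 3 := by
    simp [hg, hu.2.2, layerCost, Complex.norm_exp_ofReal_mul_I]; norm_num
  rw [e1, hg0] at b1
  rw [e2, hg1] at b2
  have c1 := (abs_le.1 b1).1
  have c2 := (abs_le.1 b2).2
  have hint : Integrable (fun x => |deriv g x|) unitMeasure :=
    (intervalIntegrable_iff_integrableOn_Ioc_of_le zero_le_one).1 i
  have hle : ∫ x in (0 : ℝ)..1, |deriv g x| ≤ √2 * ∫ x, wallDensity ε u x ∂unitMeasure := by
    rw [intervalIntegral_eq_unitMeasure, ← integral_const_mul]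
    exact integral_mono_ae hint ((hu.1.integrable_wallDensity ε).const_mul _)
      (abs_deriv_layerCost_le hu.1 hε)
  have h2 : √2 ^ 2 = 2 := Real.sq_sqrt zero_le_two
  have hs : 0 < √2 := by positivity
  have : 2 * (2 / 3 - g x₀) ≤ √2 * ∫ x, wallDensity ε u x ∂unitMeasure := by linarith
  refine le_of_mul_le_mul_left ?_ hs
  calc √2 * (√2 * (2 / 3 - layerCost ‖u x₀‖)) = √2 ^ 2 * (2 / 3 - g x₀) := by ring
    _ ≤ _ := by rw [h2]; exact this

/-- The total twist is close to the increment of the phase. -/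
theorem abs_phase_sub_twist_le {u : ℝ → ℂ} (hu : u ∈ admissible α) (hL : 0 < L) (hε : 0 < ε)
    {δ K : ℝ} (hδ : 0 < δ) (hlow : ∀ x ∈ Icc (0 : ℝ) 1, δ ≤ ‖u x‖) (hK : energy L N ε u ≤ K) :
    |(logIncrement u).im - ∫ x, twist u x ∂unitMeasure|
      ≤ √ε * (δ⁻¹ ^ 2 * (2 * K + 2 * K / L + 4 * Real.pi ^ 2 * N ^ 2)) := by
  have hne : ∀ x ∈ Icc (0 : ℝ) 1, u x ≠ 0 := fun x hx => norm_pos_iff.1 (hδ.trans_le (hlow x hx))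
  have hlog := integrable_logDeriv hu.1 hne
  set c : ℝ := 2 * Real.pi * N with hc
  set s := √ε with hs
  have hs0 : 0 < s := Real.sqrt_pos.2 hε
  have hs2 : s ^ 2 = ε := Real.sq_sqrt hε.le
  have hlogim : Integrable (fun x => (deriv u x / u x).im) unitMeasure := hlog.im
  have him : (logIncrement u).im = ∫ x, (deriv u x / u x).im ∂unitMeasure :=
    (integral_im hlog).symm
  have hI1 := hu.1.integrable_potential
  have hI2 := hu.1.integrable_twist_sub_sq c
  have hW0 : 0 ≤ ∫ x, wallDensity ε u x ∂unitMeasure :=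
    integral_nonneg fun x => by unfold wallDensity; positivity
  have hT0 : 0 ≤ ∫ x, (twist u x - c) ^ 2 ∂unitMeasure := integral_nonneg fun x => sq_nonneg _
  have hE := energy_eq_add (L := L) (N := N) (ε := ε) hu.1
  have hpot : ∫ x, (‖u x‖ ^ 2 - 1) ^ 2 ∂unitMeasure ≤ 4 * ε * K := by
    have h1 : ∫ x, 1 / (4 * ε) * (‖u x‖ ^ 2 - 1) ^ 2 ∂unitMeasure
        ≤ ∫ x, wallDensity ε u x ∂unitMeasure :=
      integral_mono (hI1.const_mul _) (hu.1.integrable_wallDensity ε) fun x => by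
        unfold wallDensity
        have : 0 ≤ ε / 2 * ‖deriv u x‖ ^ 2 := by positivity
        linarith
    rw [integral_const_mul] at h1
    have h2 : 1 / (4 * ε) * ∫ x, (‖u x‖ ^ 2 - 1) ^ 2 ∂unitMeasure ≤ K := by nlinarith
    rw [one_div_mul_eq_div, div_le_iff₀ (by positivity)] at h2
    linarith
  have htw : ∫ x, (twist u x - c) ^ 2 ∂unitMeasure ≤ 2 * K / L := by
    rw [le_div_iff₀ hL]
    nlinarith
  rw [him, ← integral_sub hlogim (hu.1.memLp_twist.integrable one_le_two)]
  have i1 : Integrable (fun x => δ⁻¹ ^ 2 * (1 / (2 * s)) * (‖u x‖ ^ 2 - 1) ^ 2) unitMeasure :=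
    hI1.const_mul _
  have i2 : Integrable (fun x => δ⁻¹ ^ 2 * s * (twist u x - c) ^ 2) unitMeasure :=
    hI2.const_mul _
  have i3 : Integrable (fun _ : ℝ => δ⁻¹ ^ 2 * s * c ^ 2) unitMeasure := integrable_const _
  have i12 : Integrable (fun x => δ⁻¹ ^ 2 * (1 / (2 * s)) * (‖u x‖ ^ 2 - 1) ^ 2
    + δ⁻¹ ^ 2 * s * (twist u x - c) ^ 2) unitMeasure := i1.add i2
  calc |∫ x, ((deriv u x / u x).im - twist u x) ∂unitMeasure|
      ≤ ∫ x, |(deriv u x / u x).im - twist u x| ∂unitMeasure := abs_integral_le_integral_abs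
    _ ≤ ∫ x, (δ⁻¹ ^ 2 * (1 / (2 * s)) * (‖u x‖ ^ 2 - 1) ^ 2 + δ⁻¹ ^ 2 * s * (twist u x - c) ^ 2
          + δ⁻¹ ^ 2 * s * c ^ 2) ∂unitMeasure := by
        refine integral_mono_ae (hlogim.sub (hu.1.memLp_twist.integrable one_le_two)).abs
          (i12.add i3) ?_
        filter_upwards [ae_mem_unit] with x hx
        have hux := hne x hx
        have hn : 0 < ‖u x‖ := norm_pos_iff.2 hux
        set p := ‖u x‖ ^ 2 - 1 with hp
        set w := twist u x with hw
        have hq : (deriv u x / u x).im = w * ‖u x‖⁻¹ ^ 2 := by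
          rw [hw, twist_eq_normSq_mul u hux]
          field_simp
        have hd : (deriv u x / u x).im - w = -(‖u x‖⁻¹ ^ 2 * (p * w)) := by
          rw [hq, hp]; field_simp; ring
        have hinv : ‖u x‖⁻¹ ^ 2 ≤ δ⁻¹ ^ 2 := by
          gcongr
          exact hlow x hx
        -- The weight `s = √ε` balances the terms: `∫ p²` is at most `4εK`, while the twist integral
        -- is merely bounded, so each contribution is of order `√ε`.
        have hyoung : |p * w| ≤ 1 / (2 * s) * p ^ 2 + s * (w - c) ^ 2 + s * c ^ 2 := by
          have h1 : 0 ≤ 1 / (2 * s) * (p - s * w) ^ 2 := by positivity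
          have h2 : 0 ≤ 1 / (2 * s) * (p + s * w) ^ 2 := by positivity
          have h3 : 0 ≤ s / 2 * (w - 2 * c) ^ 2 := by positivity
          have h4 : 1 / (2 * s) * (p - s * w) ^ 2
              = 1 / (2 * s) * p ^ 2 - p * w + s / 2 * w ^ 2 := by field_simp; ring
          have h5 : 1 / (2 * s) * (p + s * w) ^ 2
              = 1 / (2 * s) * p ^ 2 + p * w + s / 2 * w ^ 2 := by field_simp; ring
          have h6 : s * (w - c) ^ 2 + s * c ^ 2 = s / 2 * w ^ 2 + s / 2 * (w - 2 * c) ^ 2 := by ring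
          rw [abs_le]
          constructor <;> linarith
        simp only [hd, abs_neg, abs_mul (‖u x‖⁻¹ ^ 2)]
        rw [abs_of_nonneg (by positivity : (0 : ℝ) ≤ ‖u x‖⁻¹ ^ 2)]
        calc ‖u x‖⁻¹ ^ 2 * |p * w|
            ≤ δ⁻¹ ^ 2 * (1 / (2 * s) * p ^ 2 + s * (w - c) ^ 2 + s * c ^ 2) := by gcongr
          _ = _ := by ring
    _ = δ⁻¹ ^ 2 * (1 / (2 * s)) * (∫ x, (‖u x‖ ^ 2 - 1) ^ 2 ∂unitMeasure)
          + δ⁻¹ ^ 2 * s * (∫ x, (twist u x - c) ^ 2 ∂unitMeasure) + δ⁻¹ ^ 2 * s * c ^ 2 := by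
        rw [integral_add i12 i3, integral_add i1 i2, integral_const_mul, integral_const_mul]
        simp
    _ ≤ δ⁻¹ ^ 2 * (1 / (2 * s)) * (4 * ε * K) + δ⁻¹ ^ 2 * s * (2 * K / L)
          + δ⁻¹ ^ 2 * s * c ^ 2 := by gcongr
    _ = s * (δ⁻¹ ^ 2 * (2 * K + 2 * K / L + 4 * Real.pi ^ 2 * N ^ 2)) := by
        rw [← hs2, hc]
        field_simp
        ring

/-- The wall bound at `x₀` and Jensen's inequality for the twist concern different parts of the
energy, so they add up. Replacing the total twist by the phase increment costs the error term. -/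
theorem le_energy_of_layer {u : ℝ → ℂ} (hu : u ∈ admissible α) (hL : 0 < L) (hε : 0 < ε)
    {δ K : ℝ} (hδ : 0 < δ) (hlow : ∀ x ∈ Icc (0 : ℝ) 1, δ ≤ ‖u x‖) {x₀ : ℝ}
    (hx₀ : x₀ ∈ Icc (0 : ℝ) 1) (hu₀ : ‖u x₀‖ ≤ δ) (hK : energy L N ε u ≤ K) :
    √2 * (2 / 3 - δ) + L / 2 * ((logIncrement u).im - 2 * Real.pi * N) ^ 2
      - L * |(logIncrement u).im - 2 * Real.pi * N|
        * (√ε * (δ⁻¹ ^ 2 * (2 * K + 2 * K / L + 4 * Real.pi ^ 2 * N ^ 2))) ≤ energy L N ε u := by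
  have hwall := le_integral_wallDensity hu hε hx₀
  have hcost : layerCost ‖u x₀‖ ≤ δ := by
    unfold layerCost
    have : 0 ≤ ‖u x₀‖ ^ 3 := by positivity
    linarith
  have htw := sq_integral_le (hu.1.memLp_twist.sub (memLp_const (2 * Real.pi * N)))
  have hphase := abs_phase_sub_twist_le hu hL hε hδ hlow hK
  simp only [Pi.sub_apply] at htw
  rw [integral_sub (hu.1.memLp_twist.integrable one_le_two) (integrable_const _)] at htw
  simp only [integral_const, smul_eq_mul, measureReal_restrict_apply_univ,
    Real.volume_real_Ioc, sub_zero, zero_le_one, max_eq_left, one_mul] at htw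
  rw [energy_eq_add hu.1]
  set Θ := (logIncrement u).im
  set T := ∫ x, twist u x ∂unitMeasure
  set c := 2 * Real.pi * N
  set err := √ε * (δ⁻¹ ^ 2 * (2 * K + 2 * K / L + 4 * Real.pi ^ 2 * N ^ 2))
  have h1 : (Θ - c) ^ 2 - 2 * |Θ - c| * err ≤ (T - c) ^ 2 := by
    have h2 : (T - c) ^ 2 = (Θ - c) ^ 2 - 2 * ((Θ - c) * (Θ - T)) + (Θ - T) ^ 2 := by ring
    have h3 : (Θ - c) * (Θ - T) ≤ |Θ - c| * err :=
      (le_abs_self _).trans (by rw [abs_mul]; gcongr)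
    nlinarith [sq_nonneg (Θ - T)]
  have h4 : L / 2 * ((Θ - c) ^ 2 - 2 * |Θ - c| * err)
      ≤ L / 2 * ∫ x, (twist u x - c) ^ 2 ∂unitMeasure := by
    gcongr
    exact h1.trans htw
  have h5 : √2 * (2 / 3 - δ) ≤ √2 * (2 / 3 - layerCost ‖u x₀‖) := by gcongr
  linarith

end Cholesteric

end

noncomputable section

/-! ### Paths that must cross a small modulus, and the lower bound for minimax levels. -/

namespace Cholesteric

open scoped BoundedContinuousFunction ENNReal RealInnerProductSpace unitInterval

variable {L : ℝ} {N : ℕ} {α ε : ℝ}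

theorem norm_twistState (M : ℕ) (x : ℝ) : ‖twistState α M x‖ = 1 :=
  Complex.norm_exp_ofReal_mul_I _

theorem logIncrement_twistState (M : ℕ) :
    logIncrement (twistState α M) = (2 * Real.pi * M + α : ℝ) * Complex.I := by
  have h : ∀ x, deriv (twistState α M) x / twistState α M x
      = (2 * Real.pi * M + α : ℝ) * Complex.I := fun x => by
    have h1 := hasDerivAt_exp_mul_I (2 * Real.pi * M + α) 0 x
    simp only [add_zero] at h1
    have h2 : deriv (twistState α M) x = _ := h1.deriv
    rw [h2, twistState, mul_div_assoc, div_self (Complex.exp_ne_zero _), mul_one]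
  simp [logIncrement, h]

theorem continuous_norm_toCurve {Γ : ℝ → MeanZero} (hΓ : Continuous Γ) {x : ℝ}
    (hx : x ∈ Icc (0 : ℝ) 1) : Continuous fun t => ‖toCurve α (Γ t) x‖ := by
  refine Continuous.norm ?_
  rw [continuous_iff_continuousAt]
  intro s
  rw [ContinuousAt, tendsto_iff_norm_sub_tendsto_zero]
  have h : Tendsto (fun t => ‖Γ t - Γ s‖) (𝓝 s) (𝓝 0) :=
    tendsto_iff_norm_sub_tendsto_zero.1 (hΓ.tendsto s)
  exact squeeze_zero (fun _ => norm_nonneg _) (fun t => norm_toCurve_sub_le _ _ hx) h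

/-- Projection along the compact factor `[0,1]` is a closed map. -/
theorem isClosed_setOf_exists_norm_le {Γ : ℝ → MeanZero} (hΓ : Continuous Γ) (δ : ℝ) :
    IsClosed {t | ∃ x ∈ Icc (0 : ℝ) 1, ‖toCurve α (Γ t) x‖ ≤ δ} := by
  have hU : Continuous fun p : ℝ × Icc (0 : ℝ) 1 => ‖toCurve α (Γ p.1) p.2‖ := by
    have h1 : Continuous fun p : ℝ × Icc (0 : ℝ) 1 =>
        (primitiveL (refDeriv α + Γ p.1), p.2) := by fun_prop
    exact (continuous_const.add (continuous_eval.comp h1)).norm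
  have hC : IsClosed {p : ℝ × Icc (0 : ℝ) 1 | ‖toCurve α (Γ p.1) p.2‖ ≤ δ} :=
    isClosed_le hU continuous_const
  convert isClosedMap_fst_of_compactSpace _ hC using 1
  ext t
  simp only [mem_ofPred_eq, mem_image, Prod.exists, exists_and_right, exists_eq_right, Subtype.exists,
    exists_prop]

/-- The first time at which the modulus reaches the level `δ`. -/
theorem exists_first_crossing {Γ : ℝ → MeanZero} (hΓ : Continuous Γ) {δ : ℝ}
    (h0 : ∀ t ≤ 0, ∀ x ∈ Icc (0 : ℝ) 1, δ < ‖toCurve α (Γ t) x‖)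
    (h1 : ∃ t ∈ Icc (0 : ℝ) 1, ∃ x ∈ Icc (0 : ℝ) 1, ‖toCurve α (Γ t) x‖ ≤ δ) :
    ∃ t ∈ Icc (0 : ℝ) 1, (∃ x ∈ Icc (0 : ℝ) 1, ‖toCurve α (Γ t) x‖ ≤ δ) ∧
      ∀ s ≤ t, ∀ x ∈ Icc (0 : ℝ) 1, δ ≤ ‖toCurve α (Γ s) x‖ := by
  set S := {t | ∃ x ∈ Icc (0 : ℝ) 1, ‖toCurve α (Γ t) x‖ ≤ δ} with hS
  have hcomp : IsCompact (Icc (0 : ℝ) 1 ∩ S) :=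
    isCompact_Icc.inter_right (isClosed_setOf_exists_norm_le hΓ δ)
  obtain ⟨t, ⟨htI, htS⟩, hleast⟩ := hcomp.exists_isLeast (by
    obtain ⟨t, ht, h⟩ := h1
    exact ⟨t, ht, h⟩)
  have hlt : ∀ s < t, ∀ x ∈ Icc (0 : ℝ) 1, δ < ‖toCurve α (Γ s) x‖ := by
    intro s hs x hx
    by_contra! hcon
    rcases le_total s 0 with h | h
    · exact (h0 s h x hx).not_ge hcon
    · exact hs.not_ge (hleast ⟨⟨h, hs.le.trans htI.2⟩, x, hx, hcon⟩)
  refine ⟨t, htI, htS, fun s hs x hx => ?_⟩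
  rcases hs.lt_or_eq with h | rfl
  · exact (hlt s h x hx).le
  · refine ge_of_tendsto (((continuous_norm_toCurve hΓ hx).tendsto s).mono_left
      nhdsWithin_le_nhds : Tendsto _ (𝓝[<] s) _) ?_
    filter_upwards [self_mem_nhdsWithin] with r hr
    exact (hlt r hr x hx).le

/-- The increment of the phase is constant as long as the modulus is bounded away from zero. -/
theorem logIncrement_eq_of_forall_le {Γ : ℝ → MeanZero} (hΓ : Continuous Γ) {δ : ℝ} (hδ : 0 < δ)
    {t : ℝ} (ht : 0 ≤ t)
    (h : ∀ s ∈ Icc 0 t, ∀ x ∈ Icc (0 : ℝ) 1, δ ≤ ‖toCurve α (Γ s) x‖) :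
    logIncrement (toCurve α (Γ t)) = logIncrement (toCurve α (Γ 0)) := by
  refine eq_of_continuousOn_of_exp_eq (h := fun s => logIncrement (toCurve α (Γ s))) ht ?_
    (fun s hs => exp_logIncrement (toCurve_mem _)
      fun x hx => norm_pos_iff.1 (hδ.trans_le (h s hs x hx)))
  intro s hs
  rw [ContinuousWithinAt, tendsto_iff_norm_sub_tendsto_zero]
  have hlim : Tendsto (fun r => (δ⁻¹ + δ⁻¹ * δ⁻¹ * ‖refDeriv α + Γ s‖) * ‖Γ r - Γ s‖)
      (𝓝[Icc 0 t] s) (𝓝 0) := by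
    have : Continuous fun r => (δ⁻¹ + δ⁻¹ * δ⁻¹ * ‖refDeriv α + Γ s‖) * ‖Γ r - Γ s‖ := by fun_prop
    simpa using (this.tendsto s).mono_left nhdsWithin_le_nhds
  refine squeeze_zero' (Eventually.of_forall fun _ => norm_nonneg _) ?_ hlim
  filter_upwards [self_mem_nhdsWithin] with r hr
  exact logIncrement_sub_le hδ (h r hr) (h s hs)

/-- The limit energy of the twist state of class `M`. -/
def limitTwistEnergy (L : ℝ) (N M : ℕ) (α : ℝ) : ℝ :=
  L / 2 * (2 * Real.pi * M + α - 2 * Real.pi * N) ^ 2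

/-- The admissible states that a path from the twist state of class `M` reaches only through a
zero. -/
def Separated (α : ℝ) (M : ℕ) (b : MeanZero) : Prop :=
  (∃ x ∈ Icc (0 : ℝ) 1, toCurve α b x = 0) ∨ ∃ M', M' ≠ M ∧ b = ofCurve (twistState_mem α M')

/-- If the modulus stayed above `δ`, the end could not vanish anywhere and would have the phase
increment of the start, which excludes both kinds of separated state. At the first crossing the
phase increment has not yet changed. -/
theorem exists_crossing_of_separated {M : ℕ} {b : MeanZero} (hb : Separated α M b)
    (γ : Path (ofCurve (twistState_mem α M)) b) {δ : ℝ} (hδ : 0 < δ) (hδ1 : δ < 1) :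
    ∃ t ∈ Icc (0 : ℝ) 1, ∃ x₀ ∈ Icc (0 : ℝ) 1, ‖toCurve α (γ.extend t) x₀‖ ≤ δ ∧
      (∀ x ∈ Icc (0 : ℝ) 1, δ ≤ ‖toCurve α (γ.extend t) x‖) ∧
      (logIncrement (toCurve α (γ.extend t))).im = 2 * Real.pi * M + α := by
  have hinit : ∀ M' : ℕ, ∀ x ∈ Icc (0 : ℝ) 1,
      ‖toCurve α (ofCurve (twistState_mem α M')) x‖ = 1 := fun M' x hx => by
    rw [toCurve_ofCurve _ hx, norm_twistState]
  have hlog : ∀ M' : ℕ, (logIncrement (toCurve α (ofCurve (twistState_mem α M')))).im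
      = 2 * Real.pi * M' + α := fun M' => by
    rw [logIncrement_congr (toCurve_ofCurve _), logIncrement_twistState, Complex.im_ofReal_mul, Complex.I_im,
      mul_one]
  have h0 : ∀ t ≤ 0, ∀ x ∈ Icc (0 : ℝ) 1, δ < ‖toCurve α (γ.extend t) x‖ := fun t ht x hx => by
    rw [γ.extend_of_le_zero ht, hinit M x hx]
    exact hδ1
  have h1 : ∃ t ∈ Icc (0 : ℝ) 1, ∃ x ∈ Icc (0 : ℝ) 1, ‖toCurve α (γ.extend t) x‖ ≤ δ := by
    rcases hb with ⟨x, hx, h⟩ | ⟨M', hM', rfl⟩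
    · exact ⟨1, one_mem_unit, x, hx, by rw [γ.extend_one, h, norm_zero]; exact hδ.le⟩
    · by_contra! hcon
      have := logIncrement_eq_of_forall_le γ.continuous_extend hδ zero_le_one
        fun s hs x hx => (hcon s hs x hx).le
      rw [γ.extend_one, γ.extend_zero] at this
      have := congrArg Complex.im this
      rw [hlog, hlog, add_left_inj, mul_right_inj' (by positivity)] at this
      exact hM' (Nat.cast_injective this)
  obtain ⟨t, ht, ⟨x₀, hx₀, hle⟩, hge⟩ := exists_first_crossing γ.continuous_extend h0 h1
  refine ⟨t, ht, x₀, hx₀, hle, hge t le_rfl, ?_⟩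
  rw [logIncrement_eq_of_forall_le γ.continuous_extend hδ ht.1 fun s hs => hge s hs.2,
    γ.extend_zero, hlog]

/-- The range of `ε` is uniform in the end `b`, which is essential because the wall used as an end
depends on `ε`. -/
theorem eventually_le_max_energy (hL : 0 < L) (N : ℕ) (α : ℝ) (M : ℕ) {η : ℝ} (hη : 0 < η) :
    ∀ᶠ ε in 𝓝[>] (0 : ℝ), ∀ b, Separated α M b →
      ∀ γ : Path (ofCurve (twistState_mem α M)) b,
        ∃ t, limitTwistEnergy L N M α + 2 * √2 / 3 - η ≤ modelEnergy L N α ε (γ t) := by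
  -- Half of `η` pays for the loss `√2 δ` in the wall cost, the other half for the error that
  -- vanishes with `ε` once `δ` is fixed.
  set δ : ℝ := min (1 / 2) (η / 4) with hδdef
  have hδ : 0 < δ := lt_min (by norm_num) (by positivity)
  have hδ1 : δ < 1 := (min_le_left _ _).trans_lt (by norm_num)
  have hδη : √2 * δ ≤ η / 2 := by
    have h1 : √2 ≤ 2 := by
      rw [Real.sqrt_le_left (by norm_num)]; norm_num
    have h2 : δ ≤ η / 4 := min_le_right _ _
    nlinarith
  -- The target level serves as the a priori energy bound: arguing by contradiction, the crossing
  -- curve has less energy than this.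
  set K := limitTwistEnergy L N M α + 2 * √2 / 3 with hK
  set Θ : ℝ := 2 * Real.pi * M + α with hΘ
  have herr : Tendsto (fun ε => L * |Θ - 2 * Real.pi * N|
        * (√ε * (δ⁻¹ ^ 2 * (2 * K + 2 * K / L + 4 * Real.pi ^ 2 * N ^ 2)))) (𝓝[>] 0) (𝓝 0) := by
    have : Continuous fun ε => L * |Θ - 2 * Real.pi * N|
        * (√ε * (δ⁻¹ ^ 2 * (2 * K + 2 * K / L + 4 * Real.pi ^ 2 * N ^ 2))) := by fun_prop
    simpa using (this.tendsto 0).mono_left nhdsWithin_le_nhds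
  filter_upwards [herr.eventually (gt_mem_nhds (half_pos hη)), self_mem_nhdsWithin]
    with ε hsmall hε b hb γ
  obtain ⟨t, ht, x₀, hx₀, hle, hge, hlog⟩ := exists_crossing_of_separated hb γ hδ hδ1
  refine ⟨⟨t, ht⟩, ?_⟩
  rw [← γ.extend_apply ht, ← energy_toCurve]
  by_contra! hcon
  have := le_energy_of_layer (toCurve_mem (γ.extend t)) hL hε hδ hge hx₀ hle
    (K := K) (by linarith)
  rw [hlog] at this
  have hlim : limitTwistEnergy L N M α = L / 2 * (Θ - 2 * Real.pi * N) ^ 2 := rfl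
  linarith

theorem eventually_le_minimaxLevel (hL : 0 < L) (N : ℕ) (α : ℝ) (M : ℕ) {η : ℝ} (hη : 0 < η) :
    ∀ᶠ ε in 𝓝[>] (0 : ℝ), ∀ b, Separated α M b →
      limitTwistEnergy L N M α + 2 * √2 / 3 - η
        ≤ minimaxLevel (modelEnergy L N α ε) (ofCurve (twistState_mem α M)) b := by
  filter_upwards [eventually_le_max_energy hL N α M hη] with ε h b hb
  exact le_minimaxLevel (continuous_modelEnergy L N α ε) (h b hb)

end Cholesteric

end

noncomputable section

/-! ### The hyperbolic tangent. -/

section Tanh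

theorem Real.hasDerivAt_tanh_one_sub_sq (x : ℝ) : HasDerivAt Real.tanh (1 - Real.tanh x ^ 2) x := by
  have hc : Real.cosh x ≠ 0 := (Real.cosh_pos x).ne'
  have h := (Real.hasDerivAt_sinh x).div (Real.hasDerivAt_cosh x) hc
  have hfun : Real.tanh = Real.sinh / Real.cosh := by
    funext y
    exact Real.tanh_eq_sinh_div_cosh y
  rw [hfun]
  refine h.congr_deriv ?_
  simp only [Pi.div_apply]
  field_simp

theorem Real.monotone_tanh : Monotone Real.tanh := by
  refine monotone_of_deriv_nonneg (fun x => (hasDerivAt_tanh_one_sub_sq x).differentiableAt)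
    fun x => ?_
  rw [(hasDerivAt_tanh_one_sub_sq x).deriv]
  linarith [Real.tanh_sq_lt_one x]

theorem Real.continuous_tanh_real : Continuous Real.tanh :=
  continuous_iff_continuousAt.2 fun x => (Real.hasDerivAt_tanh_one_sub_sq x).continuousAt

theorem Real.tanh_pos_of_pos {x : ℝ} (hx : 0 < x) : 0 < Real.tanh x := by
  rw [Real.tanh_eq_sinh_div_cosh]
  exact div_pos (Real.sinh_pos_iff.2 hx) (Real.cosh_pos x)

theorem Real.one_sub_exp_neg_le_tanh (x : ℝ) : 1 - Real.exp (-x) ≤ Real.tanh x := by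
  have h : 1 - Real.tanh x = Real.exp (-x) / Real.cosh x := by
    rw [Real.tanh_eq_sinh_div_cosh, ← Real.cosh_sub_sinh]
    have := (Real.cosh_pos x).ne'
    field_simp
  have : Real.exp (-x) / Real.cosh x ≤ Real.exp (-x) :=
    div_le_self (Real.exp_pos _).le (Real.one_le_cosh x)
  linarith

theorem Real.tendsto_tanh_atTop_one : Tendsto Real.tanh atTop (𝓝 1) := by
  have h : Tendsto (fun x : ℝ => 1 - Real.exp (-x)) atTop (𝓝 1) := by
    simpa using Real.tendsto_exp_neg_atTop_nhds_zero.const_sub 1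
  exact tendsto_of_tendsto_of_tendsto_of_le_of_le h tendsto_const_nhds
    Real.one_sub_exp_neg_le_tanh fun x => (Real.tanh_lt_one x).le

end Tanh

/-! ### The explicit wall states and their energy. -/

namespace Cholesteric

variable {L : ℝ} {N : ℕ} {α ε c s k : ℝ}

/-- The normalized transition profile centred at `1/2`. -/
def kink (c x : ℝ) : ℝ := Real.tanh (c * (x - 1 / 2)) / Real.tanh (c / 2)

/-- The derivative of `kink`. -/
def kinkDeriv (c x : ℝ) : ℝ := c * (1 - Real.tanh (c * (x - 1 / 2)) ^ 2) / Real.tanh (c / 2)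

theorem hasDerivAt_tanh_layer (c x : ℝ) : HasDerivAt (fun x => Real.tanh (c * (x - 1 / 2)))
    (c * (1 - Real.tanh (c * (x - 1 / 2)) ^ 2)) x := by
  have h1 : HasDerivAt (fun x : ℝ => c * (x - 1 / 2)) c x := by
    simpa only [mul_one] using ((hasDerivAt_id' x).sub_const (1 / 2)).const_mul c
  have := (Real.hasDerivAt_tanh_one_sub_sq (c * (x - 1 / 2))).comp x h1
  rwa [mul_comm] at this

theorem hasDerivAt_kink (c x : ℝ) : HasDerivAt (kink c) (kinkDeriv c x) x :=
  (hasDerivAt_tanh_layer c x).div_const _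

theorem continuous_kinkDeriv (c : ℝ) : Continuous (kinkDeriv c) := by
  have := Real.continuous_tanh_real
  unfold kinkDeriv
  fun_prop

theorem continuous_kink (c : ℝ) : Continuous (kink c) :=
  continuous_iff_continuousAt.2 fun x => (hasDerivAt_kink c x).continuousAt

theorem kink_half (c : ℝ) : kink c (1 / 2) = 0 := by simp [kink]

theorem kink_one (hc : 0 < c) : kink c 1 = 1 := by
  have : c * (1 - 1 / 2) = c / 2 := by ring
  rw [kink, this, div_self (Real.tanh_pos_of_pos (by positivity)).ne']

theorem kink_zero (hc : 0 < c) : kink c 0 = -1 := by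
  have : c * (0 - 1 / 2) = -(c / 2) := by ring
  rw [kink, this, Real.tanh_neg, neg_div, div_self (Real.tanh_pos_of_pos (by positivity)).ne']

theorem kink_monotone (hc : 0 < c) : Monotone (kink c) := fun x y hxy => by
  have := Real.tanh_pos_of_pos (half_pos hc)
  unfold kink
  gcongr
  exact Real.monotone_tanh (by gcongr)

/-- One half of a wall: amplitude `1 - s (1 - σ kink)` and phase `k x + θ`. -/
def branch (c s k σ θ x : ℝ) : ℂ :=
  ((1 - s * (1 - σ * kink c x) : ℝ) : ℂ) * Complex.exp (((k * x + θ : ℝ) : ℂ) * Complex.I)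

/-- The derivative of `branch`. -/
def branchDeriv (c s k σ θ x : ℝ) : ℂ :=
  (((s * σ * kinkDeriv c x : ℝ) : ℂ) + ((k * (1 - s * (1 - σ * kink c x)) : ℝ) : ℂ) * Complex.I)
    * Complex.exp (((k * x + θ : ℝ) : ℂ) * Complex.I)

theorem hasDerivAt_branch (c s k σ θ x : ℝ) :
    HasDerivAt (branch c s k σ θ) (branchDeriv c s k σ θ x) x := by
  have h1 : HasDerivAt (fun x => 1 - s * (1 - σ * kink c x)) (s * σ * kinkDeriv c x) x := by
    have := ((((hasDerivAt_kink c x).const_mul σ).const_sub 1).const_mul s).const_sub 1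
    refine this.congr_deriv ?_
    ring
  refine (h1.ofReal_comp.mul (hasDerivAt_exp_mul_I k θ x)).congr_deriv ?_
  rw [branchDeriv]
  push_cast
  ring

theorem continuous_branch (c s k σ θ : ℝ) : Continuous (branch c s k σ θ) :=
  continuous_iff_continuousAt.2 fun x => (hasDerivAt_branch c s k σ θ x).continuousAt

theorem continuous_branchDeriv (c s k σ θ : ℝ) : Continuous (branchDeriv c s k σ θ) := by
  have := continuous_kink c
  have := continuous_kinkDeriv c
  unfold branchDeriv
  fun_prop

theorem norm_sq_branch (c s k σ θ x : ℝ) :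
    ‖branch c s k σ θ x‖ ^ 2 = (1 - s * (1 - σ * kink c x)) ^ 2 := by
  rw [branch, norm_mul, Complex.norm_exp_ofReal_mul_I, mul_one, Complex.norm_real, Real.norm_eq_abs,
    sq_abs]

theorem norm_sq_branchDeriv (c s k σ θ x : ℝ) : ‖branchDeriv c s k σ θ x‖ ^ 2
    = (s * σ * kinkDeriv c x) ^ 2 + (k * (1 - s * (1 - σ * kink c x))) ^ 2 := by
  rw [branchDeriv, norm_mul, Complex.norm_exp_ofReal_mul_I, mul_one, Complex.sq_norm,
    Complex.normSq_add_mul_I]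

theorem cross_branch (c s k σ θ x : ℝ) :
    (branch c s k σ θ x).re * (branchDeriv c s k σ θ x).im
      - (branch c s k σ θ x).im * (branchDeriv c s k σ θ x).re
      = k * (1 - s * (1 - σ * kink c x)) ^ 2 := by
  have h := Real.sin_sq_add_cos_sq (k * x + θ)
  simp only [branch, branchDeriv, Complex.mul_re, Complex.mul_im, Complex.add_re, Complex.add_im,
    Complex.ofReal_re, Complex.ofReal_im, Complex.exp_ofReal_mul_I_re, Complex.exp_ofReal_mul_I_im,
    Complex.I_re, Complex.I_im]
  linear_combination (k * (1 - s * (1 - σ * kink c x)) ^ 2) * h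

/-- The twist state with a wall of relative depth `s` and twist rate `k`. -/
def wallState (α c s k x : ℝ) : ℂ :=
  if x ≤ 1 / 2 then branch c s k (-1) 0 x else branch c s k 1 (α - k) x

/-- The derivative of `wallState`. -/
def wallStateDeriv (α c s k x : ℝ) : ℂ :=
  if x ≤ 1 / 2 then branchDeriv c s k (-1) 0 x else branchDeriv c s k 1 (α - k) x

/-- The condition under which `wallState` is continuous. -/
def Matched (α s k : ℝ) : Prop :=
  s = 1 ∨ Complex.exp (((α - k : ℝ) : ℂ) * Complex.I) = 1

/-- At `1/2` the amplitude is `1 - s`: either it vanishes and the phases are irrelevant, or the two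
phases agree modulo `2π`. -/
theorem continuous_wallState (h : Matched α s k) : Continuous (wallState α c s k) := by
  refine Continuous.if_le (continuous_branch ..) (continuous_branch ..) continuous_id
    continuous_const fun x hx => ?_
  replace hx : x = 1 / 2 := hx
  rw [hx, branch, branch, kink_half]
  rcases h with rfl | h
  · simp
  · have : ((k * (1 / 2) + (α - k) : ℝ) : ℂ) * Complex.I
        = ((k * (1 / 2) + 0 : ℝ) : ℂ) * Complex.I + ((α - k : ℝ) : ℂ) * Complex.I := by
      push_cast; ring
    rw [this, Complex.exp_add, h]
    simp

theorem hasDerivAt_wallState {x : ℝ} (hx : x ≠ 1 / 2) :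
    HasDerivAt (wallState α c s k) (wallStateDeriv α c s k x) x := by
  rcases hx.lt_or_gt with h | h
  · rw [wallStateDeriv, if_pos h.le]
    refine (hasDerivAt_branch c s k (-1) 0 x).congr_of_eventuallyEq ?_
    filter_upwards [Iio_mem_nhds h] with y hy
    rw [wallState, if_pos (le_of_lt hy)]
  · rw [wallStateDeriv, if_neg h.not_ge]
    refine (hasDerivAt_branch c s k 1 (α - k) x).congr_of_eventuallyEq ?_
    filter_upwards [Ioi_mem_nhds h] with y hy
    rw [wallState, if_neg (not_le_of_gt hy)]

theorem ae_ne_half : ∀ᵐ x ∂unitMeasure, x ≠ 1 / 2 :=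
  ae_restrict_of_ae (by simp [ae_iff, measure_singleton])

theorem deriv_wallState : deriv (wallState α c s k) =ᵐ[unitMeasure] wallStateDeriv α c s k := by
  filter_upwards [ae_ne_half] with x hx using (hasDerivAt_wallState hx).deriv

theorem memLp_wallStateDeriv (α c s k : ℝ) : MemLp (wallStateDeriv α c s k) 2 unitMeasure := by
  obtain ⟨C, hC⟩ := isCompact_Icc.exists_bound_of_continuousOn (s := Icc (0 : ℝ) 1)
    (continuous_branchDeriv c s k (-1) 0).continuousOn
  obtain ⟨C', hC'⟩ := isCompact_Icc.exists_bound_of_continuousOn (s := Icc (0 : ℝ) 1)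
    (continuous_branchDeriv c s k 1 (α - k)).continuousOn
  have hm : Measurable (wallStateDeriv α c s k) :=
    Measurable.ite measurableSet_Iic (continuous_branchDeriv ..).measurable
      (continuous_branchDeriv ..).measurable
  refine MemLp.of_bound hm.aestronglyMeasurable (max C C') ?_
  filter_upwards [ae_mem_unit] with x hx
  unfold wallStateDeriv
  split_ifs
  · exact (hC x hx).trans (le_max_left _ _)
  · exact (hC' x hx).trans (le_max_right _ _)

theorem wallState_zero (hc : 0 < c) : wallState α c s k 0 = 1 := by
  rw [wallState, if_pos (by norm_num), branch, kink_zero hc]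
  simp

theorem wallState_one (hc : 0 < c) : wallState α c s k 1 = Complex.exp (α * Complex.I) := by
  rw [wallState, if_neg (by norm_num), branch, kink_one hc]
  simp

theorem wallState_mem (hc : 0 < c) (h : Matched α s k) : wallState α c s k ∈ admissible α := by
  have hmem := memLp_wallStateDeriv α c s k
  have heq : EqOn (curve (wallStateDeriv α c s k)) (wallState α c s k) (Icc 0 1) := fun x hx => by
    have hi : IntervalIntegrable (wallStateDeriv α c s k) volume 0 x :=
      (intervalIntegrable_of_memLp hmem).mono_set (by
        rw [uIcc_of_le zero_le_one]
        exact uIcc_subset_Icc zero_mem_unit hx)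
    have := integral_eq_of_hasDerivAt_off_countable_of_le (wallState α c s k)
      (wallStateDeriv α c s k) hx.1 (countable_singleton (1 / 2 : ℝ))
      (continuous_wallState h).continuousOn (fun y hy => hasDerivAt_wallState hy.2) hi
    rw [curve, this, wallState_zero hc]
    ring
  refine ⟨⟨?_, ?_⟩, wallState_zero hc, wallState_one hc⟩
  · exact (memH1_curve hmem).absolutelyContinuous.congr (by rwa [uIcc_of_le zero_le_one])
  · rw [restrict_Ioo_eq_unitMeasure]
    exact (memLp_congr_ae deriv_wallState).2 hmem

theorem wallState_half : wallState α c 1 k (1 / 2) = 0 := by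
  rw [wallState, if_pos le_rfl, branch, kink_half]
  simp

theorem wallState_eq_twistState (M : ℕ) :
    wallState α c 0 (2 * Real.pi * M + α) = twistState α M := by
  funext x
  unfold wallState
  split_ifs
  · simp [branch, twistState]
  · have h : (((2 * Real.pi * M + α) * x + (α - (2 * Real.pi * M + α)) : ℝ) : ℂ) * Complex.I
        = (((2 * Real.pi * M + α) * x : ℝ) : ℂ) * Complex.I - M * (2 * Real.pi * Complex.I) := by
      push_cast; ring
    rw [branch, h, Complex.exp_sub, Complex.exp_nat_mul_two_pi_mul_I, twistState]
    simp

theorem matched_twist (α s : ℝ) (M : ℕ) : Matched α s (2 * Real.pi * M + α) := by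
  right
  have h : ((α - (2 * Real.pi * M + α) : ℝ) : ℂ) * Complex.I
      = -(M * (2 * Real.pi * Complex.I)) := by
    push_cast; ring
  rw [h, Complex.exp_neg, Complex.exp_nat_mul_two_pi_mul_I, inv_one]

/-- Deepening the wall at a fixed rate is thus a straight segment, which makes continuity of that
part of the path immediate. -/
theorem wallState_affine (x : ℝ) : wallState α c s k x
    = wallState α c 0 k x + (s : ℂ) * (wallState α c 1 k x - wallState α c 0 k x) := by
  unfold wallState
  split_ifs <;> simp only [branch] <;> push_cast <;> ring

/-- The energy density of a wall, in terms of the amplitude `1 - s (1 - τ)` and of the square `q`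
of the hyperbolic tangent. -/
theorem wall_density_le (hL : 0 < L) (hε : 0 < ε) {T τ d q n : ℝ} (hT : 0 < T) (hT1 : T ≤ 1)
    (hs : s ∈ Icc (0 : ℝ) 1) (hτ : τ ∈ Icc (0 : ℝ) 1) (hτq : q ≤ τ ^ 2) (hd : 2 * ε ^ 2 * d ^ 2 = (1 - q) ^ 2 / T ^ 2) :
    ε / 2 * ((s * d) ^ 2 + (k * (1 - s * (1 - τ))) ^ 2)
        + 1 / (4 * ε) * ((1 - s * (1 - τ)) ^ 2 - 1) ^ 2
        + L / 2 * (k * (1 - s * (1 - τ)) ^ 2 - n) ^ 2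
      ≤ 1 / (2 * ε * T ^ 2) * (1 - q) ^ 2 + L / 2 * (2 * |k| * |k - n| + k ^ 2) * (1 - q)
        + (ε / 2 * k ^ 2 + L / 2 * (k - n) ^ 2) := by
  obtain ⟨hs0, hs1⟩ := hs
  obtain ⟨hτ0, hτ1⟩ := hτ
  set r := 1 - s * (1 - τ) with hr
  have hrτ : τ ≤ r := by rw [hr]; nlinarith
  have hr1 : r ≤ 1 := by rw [hr]; nlinarith
  have hr0 : 0 ≤ r := hτ0.trans hrτ
  have hr2 : τ ^ 2 ≤ r ^ 2 := by gcongr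
  have hr21 : r ^ 2 ≤ 1 := pow_le_one₀ hr0 hr1
  set w := 1 - r ^ 2 with hw
  have hw0 : 0 ≤ w := by linarith
  have hwq : w ≤ 1 - q := by linarith
  have hw1 : w ≤ 1 := by rw [hw]; nlinarith [sq_nonneg r]
  have hT2 : T ^ 2 ≤ 1 := pow_le_one₀ hT.le hT1
  have t1 : ε / 2 * (s * d) ^ 2 ≤ 1 / (4 * ε * T ^ 2) * (1 - q) ^ 2 := by
    have h1 : (s * d) ^ 2 ≤ d ^ 2 := by
      rw [mul_pow]
      exact mul_le_of_le_one_left (sq_nonneg d) (pow_le_one₀ hs0 hs1)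
    have h2 : ε / 2 * d ^ 2 = 1 / (4 * ε * T ^ 2) * (1 - q) ^ 2 := by
      have : ε / 2 * d ^ 2 = 1 / (4 * ε) * (2 * ε ^ 2 * d ^ 2) := by field_simp; ring
      rw [this, hd]
      field_simp
    rw [← h2]
    gcongr
  have t2 : ε / 2 * (k * r) ^ 2 ≤ ε / 2 * k ^ 2 := by
    rw [mul_pow]
    gcongr
    exact mul_le_of_le_one_right (sq_nonneg k) hr21
  have t3 : 1 / (4 * ε) * (r ^ 2 - 1) ^ 2 ≤ 1 / (4 * ε * T ^ 2) * (1 - q) ^ 2 := by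
    have h1 : (r ^ 2 - 1) ^ 2 ≤ (1 - q) ^ 2 := by
      have : (r ^ 2 - 1) ^ 2 = w ^ 2 := by rw [hw]; ring
      rw [this]
      gcongr
    have h2 : 1 / (4 * ε) ≤ 1 / (4 * ε * T ^ 2) := by
      apply one_div_le_one_div_of_le (by positivity)
      exact mul_le_of_le_one_right (by positivity) hT2
    gcongr
  have t4 : (k * r ^ 2 - n) ^ 2 ≤ (k - n) ^ 2 + (2 * |k| * |k - n| + k ^ 2) * (1 - q) := by
    have h1 : (k * r ^ 2 - n) ^ 2 = (k - n) ^ 2 - 2 * (k * (k - n)) * w + k ^ 2 * w ^ 2 := by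
      rw [hw]; ring
    have h2 : -(k * (k - n)) ≤ |k| * |k - n| := by
      rw [← abs_mul]; exact neg_le_abs _
    have h3 : k ^ 2 * w ^ 2 ≤ k ^ 2 * w := by
      gcongr
      nlinarith
    have h4 : -(k * (k - n)) * w ≤ |k| * |k - n| * w := by gcongr
    have h5 : (2 * |k| * |k - n| + k ^ 2) * w ≤ (2 * |k| * |k - n| + k ^ 2) * (1 - q) := by gcongr
    linarith
  have t5 : L / 2 * (k * r ^ 2 - n) ^ 2
      ≤ L / 2 * ((k - n) ^ 2 + (2 * |k| * |k - n| + k ^ 2) * (1 - q)) := by gcongr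
  have e : 1 / (2 * ε * T ^ 2) * (1 - q) ^ 2 = 1 / (4 * ε * T ^ 2) * (1 - q) ^ 2
      + 1 / (4 * ε * T ^ 2) * (1 - q) ^ 2 := by field_simp; ring
  rw [e]
  linarith

theorem integral_one_sub_tanh_sq (hc : 0 < c) :
    ∫ x, (1 - Real.tanh (c * (x - 1 / 2)) ^ 2) ∂unitMeasure = 2 * Real.tanh (c / 2) / c := by
  have hd : ∀ x ∈ uIcc (0 : ℝ) 1, HasDerivAt (fun x => Real.tanh (c * (x - 1 / 2)) / c)
      (1 - Real.tanh (c * (x - 1 / 2)) ^ 2) x := fun x _ => by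
    refine ((hasDerivAt_tanh_layer c x).div_const c).congr_deriv ?_
    field_simp
  have := Real.continuous_tanh_real
  have hcont : Continuous fun x => 1 - Real.tanh (c * (x - 1 / 2)) ^ 2 := by fun_prop
  rw [← intervalIntegral_eq_unitMeasure,
    intervalIntegral.integral_eq_sub_of_hasDerivAt hd (hcont.intervalIntegrable _ _)]
  have e1 : c * (1 - 1 / 2) = c / 2 := by ring
  have e2 : c * (0 - 1 / 2) = -(c / 2) := by ring
  rw [e1, e2, Real.tanh_neg]
  ring

theorem integral_one_sub_tanh_sq_sq (hc : 0 < c) :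
    ∫ x, (1 - Real.tanh (c * (x - 1 / 2)) ^ 2) ^ 2 ∂unitMeasure
      = 2 * layerCost (Real.tanh (c / 2)) / c := by
  have hd : ∀ x ∈ uIcc (0 : ℝ) 1, HasDerivAt (fun x => layerCost (Real.tanh (c * (x - 1 / 2))) / c)
      ((1 - Real.tanh (c * (x - 1 / 2)) ^ 2) ^ 2) x := fun x _ => by
    have h := (HasDerivAt.comp (h₂ := layerCost) x (hasDerivAt_layerCost _)
      (hasDerivAt_tanh_layer c x)).div_const c
    refine h.congr_deriv ?_
    field_simp
  have := Real.continuous_tanh_real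
  have hcont : Continuous fun x => (1 - Real.tanh (c * (x - 1 / 2)) ^ 2) ^ 2 := by fun_prop
  rw [← intervalIntegral_eq_unitMeasure,
    intervalIntegral.integral_eq_sub_of_hasDerivAt hd (hcont.intervalIntegrable _ _)]
  have e1 : c * (1 - 1 / 2) = c / 2 := by ring
  have e2 : c * (0 - 1 / 2) = -(c / 2) := by ring
  rw [e1, e2, Real.tanh_neg]
  simp only [layerCost]
  ring

theorem layerCost_le {t : ℝ} (ht0 : 0 ≤ t) : layerCost t ≤ 2 / 3 := by
  unfold layerCost
  have : (1 - t) ^ 2 * (2 + t) ≥ 0 := by positivity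
  nlinarith

/-- The choice `c = 1/(√2 ε)` gives the gradient and the potential the same bound, a multiple of `(1
- tanh²)²`, whose integral is explicit. The twist deviates from rate `k` only through `1 - tanh²`,
whose integral is of order `ε`. -/
theorem energy_wallState_le (hL : 0 < L) (hε : 0 < ε) (hs : s ∈ Icc (0 : ℝ) 1)
    (hc : 0 < c) (hcε : 2 * ε ^ 2 * c ^ 2 = 1) (h : Matched α s k) :
    energy L N ε (wallState α c s k)
      ≤ 2 * √2 / 3 / Real.tanh (c / 2) ^ 2
        + L * (2 * |k| * |k - 2 * Real.pi * N| + k ^ 2) * (√2 * ε)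
        + (ε / 2 * k ^ 2 + L / 2 * (k - 2 * Real.pi * N) ^ 2) := by
  set T := Real.tanh (c / 2) with hT
  set n : ℝ := 2 * Real.pi * N with hn
  have hTpos : 0 < T := Real.tanh_pos_of_pos (by positivity)
  have hT1 : T ≤ 1 := (Real.tanh_lt_one _).le
  set A := 1 / (2 * ε * T ^ 2) with hA
  set B := L / 2 * (2 * |k| * |k - n| + k ^ 2) with hB
  set D := ε / 2 * k ^ 2 + L / 2 * (k - n) ^ 2 with hD
  have hmem := (wallState_mem hc h).1
  have htc := Real.continuous_tanh_real
  have i1 : Integrable (fun x => A * (1 - Real.tanh (c * (x - 1 / 2)) ^ 2) ^ 2) unitMeasure :=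
    integrable_of_continuousOn (by fun_prop)
  have i2 : Integrable (fun x => B * (1 - Real.tanh (c * (x - 1 / 2)) ^ 2)) unitMeasure :=
    integrable_of_continuousOn (by fun_prop)
  have i12 : Integrable (fun x => A * (1 - Real.tanh (c * (x - 1 / 2)) ^ 2) ^ 2
    + B * (1 - Real.tanh (c * (x - 1 / 2)) ^ 2)) unitMeasure := i1.add i2
  have hpt : ∀ σ θ x : ℝ, (σ = 1 ∨ σ = -1) → σ * kink c x ∈ Icc (0 : ℝ) 1 →
      ε / 2 * ‖branchDeriv c s k σ θ x‖ ^ 2 + 1 / (4 * ε) * (‖branch c s k σ θ x‖ ^ 2 - 1) ^ 2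
        + L / 2 * ((branch c s k σ θ x).re * (branchDeriv c s k σ θ x).im
          - (branch c s k σ θ x).im * (branchDeriv c s k σ θ x).re - n) ^ 2
      ≤ A * (1 - Real.tanh (c * (x - 1 / 2)) ^ 2) ^ 2
        + B * (1 - Real.tanh (c * (x - 1 / 2)) ^ 2) + D := by
    intro σ θ x hσ hτ
    have hσ2 : σ ^ 2 = 1 := by rcases hσ with rfl | rfl <;> norm_num
    rw [cross_branch, norm_sq_branch, norm_sq_branchDeriv]
    have hT2 : T ^ 2 ≤ 1 := pow_le_one₀ hTpos.le hT1
    have := wall_density_le (k := k) (n := n) (d := σ * kinkDeriv c x) hL hε hTpos hT1 hs hτ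
      (q := Real.tanh (c * (x - 1 / 2)) ^ 2) ?_ ?_
    · rw [mul_assoc s σ]
      exact this
    · rw [mul_pow, hσ2, one_mul, kink, div_pow]
      exact le_div_self (sq_nonneg _) (by positivity) hT2
    · rw [mul_pow, hσ2, one_mul, kinkDeriv, ← hT]
      generalize Real.tanh (c * (x - 1 / 2)) = w
      field_simp
      linear_combination (1 - w ^ 2) ^ 2 * hcε
  have hmono := kink_monotone hc
  have hE : energy L N ε (wallState α c s k)
      ≤ ∫ x, (A * (1 - Real.tanh (c * (x - 1 / 2)) ^ 2) ^ 2
        + B * (1 - Real.tanh (c * (x - 1 / 2)) ^ 2) + D) ∂unitMeasure := by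
    rw [energy, intervalIntegral_eq_unitMeasure]
    refine integral_mono_ae ((hmem.integrable_wallDensity ε).add
      ((hmem.integrable_twist_sub_sq n).const_mul _)) (i12.add (integrable_const _)) ?_
    filter_upwards [ae_mem_unit, deriv_wallState (α := α) (c := c) (s := s) (k := k)] with x hx hdx
    simp only [twist, hdx]
    unfold wallState wallStateDeriv
    split_ifs with hx2
    · refine hpt (-1) 0 x (Or.inr rfl) ⟨?_, ?_⟩
      · have := hmono hx2
        rw [kink_half] at this
        linarith
      · have := hmono hx.1
        rw [kink_zero hc] at this
        linarith
    · refine hpt 1 (α - k) x (Or.inl rfl) ⟨?_, ?_⟩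
      · have := hmono (le_of_not_ge hx2)
        rw [kink_half] at this
        linarith
      · have := hmono hx.2
        rw [kink_one hc] at this
        linarith
  refine hE.trans ?_
  rw [integral_add i12 (integrable_const _), integral_add i1 i2, integral_const_mul,
    integral_const_mul, integral_one_sub_tanh_sq hc, integral_one_sub_tanh_sq_sq hc]
  have hcinv : 1 / c = √2 * ε := by
    have h1 : √2 ^ 2 = 2 := Real.sq_sqrt zero_le_two
    have h2 : (√2 * ε * c) ^ 2 = 1 := by rw [mul_pow, mul_pow, h1, hcε]
    have h3 : √2 * ε * c = 1 :=
      (pow_eq_one_iff_of_nonneg (by positivity) two_ne_zero).1 h2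
    rw [div_eq_iff hc.ne', h3]
  have hB0 : 0 ≤ B := by positivity
  have u1 : A * (2 * layerCost T / c) ≤ 2 * √2 / 3 / T ^ 2 := by
    have e : A * (2 * layerCost T / c) = layerCost T * (√2 / T ^ 2) := by
      rw [hA, mul_div_assoc, div_eq_mul_one_div (layerCost T), hcinv]
      field_simp
    rw [e]
    calc layerCost T * (√2 / T ^ 2) ≤ 2 / 3 * (√2 / T ^ 2) := by
          gcongr
          exact layerCost_le hTpos.le
      _ = _ := by ring
  have u2 : B * (2 * T / c) ≤ L * (2 * |k| * |k - n| + k ^ 2) * (√2 * ε) := by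
    have e : B * (2 * T / c) = B * (2 * (√2 * ε)) * T := by
      rw [mul_div_assoc, div_eq_mul_one_div T, hcinv]; ring
    rw [e]
    calc B * (2 * (√2 * ε)) * T ≤ B * (2 * (√2 * ε)) * 1 := by gcongr
      _ = _ := by rw [hB]; ring
  have u3 : ∫ _, D ∂unitMeasure = D := by simp
  rw [u3]
  linarith

end Cholesteric

end

noncomputable section

/-! ### Low-energy paths, limits of the minimax levels, and critical points. -/

namespace Cholesteric

open scoped BoundedContinuousFunction ENNReal RealInnerProductSpace

variable {L : ℝ} {N : ℕ} {α ε c s k : ℝ}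

theorem norm_ofCurve_sub_le {u v : ℝ → ℂ} (hu : u ∈ admissible α) (hv : v ∈ admissible α) {C : ℝ}
    (hC : 0 ≤ C) (h : ∀ᵐ x ∂unitMeasure, ‖deriv u x - deriv v x‖ ≤ C) :
    ‖ofCurve hu - ofCurve hv‖ ≤ C := by
  have h1 : ‖ofCurve hu - ofCurve hv‖ = ‖hu.1.memLp.toLp _ - hv.1.memLp.toLp _‖ := by
    change ‖(hu.1.memLp.toLp _ - refDeriv α) - (hv.1.memLp.toLp _ - refDeriv α)‖ = _
    rw [sub_sub_sub_cancel_right]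
  rw [h1]
  refine (Lp.norm_le_of_ae_bound hC ?_).trans_eq (b := _) ?_
  · filter_upwards [Lp.coeFn_sub (hu.1.memLp.toLp _) (hv.1.memLp.toLp _), hu.1.memLp.coeFn_toLp,
      hv.1.memLp.coeFn_toLp, h] with x e1 e2 e3 e4
    rwa [e1, Pi.sub_apply, e2, e3]
  · simp [measureUnivNNReal]

theorem norm_exp_mul_I_sub_le (a b : ℝ) :
    ‖Complex.exp ((a : ℂ) * Complex.I) - Complex.exp ((b : ℂ) * Complex.I)‖ ≤ |a - b| := by
  have h : Complex.exp ((a : ℂ) * Complex.I) - Complex.exp ((b : ℂ) * Complex.I)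
      = Complex.exp ((b : ℂ) * Complex.I) * (Complex.exp (Complex.I * ((a - b : ℝ) : ℂ)) - 1) := by
    rw [mul_sub, ← Complex.exp_add, mul_one]
    congr 2
    push_cast
    ring
  rw [h, norm_mul, Complex.norm_exp_ofReal_mul_I, one_mul]
  exact Real.norm_exp_I_mul_ofReal_sub_one_le

theorem norm_branchDeriv_sub_le {σ k' θ θ' x C D : ℝ} (hD : |σ * kinkDeriv c x| ≤ D)
    (hC : |σ * kink c x| ≤ C) (hphase : |(k * x + θ) - (k' * x + θ')| ≤ |k - k'|) :
    ‖branchDeriv c 1 k σ θ x - branchDeriv c 1 k' σ θ' x‖ ≤ (C + D + |k'| * C) * |k - k'| := by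
  set w := Complex.exp (((k * x + θ : ℝ) : ℂ) * Complex.I) with hw
  set w' := Complex.exp (((k' * x + θ' : ℝ) : ℂ) * Complex.I) with hw'
  have hww : ‖w - w'‖ ≤ |k - k'| := (norm_exp_mul_I_sub_le _ _).trans hphase
  have hw1 : ‖w‖ = 1 := Complex.norm_exp_ofReal_mul_I _
  have e : branchDeriv c 1 k σ θ x - branchDeriv c 1 k' σ θ' x
      = (((k - k') * (σ * kink c x) : ℝ) : ℂ) * Complex.I * w
        + (((σ * kinkDeriv c x : ℝ) : ℂ) + ((k' * (σ * kink c x) : ℝ) : ℂ) * Complex.I)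
          * (w - w') := by
    rw [branchDeriv, branchDeriv, ← hw, ← hw']
    push_cast
    ring
  have hC0 : 0 ≤ C := (abs_nonneg _).trans hC
  have n1 : ‖(((k - k') * (σ * kink c x) : ℝ) : ℂ) * Complex.I * w‖ ≤ |k - k'| * C := by
    rw [norm_mul, norm_mul, hw1, Complex.norm_I, mul_one, mul_one, Complex.norm_real,
      Real.norm_eq_abs, abs_mul]
    gcongr
  have n2 : ‖((σ * kinkDeriv c x : ℝ) : ℂ) + ((k' * (σ * kink c x) : ℝ) : ℂ) * Complex.I‖
      ≤ D + |k'| * C := by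
    refine (norm_add_le _ _).trans ?_
    rw [norm_mul, Complex.norm_I, mul_one, Complex.norm_real, Complex.norm_real, Real.norm_eq_abs,
      Real.norm_eq_abs, abs_mul k']
    gcongr
  rw [e]
  refine (norm_add_le _ _).trans ?_
  rw [norm_mul _ (w - w')]
  calc _ ≤ |k - k'| * C + (D + |k'| * C) * |k - k'| := by
        gcongr
        exact (norm_nonneg _).trans n2
    _ = _ := by ring

/-- A wall of full depth vanishes at `1/2`, so every real rate `k` is allowed; moving `k` changes
the winding without leaving the admissible class. -/
theorem continuous_ofCurve_wallState (hc : 0 < c) :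
    Continuous fun k => ofCurve (wallState_mem (α := α) (k := k) hc (Or.inl rfl)) := by
  obtain ⟨D, hD⟩ := isCompact_Icc.exists_bound_of_continuousOn (s := Icc (0 : ℝ) 1)
    (continuous_kinkDeriv c).continuousOn
  obtain ⟨C, hC⟩ := isCompact_Icc.exists_bound_of_continuousOn (s := Icc (0 : ℝ) 1)
    (continuous_kink c).continuousOn
  simp only [Real.norm_eq_abs] at hC hD
  have hC0 : 0 ≤ C := (abs_nonneg _).trans (hC 0 zero_mem_unit)
  have hD0 : 0 ≤ D := (abs_nonneg _).trans (hD 0 zero_mem_unit)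
  rw [continuous_iff_continuousAt]
  intro k'
  rw [ContinuousAt, tendsto_iff_norm_sub_tendsto_zero]
  have hlim : Tendsto (fun k => (C + D + |k'| * C) * |k - k'|) (𝓝 k') (𝓝 0) := by
    have : Continuous fun k => (C + D + |k'| * C) * |k - k'| := by fun_prop
    simpa using this.tendsto k'
  refine squeeze_zero (fun _ => norm_nonneg _) (fun k => ?_) hlim
  refine norm_ofCurve_sub_le _ _ (by positivity) ?_
  filter_upwards [ae_mem_unit, deriv_wallState (α := α) (c := c) (s := 1) (k := k),
    deriv_wallState (α := α) (c := c) (s := 1) (k := k')] with x hx e1 e2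
  rw [e1, e2]
  unfold wallStateDeriv
  split_ifs
  · refine norm_branchDeriv_sub_le (by simpa using hD x hx) (by simpa using hC x hx) ?_
    have : (k * x + 0) - (k' * x + 0) = (k - k') * x := by ring
    rw [this, abs_mul]
    exact mul_le_of_le_one_right (abs_nonneg _) (abs_le.2 ⟨by linarith [hx.1], hx.2⟩)
  · refine norm_branchDeriv_sub_le (by simpa using hD x hx) (by simpa using hC x hx) ?_
    have : (k * x + (α - k)) - (k' * x + (α - k')) = (k - k') * (x - 1) := by ring
    rw [this, abs_mul]
    exact mul_le_of_le_one_right (abs_nonneg _)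
      (abs_le.2 ⟨by linarith [hx.1], by linarith [hx.2]⟩)

theorem joinedIn_wallState {m k' : ℝ} (hc : 0 < c)
    (h : ∀ x ∈ uIcc k k', energy L N ε (wallState α c 1 x) ≤ m) :
    JoinedIn {f | modelEnergy L N α ε f ≤ m}
      (ofCurve (wallState_mem (α := α) (k := k) hc (Or.inl rfl)))
      (ofCurve (wallState_mem (α := α) (k := k') hc (Or.inl rfl))) := by
  have h1 : JoinedIn (uIcc k k') k k' :=
    ((convex_uIcc k k').isPathConnected nonempty_uIcc).joinedIn _ left_mem_uIcc _ right_mem_uIcc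
  refine (h1.map (continuous_ofCurve_wallState (α := α) hc)).mono ?_
  rintro _ ⟨x, hx, rfl⟩
  exact (modelEnergy_ofCurve _).trans_le (h x hx)

theorem toCurve_segment (f g : MeanZero) (s : ℝ) {x : ℝ} (hx : x ∈ Icc (0 : ℝ) 1) :
    toCurve α (f + s • (g - f)) x = toCurve α f x + (s : ℂ) * (toCurve α g x - toCurve α f x) := by
  have h := toCurve_sub (α := α) (f + s • (g - f)) f hx
  have h2 : primitiveL (s • (g - f : MeanZero) : L2C) ⟨x, hx⟩
      = s • primitiveL ((g - f : MeanZero) : L2C) ⟨x, hx⟩ := by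
    rw [map_smul, BoundedContinuousFunction.smul_apply]
  rw [add_sub_cancel_left] at h
  rw [toCurve_sub g f hx, ← sub_eq_iff_eq_add', h, ← Complex.real_smul]
  exact h2

theorem joinedIn_twistState_wallState {m : ℝ} {M : ℕ} (hc : 0 < c)
    (h : ∀ s ∈ Icc (0 : ℝ) 1, energy L N ε (wallState α c s (2 * Real.pi * M + α)) ≤ m) :
    JoinedIn {f | modelEnergy L N α ε f ≤ m} (ofCurve (twistState_mem α M))
      (ofCurve (wallState_mem (α := α) (k := 2 * Real.pi * M + α) hc (Or.inl rfl))) := by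
  set f := ofCurve (twistState_mem α M)
  set g := ofCurve (wallState_mem (α := α) (k := 2 * Real.pi * M + α) hc (Or.inl rfl))
  refine JoinedIn.ofLine (f := fun s : ℝ => f + s • (g - f)) (by fun_prop) (by simp) (by simp) ?_
  rintro _ ⟨s, hs, rfl⟩
  refine le_trans (le_of_eq ?_) (h s hs)
  rw [← energy_toCurve]
  refine energy_congr fun x hx => ?_
  rw [toCurve_segment _ _ _ hx, wallState_affine, wallState_eq_twistState, toCurve_ofCurve _ hx,
    toCurve_ofCurve _ hx]

theorem separated_wallState (hc : 0 < c) (M : ℕ) :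
    Separated α M (ofCurve (wallState_mem (α := α) (k := k) hc (Or.inl rfl))) :=
  Or.inl ⟨1 / 2, by norm_num, by rw [toCurve_ofCurve _ (by norm_num), wallState_half]⟩

theorem energy_twistState (M : ℕ) : energy L N ε (twistState α M)
    = ε / 2 * (2 * Real.pi * M + α) ^ 2 + limitTwistEnergy L N M α := by
  set k : ℝ := 2 * Real.pi * M + α with hk
  have hd : ∀ x, deriv (twistState α M) x
      = k * Complex.I * Complex.exp (((k * x : ℝ) : ℂ) * Complex.I) := fun x => by
    have := (hasDerivAt_exp_mul_I k 0 x).deriv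
    simp only [add_zero] at this
    exact this
  have h : ∀ x, ε / 2 * ‖deriv (twistState α M) x‖ ^ 2
      + 1 / (4 * ε) * (‖twistState α M x‖ ^ 2 - 1) ^ 2
      + L / 2 * (twist (twistState α M) x - 2 * Real.pi * N) ^ 2
      = ε / 2 * k ^ 2 + limitTwistEnergy L N M α := fun x => by
    have h1 : ‖deriv (twistState α M) x‖ ^ 2 = k ^ 2 := by
      rw [hd, norm_mul, Complex.norm_exp_ofReal_mul_I, norm_mul, Complex.norm_I, Complex.norm_real,
        mul_one, mul_one, Real.norm_eq_abs, sq_abs]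
    have h2 : twist (twistState α M) x = k := by
      have h := Real.sin_sq_add_cos_sq (k * x)
      rw [twist, hd]
      simp only [twistState, ← hk, Complex.mul_re, Complex.mul_im,
        Complex.exp_ofReal_mul_I_re, Complex.exp_ofReal_mul_I_im, Complex.ofReal_re,
        Complex.ofReal_im, Complex.I_re, Complex.I_im]
      linear_combination k * h
    rw [h1, h2, norm_twistState, limitTwistEnergy]
    ring
  simp only [energy, h]
  simp

/-- The decay rate of the transition profile of least energy. -/
def wallRate (ε : ℝ) : ℝ := 1 / (√2 * ε)

theorem wallRate_pos (hε : 0 < ε) : 0 < wallRate ε := by unfold wallRate; positivity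

theorem wallRate_sq (hε : 0 < ε) : 2 * ε ^ 2 * wallRate ε ^ 2 = 1 := by
  have h1 : √2 ^ 2 = 2 := Real.sq_sqrt zero_le_two
  rw [wallRate, div_pow, mul_pow, h1]
  field_simp

/-- The bound is uniform in the depth `s` and in bounded rates `k`, so one range of `ε` serves a
whole path. -/
theorem eventually_energy_wallState_le (hL : 0 < L) (N : ℕ) (α κ : ℝ) {η : ℝ} (hη : 0 < η) :
    ∀ᶠ ε in 𝓝[>] (0 : ℝ), ∀ s ∈ Icc (0 : ℝ) 1, ∀ k, |k| ≤ κ → Matched α s k →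
      energy L N ε (wallState α (wallRate ε) s k)
        ≤ L / 2 * (k - 2 * Real.pi * N) ^ 2 + 2 * √2 / 3 + η := by
  have hrate : Tendsto (fun ε => wallRate ε / 2) (𝓝[>] 0) atTop := by
    have : (fun ε => wallRate ε / 2) = fun ε => (2 * √2)⁻¹ * ε⁻¹ := by
      funext ε
      rw [wallRate]
      field_simp
    rw [this]
    exact tendsto_inv_nhdsGT_zero.const_mul_atTop (by positivity)
  have h1 : Tendsto (fun ε => 2 * √2 / 3 / Real.tanh (wallRate ε / 2) ^ 2) (𝓝[>] 0)
      (𝓝 (2 * √2 / 3 / 1 ^ 2)) :=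
    tendsto_const_nhds.div ((Real.tendsto_tanh_atTop_one.comp hrate).pow 2) (by norm_num)
  have h2 : Tendsto (fun ε => L * (2 * κ * (κ + 2 * Real.pi * N) + κ ^ 2) * (√2 * ε)
      + ε / 2 * κ ^ 2) (𝓝[>] 0) (𝓝 0) := by
    have : Continuous fun ε => L * (2 * κ * (κ + 2 * Real.pi * N) + κ ^ 2) * (√2 * ε)
      + ε / 2 * κ ^ 2 := by fun_prop
    simpa using (this.tendsto 0).mono_left nhdsWithin_le_nhds
  have h3 := h1.add h2
  have hlt : 2 * √2 / 3 / 1 ^ 2 + 0 < 2 * √2 / 3 + η := by simpa using hη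
  filter_upwards [h3.eventually (gt_mem_nhds hlt), self_mem_nhdsWithin] with ε hsmall hε s hs k hk hm
  refine (energy_wallState_le hL hε hs (wallRate_pos hε) (wallRate_sq hε) hm).trans ?_
  have hε' : (0 : ℝ) < ε := hε
  have b1 : |k - 2 * Real.pi * N| ≤ κ + 2 * Real.pi * N := by
    refine (abs_sub _ _).trans ?_
    rw [abs_of_nonneg (by positivity : 0 ≤ 2 * Real.pi * N)]
    gcongr
  have b2 : k ^ 2 ≤ κ ^ 2 := sq_le_sq.2 (hk.trans (le_abs_self κ))
  have b0 : 0 ≤ κ := (abs_nonneg k).trans hk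
  have b3 : L * (2 * |k| * |k - 2 * Real.pi * N| + k ^ 2) * (√2 * ε)
      ≤ L * (2 * κ * (κ + 2 * Real.pi * N) + κ ^ 2) * (√2 * ε) := by gcongr
  have b4 : ε / 2 * k ^ 2 ≤ ε / 2 * κ ^ 2 := by gcongr
  linarith

theorem sq_sub_le_max_of_mem_uIcc {a b n x : ℝ} (hx : x ∈ uIcc a b) :
    (x - n) ^ 2 ≤ max ((a - n) ^ 2) ((b - n) ^ 2) := by
  rw [mem_uIcc] at hx
  rcases le_total n x with h | h <;> rcases hx with hx | hx
  · exact le_max_of_le_right (by nlinarith)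
  · exact le_max_of_le_left (by nlinarith)
  · exact le_max_of_le_left (by nlinarith)
  · exact le_max_of_le_right (by nlinarith)

/-- The path deepens the wall at the rate `2πM + α` and then moves the rate to `k` at full depth; by
convexity the energy is governed by the two end rates. -/
theorem eventually_joinedIn (hL : 0 < L) (N : ℕ) (α : ℝ) (M : ℕ) (k : ℝ) {η : ℝ} (hη : 0 < η) :
    ∀ᶠ ε in 𝓝[>] (0 : ℝ), ∀ hc : 0 < wallRate ε, JoinedIn {f | modelEnergy L N α ε f
        ≤ max (limitTwistEnergy L N M α) (L / 2 * (k - 2 * Real.pi * N) ^ 2) + 2 * √2 / 3 + η}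
      (ofCurve (twistState_mem α M))
      (ofCurve (wallState_mem (α := α) (k := k) hc (Or.inl rfl))) := by
  filter_upwards [eventually_energy_wallState_le hL N α (max |2 * Real.pi * M + α| |k|) hη]
    with ε h hc
  refine (joinedIn_twistState_wallState hc fun s hs => ?_).trans
    (joinedIn_wallState hc fun x hx => ?_)
  · refine (h s hs _ (le_max_left _ _) (matched_twist α s M)).trans ?_
    gcongr
    exact le_max_left _ _
  · have hx' : |x| ≤ max |2 * Real.pi * M + α| |k| := by
      have := sq_sub_le_max_of_mem_uIcc (n := 0) hx
      simp only [sub_zero] at this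
      rcases le_max_iff.1 this with h | h
      · exact (sq_le_sq.1 h).trans (le_max_left _ _)
      · exact (sq_le_sq.1 h).trans (le_max_right _ _)
    refine (h 1 (by norm_num) x hx' (Or.inl rfl)).trans ?_
    gcongr
    rw [limitTwistEnergy, ← mul_max_of_nonneg _ _ (by positivity)]
    gcongr
    exact sq_sub_le_max_of_mem_uIcc hx

theorem limitTwistEnergy_eq (L : ℝ) (N M : ℕ) (α : ℝ) : limitTwistEnergy L N M α
    = 2 * Real.pi ^ 2 * L * ((N : ℝ) - M - α / (2 * Real.pi)) ^ 2 := by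
  rw [limitTwistEnergy]
  have := Real.pi_ne_zero
  field_simp
  ring

theorem tendsto_energy_twistState (L : ℝ) (N : ℕ) (α : ℝ) (M : ℕ) :
    Tendsto (fun ε => modelEnergy L N α ε (ofCurve (twistState_mem α M))) (𝓝[>] 0)
      (𝓝 (limitTwistEnergy L N M α)) := by
  have : Continuous fun ε : ℝ =>
      ε / 2 * (2 * Real.pi * M + α) ^ 2 + limitTwistEnergy L N M α := by fun_prop
  simp only [modelEnergy_ofCurve, energy_twistState]
  simpa using (this.tendsto 0).mono_left nhdsWithin_le_nhds

theorem tendsto_of_eventually_le_add {l : Filter ℝ} {f : ℝ → ℝ} {a : ℝ}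
    (h1 : ∀ η > 0, ∀ᶠ x in l, a - η ≤ f x) (h2 : ∀ η > 0, ∀ᶠ x in l, f x ≤ a + η) :
    Tendsto f l (𝓝 a) := by
  refine tendsto_order.2 ⟨fun b hb => ?_, fun b hb => ?_⟩
  · filter_upwards [h1 ((a - b) / 2) (by linarith)] with x hx
    linarith
  · filter_upwards [h2 ((b - a) / 2) (by linarith)] with x hx
    linarith

/-- Below: every path crosses at class `M`, and its reversal crosses at class `M + 1`, which gives
the maximum. Above: both twist states are joined to the same wall, of rate `2π(M + 1) + α`. -/
theorem tendsto_mountainPassLevel (hL : 0 < L) (N : ℕ) (α : ℝ) (M : ℕ) :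
    Tendsto (fun ε => mountainPassLevel L N α ε M (M + 1)) (𝓝[>] 0)
      (𝓝 (max (limitTwistEnergy L N M α) (limitTwistEnergy L N (M + 1) α) + 2 * √2 / 3)) := by
  have hMM : Separated α M (ofCurve (twistState_mem α (M + 1))) :=
    Or.inr ⟨M + 1, by simp, rfl⟩
  have hMM' : Separated α (M + 1) (ofCurve (twistState_mem α M)) := Or.inr ⟨M, by simp, rfl⟩
  simp only [mountainPassLevel_eq]
  refine tendsto_of_eventually_le_add (fun η hη => ?_) fun η hη => ?_
  · filter_upwards [eventually_le_minimaxLevel hL N α M hη,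
      eventually_le_max_energy hL N α (M + 1) hη] with ε h1 h2
    rw [← max_add_add_right, ← max_sub_sub_right]
    refine max_le (h1 _ hMM) (le_minimaxLevel (continuous_modelEnergy L N α ε) fun γ => ?_)
    obtain ⟨t, ht⟩ := h2 _ hMM' γ.symm
    exact ⟨unitInterval.symm t, ht⟩
  · filter_upwards [eventually_joinedIn hL N α M (2 * Real.pi * (M + 1 : ℕ) + α) hη,
      eventually_joinedIn hL N α (M + 1) (2 * Real.pi * (M + 1 : ℕ) + α) hη,
      self_mem_nhdsWithin] with ε h1 h2 hε
    refine minimaxLevel_le (continuous_modelEnergy L N α ε)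
      ((h1 (wallRate_pos hε)).trans ((h2 (wallRate_pos hε)).mono fun f hf => ?_).symm)
    refine (mem_ofPred_eq ▸ hf : modelEnergy L N α ε f ≤ _).trans ?_
    rw [← limitTwistEnergy, max_self]
    gcongr
    exact le_max_right _ _

/-- In the limit the level exceeds both end energies by at least the wall cost `2√2/3`. -/
theorem eventually_isCriticalPoint_mountainPassLevel (hL : 0 < L) (N : ℕ) (α : ℝ) (M : ℕ) :
    ∀ᶠ ε in 𝓝[>] (0 : ℝ), ∃ w, IsCriticalPoint L N α ε w ∧
      energy L N ε w = mountainPassLevel L N α ε M (M + 1) := by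
  have hpos : 0 < 2 * √2 / 3 := by positivity
  have h0 := tendsto_mountainPassLevel hL N α M
  filter_upwards [(tendsto_energy_twistState L N α M).eventually_lt h0
      (by linarith [le_max_left (limitTwistEnergy L N M α) (limitTwistEnergy L N (M + 1) α)]),
    (tendsto_energy_twistState L N α (M + 1)).eventually_lt h0
      (by linarith [le_max_right (limitTwistEnergy L N M α) (limitTwistEnergy L N (M + 1) α)]),
    self_mem_nhdsWithin] with ε h1 h2 hε
  rw [mountainPassLevel_eq] at h1 h2 ⊢
  exact exists_isCriticalPoint_minimaxLevel hL hε h1 h2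

/-- The minimax level between a twist state and a wall without twist energy. -/
def wallLevel (L : ℝ) (N : ℕ) (α : ℝ) (M : ℕ) (ε : ℝ) : ℝ :=
  if hc : 0 < wallRate ε then
    minimaxLevel (modelEnergy L N α ε) (ofCurve (twistState_mem α M))
      (ofCurve (wallState_mem (α := α) (k := 2 * Real.pi * N) hc (Or.inl rfl)))
  else 0

theorem tendsto_wallLevel (hL : 0 < L) (N : ℕ) (α : ℝ) (M : ℕ) :
    Tendsto (wallLevel L N α M) (𝓝[>] 0) (𝓝 (limitTwistEnergy L N M α + 2 * √2 / 3)) := by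
  refine tendsto_of_eventually_le_add (fun η hη => ?_) fun η hη => ?_
  · filter_upwards [eventually_le_minimaxLevel hL N α M hη, self_mem_nhdsWithin] with ε h hε
    rw [wallLevel, dif_pos (wallRate_pos hε)]
    exact h _ (separated_wallState (wallRate_pos hε) M)
  · filter_upwards [eventually_joinedIn hL N α M (2 * Real.pi * N) hη, self_mem_nhdsWithin]
      with ε h hε
    rw [wallLevel, dif_pos (wallRate_pos hε)]
    refine minimaxLevel_le (continuous_modelEnergy L N α ε) ((h (wallRate_pos hε)).mono ?_)
    intro f hf
    refine (mem_ofPred_eq ▸ hf : modelEnergy L N α ε f ≤ _).trans ?_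
    have : max (limitTwistEnergy L N M α) (L / 2 * (2 * Real.pi * N - 2 * Real.pi * N) ^ 2)
        = limitTwistEnergy L N M α := by
      rw [sub_self]
      refine max_eq_left ?_
      unfold limitTwistEnergy
      simp only [ne_eq, OfNat.ofNat_ne_zero, not_false_eq_true, zero_pow, mul_zero]
      positivity
    rw [this]

/-- The twist state lies below the level by the wall cost, the wall by the twist energy of class
`M`. The latter gap is where `h` is needed; half of it absorbs the error in the energy of the wall.
-/
theorem eventually_isCriticalPoint_wallLevel (hL : 0 < L) {M : ℕ}
    (h : 0 < limitTwistEnergy L N M α) :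
    ∀ᶠ ε in 𝓝[>] (0 : ℝ), ∃ v, IsCriticalPoint L N α ε v ∧
      energy L N ε v = wallLevel L N α M ε := by
  have hpos : 0 < 2 * √2 / 3 := by positivity
  have h0 := tendsto_wallLevel hL N α M
  filter_upwards [(tendsto_energy_twistState L N α M).eventually_lt h0 (by linarith),
    h0.eventually (lt_mem_nhds (show 2 * √2 / 3 + limitTwistEnergy L N M α / 2
      < limitTwistEnergy L N M α + 2 * √2 / 3 by linarith)),
    eventually_energy_wallState_le hL N α |2 * Real.pi * N| (half_pos h),
    self_mem_nhdsWithin] with ε h1 h2 h3 hε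
  have h4 := h3 1 (by norm_num) _ le_rfl (Or.inl rfl)
  rw [sub_self, zero_pow two_ne_zero, mul_zero, zero_add] at h4
  rw [wallLevel, dif_pos (wallRate_pos hε)] at h1 h2 ⊢
  exact exists_isCriticalPoint_minimaxLevel hL hε h1
    ((modelEnergy_ofCurve _).trans_lt (h4.trans_lt h2))

theorem limitTwistEnergy_pos (hL : 0 < L) {M : ℕ} (hα : α ∈ Ico 0 (2 * Real.pi))
    (h : ¬(M = N ∧ α = 0)) : 0 < limitTwistEnergy L N M α := by
  unfold limitTwistEnergy
  suffices 2 * Real.pi * M + α - 2 * Real.pi * N ≠ 0 by positivity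
  intro h0
  have hπ := Real.two_pi_pos
  rcases lt_trichotomy M N with hlt | rfl | hlt
  · have : (M : ℝ) + 1 ≤ N := by exact_mod_cast hlt
    have := mul_le_mul_of_nonneg_left this hπ.le
    linarith [hα.2]
  · exact h ⟨rfl, by linarith⟩
  · have : (N : ℝ) + 1 ≤ M := by exact_mod_cast hlt
    have := mul_le_mul_of_nonneg_left this hπ.le
    linarith [hα.1]

end Cholesteric

end

/-! ### The main theorem. -/

theorem theorem4p2 (L : ℝ) (hL : 0 < L) (N : ℕ) (hN : 0 < N) (M : ℕ) (hM : 0 < M)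
    (α : ℝ) (hα : α ∈ Set.Ico 0 (2 * Real.pi)) :
    (¬ (M = N ∧ α = 0) →
      ∃ v : ℝ → ℝ → ℂ,
        (∀ ε : ℝ, 0 < ε → Cholesteric.IsCriticalPoint L N α ε (v ε)) ∧
        Tendsto (fun ε => Cholesteric.energy L N ε (v ε)) (𝓝[>] 0)
          (𝓝 (2 * Real.pi ^ 2 * L * ((N : ℝ) - M - α / (2 * Real.pi)) ^ 2
            + 2 * Real.sqrt 2 / 3))) ∧
    (∃ ε₀ : ℝ, 0 < ε₀ ∧ ∀ ε : ℝ, 0 < ε → ε < ε₀ →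
      ∃ w : ℝ → ℂ, Cholesteric.IsCriticalPoint L N α ε w ∧
        Cholesteric.energy L N ε w = Cholesteric.mountainPassLevel L N α ε M (M + 1)) ∧
    Tendsto (fun ε => Cholesteric.mountainPassLevel L N α ε M (M + 1)) (𝓝[>] 0)
      (𝓝 (2 * Real.pi ^ 2 * L *
          max (((N : ℝ) - M - α / (2 * Real.pi)) ^ 2)
            (((N : ℝ) - (M + 1) - α / (2 * Real.pi)) ^ 2)
        + 2 * Real.sqrt 2 / 3)) := by
  refine ⟨fun h => ?_, ?_, ?_⟩
  · have hev := Cholesteric.eventually_isCriticalPoint_wallLevel hL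
      (Cholesteric.limitTwistEnergy_pos hL hα h)
    -- A critical point is required for every `ε > 0`, but the minimax level is known to be critical
    -- only for small `ε`. Where it is not attained by a critical point, one from
    -- `exists_isCriticalPoint` is used, which does not affect the limit.
    have hex : ∀ ε : ℝ, ∃ v : ℝ → ℂ, 0 < ε → Cholesteric.IsCriticalPoint L N α ε v ∧
        ((∃ w, Cholesteric.IsCriticalPoint L N α ε w ∧
            Cholesteric.energy L N ε w = Cholesteric.wallLevel L N α M ε) →
          Cholesteric.energy L N ε v = Cholesteric.wallLevel L N α M ε) := fun ε => by
      by_cases hw : ∃ w, Cholesteric.IsCriticalPoint L N α ε w ∧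
        Cholesteric.energy L N ε w = Cholesteric.wallLevel L N α M ε
      · obtain ⟨w, hw1, hw2⟩ := hw
        exact ⟨w, fun _ => ⟨hw1, fun _ => hw2⟩⟩
      · by_cases hε : 0 < ε
        · obtain ⟨v, hv⟩ := Cholesteric.exists_isCriticalPoint (N := N) (α := α) hL hε
          exact ⟨v, fun _ => ⟨hv, fun h => absurd h hw⟩⟩
        · exact ⟨0, fun h => absurd h hε⟩
    choose v hv using hex
    refine ⟨v, fun ε hε => (hv ε hε).1, ?_⟩
    rw [← Cholesteric.limitTwistEnergy_eq]
    refine (Cholesteric.tendsto_wallLevel hL N α M).congr' ?_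
    filter_upwards [hev, self_mem_nhdsWithin] with ε h1 hε
    exact ((hv ε hε).2 h1).symm
  · obtain ⟨ε₀, hε₀, h⟩ := mem_nhdsGT_iff_exists_Ioo_subset.1
      (Cholesteric.eventually_isCriticalPoint_mountainPassLevel hL N α M)
    exact ⟨ε₀, hε₀, fun ε h1 h2 => h ⟨h1, h2⟩⟩
  · have h := Cholesteric.tendsto_mountainPassLevel hL N α M
    rw [Cholesteric.limitTwistEnergy_eq, Cholesteric.limitTwistEnergy_eq,
      ← mul_max_of_nonneg _ _ (by positivity), Nat.cast_add_one] at h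
    exact h
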